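/- Let $n\ge 1$, $1<p<\infty$, $\Lambda\ge 1$. There is a constant $C\ge 1$, depending only on $n,p,\Lambda$, such that the following holds. Let $s\in(0,1)$, $\xi\ge 1$, and let $K=K(x,y,t)$ be a measurable kernel with $\Lambda^{-1}|x-y|^{-(n+sp)}\le K(x,y,t)\le \Lambda|x-y|^{-(n+sp)}$ for $x\ne y$. Let $x_0\in\mathbb R^n$, $r>0$, $B_r=B_r(x_0)$, $\tau_1<\tau_2$. Let $u\in L^p(\tau_1,\tau_2;W^{s,p}(\mathbb R^n))$ be a subsolution of $\partial_tu+Lu=0$ in $B_r\times(\tau_1,\tau_2)$, that is, $$\int_{\tau_1}^{\tau_2}\!\int_{\mathbb R^n}\!\int_{\mathbb R^n}K(x,y,t)|u(x,t)-u(y,t)|^{p-2}(u(x,t)-u(y,t))(\eta(x,t)-\eta(y,t))\,dx\,dy\,dt-\int_{\tau_1}^{\tau_2}\!\int_{\mathbb R^n}u\,\partial_t\eta\,dx\,dt\le 0$$ for all $\eta\ge0$ in $L^p(\tau_1,\tau_2;W^{s,p}_0(B_r))$ with $\partial_t\eta\in L^{p'}(\tau_1,\tau_2;(W^{s,p}(B_r))^*)$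 and $\eta(\cdot,\tau_1)=\eta(\cdot,\tau_2)=0$. Here $p'=p/(p-1)$, $W^{s,p}_0(B_r)$ consists of the functions in $W^{s,p}(\mathbb R^n)$ that vanish outside $B_r$, and the last integral is a duality pairing. Assume $u\ge 0$ a.e. in $B_r\times(\tau_1,\tau_2)$. Let $d>0$, $v=u+d$, $w=v^{(p-1+\xi)/p}$, and $\phi(x,t)=\psi(x)\zeta(t)$ with $\psi\in C_0^\infty(B_r)$, $\zeta\in C_0^\infty(\tau_1,\tau_2)$; write $\phi^p$ for $|\phi|^p$. For $\tau_1\le a<b\le\tau_2$ set $$E(a,b)=\int_a^b\!\int_{B_r}\!\int_{B_r}|w\phi(x,t)-w\phi(y,t)|^pK(x,y,t)\,dx\,dy\,dt,\qquad A(t)=\frac1{1+\xi}\int_{B_r}v(x,t)^{1+\xi}\phi^p(x,t)\,dx,$$ $$I_1(a,b)=\int_a^b\!\int_{B_r}\!\int_{B_r}\max\{w(x,t),w(y,t)\}^p\frac{|\phi(x,t)-\phi(y,t)|^p}{|x-y|^{n+sp}}\,dx\,dy\,dt,$$ $$I_2(a,b)=\Big(\sup_{x\in\operatorname{supp}\psi}\int_{\mathbb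 R^n\setminus B_r}\frac{dy}{|x-y|^{n+sp}}\Big)\int_a^b\!\int_{B_r}w^p\phi^p\,dx\,dt,$$ $$I_3(a,b)=\int_a^b\Big(\sup_{x\in\operatorname{supp}\psi}\int_{\mathbb R^n\setminus B_r}\frac{u_+(y,t)^{p-1}}{|x-y|^{n+sp}}\,dy\Big)\Big(\int_{B_r}v^\xi\phi^p\,dx\Big)dt,$$ $$I_4(a,b)=\frac1{1+\xi}\int_a^b\!\int_{B_r}v^{1+\xi}(\partial_t\phi^p)_+\,dx\,dt .$$ All these quantities take values in $[0,\infty]$. (i) Let $\tau_1<t_1<t_2<\tau_2$, where $t_1,t_2$ are Lebesgue instants for $u$, i.e. for $t\in\{t_1,t_2\}$ one has $\lim_{h\to0^+}\int_{B_r}|u_h(x,t)-u(x,t)|^2dx=0$, where $u_h(x,t)=\int u(x,\sigma)\rho_h(t-\sigma)\,d\sigma$, $\rho_h(\sigma)=h^{-1}\rho(\sigma/h)$, and $\rho\ge 0$ is a smooth even function supported in $[-1,1]$ with $\int\rho=1$. Then $$\frac{1}{C\,\xi^{p-1}}E(t_1,t_2)+A(t_2)\le A(t_1)+C\,I_1(t_1,t_2)+C\,I_2(t_1,t_2)+C\,I_3(t_1,t_2)+I_4(t_1,t_2).$$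 (ii) Moreover, $$\frac{1}{\xi^{p-1}}E(\tau_1,\tau_2)+\operatorname*{ess\,sup}_{\tau_1<t<\tau_2}A(t)\le C\big(I_1+I_2+I_3+I_4\big)(\tau_1,\tau_2).$$ -/

import Mathlib

open MeasureTheory Set Filter Topology
open scoped ENNReal ContDiff

namespace FracParabolic

/-- `ℝⁿ` with its Euclidean norm and Lebesgue measure. -/
abbrev Rn (n : ℕ) : Type := EuclideanSpace ℝ (Fin n)

/-- The singular kernel `|x - y| ^ (-(n + s p))`. -/
noncomputable def singKernel {n : ℕ} (s p : ℝ) (x y : Rn n) : ℝ :=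
  ‖x - y‖ ^ (-((n : ℝ) + s * p))

/-- Measurability and two-sided ellipticity of the kernel `K(x, y, t)`. -/
structure IsEllipticKernel {n : ℕ} (s p Λ : ℝ) (K : Rn n → Rn n → ℝ → ℝ) : Prop where
  measurable : Measurable fun q : Rn n × Rn n × ℝ => K q.1 q.2.1 q.2.2
  lower : ∀ x y t, x ≠ y → Λ⁻¹ * singKernel s p x y ≤ K x y t
  upper : ∀ x y t, x ≠ y → K x y t ≤ Λ * singKernel s p x y

/-! ### Fractional Sobolev spaces -/

/-- `∫_D ∫_D |f(x) - f(y)|^p / |x - y|^(n + s p) dx dy`. -/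
noncomputable def gagliardo {n : ℕ} (s p : ℝ) (D : Set (Rn n)) (f : Rn n → ℝ) : ℝ≥0∞ :=
  ∫⁻ x in D, ∫⁻ y in D, ENNReal.ofReal (|f x - f y| ^ p * singKernel s p x y)

/-- The norm `‖f‖_{L^p(D)} + (∫_D ∫_D |f(x) - f(y)|^p / |x - y|^(n + s p) dx dy)^(1/p)`. -/
noncomputable def sobolevNorm {n : ℕ} (s p : ℝ) (D : Set (Rn n)) (f : Rn n → ℝ) : ℝ≥0∞ :=
  (∫⁻ x in D, ENNReal.ofReal (|f x| ^ p)) ^ (1 / p) + gagliardo s p D f ^ (1 / p)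

/-- `f ∈ W^{s,p}(D)`; only the values of `f` on `D` matter. -/
def MemW {n : ℕ} (s p : ℝ) (D : Set (Rn n)) (f : Rn n → ℝ) : Prop :=
  AEStronglyMeasurable f (volume.restrict D) ∧ sobolevNorm s p D f < ⊤

/-- `u ∈ L^p(a, b; W^{s,p}(D))`. -/
def MemLpW {n : ℕ} (s p : ℝ) (D : Set (Rn n)) (a b : ℝ) (u : Rn n → ℝ → ℝ) : Prop :=
  AEStronglyMeasurable (fun q : Rn n × ℝ => u q.1 q.2) (volume.restrict (D ×ˢ Ioo a b)) ∧
    ∫⁻ t in Ioo a b, sobolevNorm s p D (fun x => u x t) ^ p < ⊤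

/-! ### Subsolutions -/

/-- `η' ∈ L^{p'}(a, b; (W^{s,p}(Ω))^*)`, where `p' = p / (p - 1)`: for almost every `t` the value
`η' t` is a bounded linear functional on `W^{s,p}(Ω)`, weakly measurable in `t`, and its norm is dominated by a
function in `L^{p'}(a, b)`. -/
structure MemLpDual {n : ℕ} (s p : ℝ) (Ω : Set (Rn n)) (a b : ℝ)
    (η' : ℝ → (Rn n → ℝ) → ℝ) : Prop where
  linear : ∀ᵐ t ∂(volume.restrict (Ioo a b)), ∀ f g : Rn n → ℝ, MemW s p Ω f → MemW s p Ω g →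
    ∀ c : ℝ, η' t (fun x => c * f x + g x) = c * η' t f + η' t g
  measurable : ∀ f : Rn n → ℝ, MemW s p Ω f →
    AEStronglyMeasurable (fun t => η' t f) (volume.restrict (Ioo a b))
  bound : ∃ N : ℝ → ℝ≥0∞, Measurable N ∧ ∫⁻ t in Ioo a b, N t ^ (p / (p - 1)) < ⊤ ∧
    ∀ᵐ t ∂(volume.restrict (Ioo a b)), ∀ f : Rn n → ℝ, MemW s p Ω f →
      ENNReal.ofReal |η' t f| ≤ N t * sobolevNorm s p Ω f

/-- Admissible test functions `η` on `Ω × (a, b)` with time derivative `∂ₜη = η'`: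
`η ∈ L^p(a, b; W₀^{s,p}(Ω))`, `∂ₜη ∈ L^{p'}(a, b; (W^{s,p}(Ω))^*)`, and `η` vanishes at the times
`a` and `b`. As usual `η` stands for its representative that is continuous in time, so that
`∂ₜη = η'` means `∫_Ω η(x, t₂) f(x) dx - ∫_Ω η(x, t₁) f(x) dx = ∫_{t₁}^{t₂} ⟨η'(t), f⟩ dt`; it is
enough to ask this for bounded `f`, since these are dense in `W^{s,p}(Ω)`. -/
structure IsTestFunction {n : ℕ} (s p : ℝ) (Ω : Set (Rn n)) (a b : ℝ)
    (η : Rn n → ℝ → ℝ) (η' : ℝ → (Rn n → ℝ) → ℝ) : Prop where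
  mem : MemLpW s p univ a b η
  zero_outside : ∀ᵐ t ∂(volume.restrict (Ioo a b)), ∀ᵐ x ∂(volume : Measure (Rn n)),
    x ∉ Ω → η x t = 0
  deriv_mem : MemLpDual s p Ω a b η'
  integrable_slice : ∀ t ∈ Icc a b, IntegrableOn (fun x => η x t) Ω
  deriv_eq : ∀ f : Rn n → ℝ, MemW s p Ω f → (∃ M : ℝ, ∀ x, |f x| ≤ M) →
    ∀ t₁ t₂ : ℝ, a ≤ t₁ → t₁ ≤ t₂ → t₂ ≤ b →
      (∫ x in Ω, η x t₂ * f x) - (∫ x in Ω, η x t₁ * f x) = ∫ t in t₁..t₂, η' t f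
  zero_ends : ∀ x ∈ Ω, η x a = 0 ∧ η x b = 0

/-- `𝒜u(x,y,t) = K(x,y,t) |u(x,t) - u(y,t)|^(p-2) (u(x,t) - u(y,t))`. -/
noncomputable def opA {n : ℕ} (p : ℝ) (K : Rn n → Rn n → ℝ → ℝ) (u : Rn n → ℝ → ℝ)
    (x y : Rn n) (t : ℝ) : ℝ :=
  K x y t * |u x t - u y t| ^ (p - 2) * (u x t - u y t)

/-- `u` is a weak subsolution of `∂ₜu + Lu = 0` in `Ω × (a, b)`. The integral of `u ∂ₜη` is the
duality pairing of `∂ₜη(t)` with `u(·, t)`. -/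
structure IsSubsolution {n : ℕ} (s p : ℝ) (K : Rn n → Rn n → ℝ → ℝ) (Ω : Set (Rn n)) (a b : ℝ)
    (u : Rn n → ℝ → ℝ) : Prop where
  mem : MemLpW s p univ a b u
  ineq : ∀ (η : Rn n → ℝ → ℝ) (η' : ℝ → (Rn n → ℝ) → ℝ), IsTestFunction s p Ω a b η η' →
    (∀ x, ∀ t ∈ Icc a b, 0 ≤ η x t) →
      (∫ t in Ioo a b, ∫ x, ∫ y, opA p K u x y t * (η x t - η y t)) -
        (∫ t in Ioo a b, η' t (fun x => u x t)) ≤ 0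

/-! ### Lebesgue instants -/

/-- `ρ` is a standard mollifier on `ℝ` (of width one). -/
structure IsMollifier (ρ : ℝ → ℝ) : Prop where
  smooth : ContDiff ℝ ∞ ρ
  nonneg : ∀ σ, 0 ≤ ρ σ
  even : ∀ σ, ρ (-σ) = ρ σ
  support_subset : tsupport ρ ⊆ Icc (-1) 1
  integral_eq_one : ∫ σ, ρ σ = 1

/-- The mollification in time `u_h(x,t) = ∫ u(x,σ) ρ_h(t - σ) dσ`, where `ρ_h(σ) = ρ(σ/h)/h`. -/
noncomputable def timeMollify {n : ℕ} (ρ : ℝ → ℝ) (h : ℝ) (u : Rn n → ℝ → ℝ)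
    (x : Rn n) (t : ℝ) : ℝ :=
  ∫ σ, u x σ * (h⁻¹ * ρ ((t - σ) / h))

/-- `t` is a Lebesgue instant for `u` on `Ω`: `∫_Ω |u_h(x,t) - u(x,t)|² dx → 0` as `h → 0`. -/
def IsLebesgueInstant {n : ℕ} (ρ : ℝ → ℝ) (Ω : Set (Rn n)) (u : Rn n → ℝ → ℝ) (t : ℝ) : Prop :=
  AEStronglyMeasurable (fun x => u x t) (volume.restrict Ω) ∧
    Tendsto (fun h : ℝ => ∫⁻ x in Ω, ENNReal.ofReal (|timeMollify ρ h u x t - u x t| ^ 2))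
      (𝓝[>] 0) (𝓝 0)

/-! ### The quantities in the Caccioppoli estimate

Below `v` is the function `u + d`, `φ` is the cut-off, and the powers of `φ` are powers of `|φ|`. -/

/-- `w = v^((p - 1 + ξ)/p)`. -/
noncomputable def wPow {n : ℕ} (p ξ : ℝ) (v : Rn n → ℝ → ℝ) (x : Rn n) (t : ℝ) : ℝ :=
  v x t ^ ((p - 1 + ξ) / p)

/-- `∫_{a}^{b} ∫_B ∫_B |wφ(x,t) - wφ(y,t)|^p K(x,y,t) dx dy dt`. -/
noncomputable def energy {n : ℕ} (p ξ : ℝ) (K : Rn n → Rn n → ℝ → ℝ) (B : Set (Rn n)) (a b : ℝ)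
    (v φ : Rn n → ℝ → ℝ) : ℝ≥0∞ :=
  ∫⁻ t in Ioo a b, ∫⁻ x in B, ∫⁻ y in B,
    ENNReal.ofReal (|wPow p ξ v x t * φ x t - wPow p ξ v y t * φ y t| ^ p * K x y t)

/-- `(1/(1+ξ)) ∫_B v(x,t)^(1+ξ) φ(x,t)^p dx`. -/
noncomputable def sliceTerm {n : ℕ} (p ξ : ℝ) (B : Set (Rn n)) (v φ : Rn n → ℝ → ℝ)
    (t : ℝ) : ℝ≥0∞ :=
  ENNReal.ofReal (1 / (1 + ξ)) * ∫⁻ x in B, ENNReal.ofReal (v x t ^ (1 + ξ) * |φ x t| ^ p)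

/-- `∫_a^b ∫_B ∫_B max{w(x,t), w(y,t)}^p |φ(x,t) - φ(y,t)|^p |x - y|^(-(n+sp)) dx dy dt`. -/
noncomputable def cutoffTerm {n : ℕ} (s p ξ : ℝ) (B : Set (Rn n)) (a b : ℝ)
    (v φ : Rn n → ℝ → ℝ) : ℝ≥0∞ :=
  ∫⁻ t in Ioo a b, ∫⁻ x in B, ∫⁻ y in B,
    ENNReal.ofReal (max (wPow p ξ v x t) (wPow p ξ v y t) ^ p * |φ x t - φ y t| ^ p *
      singKernel s p x y)

/-- `(sup_{x ∈ S} ∫_{ℝⁿ∖B} |x - y|^(-(n+sp)) dy) (∫_a^b ∫_B w^p φ^p dx dt)`. -/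
noncomputable def farTerm {n : ℕ} (s p ξ : ℝ) (S B : Set (Rn n)) (a b : ℝ)
    (v φ : Rn n → ℝ → ℝ) : ℝ≥0∞ :=
  (⨆ x ∈ S, ∫⁻ y in Bᶜ, ENNReal.ofReal (singKernel s p x y)) *
    ∫⁻ t in Ioo a b, ∫⁻ x in B, ENNReal.ofReal (wPow p ξ v x t ^ p * |φ x t| ^ p)

/-- `∫_a^b (sup_{x ∈ S} ∫_{ℝⁿ∖B} u₊(y,t)^(p-1) |x - y|^(-(n+sp)) dy) (∫_B v^ξ φ^p dx) dt`. -/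
noncomputable def tailTerm {n : ℕ} (s p ξ : ℝ) (S B : Set (Rn n)) (a b : ℝ)
    (u v φ : Rn n → ℝ → ℝ) : ℝ≥0∞ :=
  ∫⁻ t in Ioo a b,
    (⨆ x ∈ S, ∫⁻ y in Bᶜ, ENNReal.ofReal (max (u y t) 0 ^ (p - 1) * singKernel s p x y)) *
      ∫⁻ x in B, ENNReal.ofReal (v x t ^ ξ * |φ x t| ^ p)

/-- `(1/(1+ξ)) ∫_a^b ∫_B v^(1+ξ) (∂ₜ φ^p)₊ dx dt`. -/
noncomputable def timeTerm {n : ℕ} (p ξ : ℝ) (B : Set (Rn n)) (a b : ℝ)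
    (v φ : Rn n → ℝ → ℝ) : ℝ≥0∞ :=
  ENNReal.ofReal (1 / (1 + ξ)) * ∫⁻ t in Ioo a b, ∫⁻ x in B,
    ENNReal.ofReal (v x t ^ (1 + ξ) * max (deriv (fun τ => |φ x τ| ^ p) t) 0)

end FracParabolic

/-! Formally the estimate comes from testing the equation with `v^ξ φ^p` on `[t₁, t₂]`. The time
derivative becomes that of `v^(1+ξ)/(1+ξ)`, which produces the two slice terms and `I₄`. In the
nonlocal term the pairs inside `B × B` yield the energy of `wφ` minus `I₁`. For a pair with one
point `y` outside `B`, where `u` has no sign, `u(x) ≥ 0` gives `|u(x) - u(y)|^(p-2) (u(x) - u(y)) ≥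
-u₊(y)^(p-1)`, so these pairs cost only `I₃`; the term `I₂` is nonnegative and is added at the end.

The pointwise core is `energy_le_form`. The power is truncated as `H(τ) = τ min(τ, M)^(pq)`, and `w`
correspondingly as `W(τ) = τ min(τ, M)^q`, with `q = (ξ-1)/p`. These functions satisfy `W^p =
τ^(p-1) H` for every `τ`, beyond `M` as well, and this homogeneity lets Young's inequality absorb
the cut-off error exactly as in the untruncated case. The factor `(1+q)^(p-1) ≤ ξ^(p-1)` is the only
loss in `ξ`.

The formal test function is not admissible: `u` has no time derivative, `v^ξ` may be unbounded, and
the restriction to `[t₁, t₂]` jumps. Three regularisations are made. In time, with `u_h = κ * u` and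
`G = Γ(u_h) ψ^p ζ^p 1_[t₁,t₂]`, the test function is `κ * G`. Evenness of `κ` transposes the outer
mollification onto `u`, so the time term is `-∫ Γ(u_h) ∂ₜu_h ψ^p ζ^p`, a total derivative of a
primitive up to the derivative of `ζ^p` (`IsSubsolution.mollified_le`). In size, the profile is
linear beyond the level `M`, which keeps it Lipschitz, and frozen beyond `N`, which makes it
bounded.

The limits are taken in this order. As `h → 0` (`IsSubsolution.profile_le`), the differences
weighted by `|x-y|^(-(n+sp)/p)` commute with time mollification, so they converge in `L^p` and pair
with a fixed flux in `L^(p')`; the slices need only `L¹` convergence because the primitives are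
Lipschitz. Next the cap is removed from the flux by domination (`IsSubsolution.powProfile_le`).
Finally Fatou's lemma with `M = N + 1 → ∞` recovers the energy and the final slice
(`IsSubsolution.caccioppoli`).

For (i), convergence of the slices is the Lebesgue instant hypothesis. For (ii), a subsequence of
mollifiers gives it at almost every time; the inequality is started before the support of `ζ`, where
the initial slice vanishes. -/

namespace FracParabolic

/-! ### Algebraic inequalities for truncated powers -/

/-- `τ ↦ τ min(τ, M)^q`, a power `τ^(1+q)` continued linearly beyond `M`. -/
noncomputable def truncMul (q M τ : ℝ) : ℝ := τ * min τ M ^ q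

theorem truncMul_nonneg {q M τ : ℝ} (hM : 0 ≤ M) (hτ : 0 ≤ τ) : 0 ≤ truncMul q M τ :=
  mul_nonneg hτ (Real.rpow_nonneg (le_min hτ hM) _)

/-- The slope of the truncated power is at most `1 + q` times `min a M ^ q`, but it has a kink at
`M`. Scaling avoids differentiation: with `ρ = b / a ≤ 1` one has `min b M ≥ ρ min a M`, and
Bernoulli's inequality bounds `ρ^(1+q)` from below by its tangent at `1`. -/
theorem truncMul_sub_le {q M a b : ℝ} (hq : 0 ≤ q) (hM : 0 < M) (hb : 0 < b) (hab : b ≤ a) :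
    truncMul q M a - truncMul q M b ≤ (1 + q) * min a M ^ q * (a - b) := by
  have ha : 0 < a := hb.trans_le hab
  have hma : 0 < min a M := lt_min ha hM
  have hr : 0 ≤ b / a := by positivity
  have hr1 : b / a ≤ 1 := (div_le_one ha).2 hab
  have h1 : min a M * (b / a) ≤ min b M := by
    apply le_min
    · calc min a M * (b / a) ≤ a * (b / a) := by gcongr; exact min_le_left _ _
        _ = b := by field_simp
    · calc min a M * (b / a) ≤ M * 1 := by gcongr; exact min_le_right _ _
        _ = M := mul_one M
  have h2 : min a M ^ q * (b / a) ^ q ≤ min b M ^ q := by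
    rw [← Real.mul_rpow hma.le hr]
    exact Real.rpow_le_rpow (by positivity) h1 hq
  have h3 : 1 + (1 + q) * (b / a - 1) ≤ (b / a) ^ (1 + q) := by
    have := one_add_mul_self_le_rpow_one_add (s := b / a - 1) (by linarith) (p := 1 + q)
      (by linarith)
    simpa using this
  have h4 : (b / a) ^ (1 + q) = (b / a) * (b / a) ^ q := by
    rw [Real.rpow_add (by positivity), Real.rpow_one]
  have h5 : a * (1 + (1 + q) * (b / a - 1)) = a - (1 + q) * (a - b) := by
    field_simp; ring
  have h6 : a - (1 + q) * (a - b) ≤ b * (b / a) ^ q := by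
    rw [← h5]
    calc a * (1 + (1 + q) * (b / a - 1)) ≤ a * (b / a) ^ (1 + q) := by gcongr
      _ = b * (b / a) ^ q := by rw [h4]; field_simp
  have hmq : 0 ≤ min a M ^ q := Real.rpow_nonneg hma.le _
  unfold truncMul
  have h7 : b * (min a M ^ q * (b / a) ^ q) ≤ b * min b M ^ q := by gcongr
  nlinarith [mul_le_mul_of_nonneg_left h6 hmq]

theorem le_truncMul_sub {q M a b : ℝ} (hq : 0 ≤ q) (hM : 0 < M) (hb : 0 < b) (hab : b ≤ a) :
    min a M ^ q * (a - b) ≤ truncMul q M a - truncMul q M b := by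
  have h : min b M ^ q ≤ min a M ^ q :=
    Real.rpow_le_rpow (le_min hb.le hM.le) (min_le_min_right M hab) hq
  unfold truncMul
  nlinarith

theorem truncMul_mono {q M a b : ℝ} (hq : 0 ≤ q) (hM : 0 < M) (hb : 0 < b) (hab : b ≤ a) :
    truncMul q M b ≤ truncMul q M a := by
  have := le_truncMul_sub hq hM hb hab
  have h0 : 0 ≤ min a M ^ q * (a - b) :=
    mul_nonneg (Real.rpow_nonneg (le_min (hb.le.trans hab) hM.le) _) (by linarith)
  linarith

/-- A discrete chain rule. Of the `p` factors on the left, `p - 1` are estimated by the slope at the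
larger point; the weight `min a M ^ (q(p-1))` they release raises the remaining difference from
exponent `q` to `pq = q(p-1) + q`. -/
theorem truncMul_sub_rpow_le {p q M a b : ℝ} (hp : 1 < p) (hq : 0 ≤ q) (hM : 0 < M) (hb : 0 < b)
    (hab : b ≤ a) :
    (truncMul q M a - truncMul q M b) ^ p ≤
      (1 + q) ^ (p - 1) * ((a - b) ^ (p - 1) *
        (truncMul (p * q) M a - truncMul (p * q) M b)) := by
  have ha : 0 < a := hb.trans_le hab
  have hma : 0 < min a M := lt_min ha hM
  have hmb : 0 < min b M := lt_min hb hM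
  have hD : 0 ≤ truncMul q M a - truncMul q M b := sub_nonneg.2 (truncMul_mono hq hM hb hab)
  have h1 : (truncMul q M a - truncMul q M b) ^ (p - 1) ≤
      (1 + q) ^ (p - 1) * min a M ^ (q * (p - 1)) * (a - b) ^ (p - 1) := by
    rw [Real.rpow_mul hma.le, ← Real.mul_rpow (by linarith) (Real.rpow_nonneg hma.le _),
      ← Real.mul_rpow (mul_nonneg (by linarith) (Real.rpow_nonneg hma.le _)) (by linarith)]
    exact Real.rpow_le_rpow hD (truncMul_sub_le hq hM hb hab) (by linarith)
  have h2 : min a M ^ (q * (p - 1)) * (truncMul q M a - truncMul q M b) ≤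
      truncMul (p * q) M a - truncMul (p * q) M b := by
    have e : p * q = q * (p - 1) + q := by ring
    unfold truncMul
    rw [e, Real.rpow_add hma, Real.rpow_add hmb]
    have h : min b M ^ (q * (p - 1)) ≤ min a M ^ (q * (p - 1)) :=
      Real.rpow_le_rpow hmb.le (min_le_min_right M hab) (mul_nonneg hq (by linarith))
    have h' : 0 ≤ b * min b M ^ q := mul_nonneg hb.le (Real.rpow_nonneg hmb.le _)
    nlinarith [mul_le_mul_of_nonneg_right h h']
  have h3 : (truncMul q M a - truncMul q M b) ^ p =
      (truncMul q M a - truncMul q M b) ^ (p - 1) * (truncMul q M a - truncMul q M b) := by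
    conv_rhs => rw [← Real.rpow_one (truncMul q M a - truncMul q M b), Real.rpow_one,
      ← Real.rpow_add_one' hD (by linarith)]
    congr 1; ring
  rw [h3]
  calc _ ≤ (1 + q) ^ (p - 1) * min a M ^ (q * (p - 1)) * (a - b) ^ (p - 1) *
        (truncMul q M a - truncMul q M b) := by gcongr
    _ = (1 + q) ^ (p - 1) * ((a - b) ^ (p - 1) *
        (min a M ^ (q * (p - 1)) * (truncMul q M a - truncMul q M b))) := by ring
    _ ≤ _ := by
        have : 0 ≤ (a - b) ^ (p - 1) := Real.rpow_nonneg (by linarith) _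
        have : 0 ≤ (1 + q) ^ (p - 1) := Real.rpow_nonneg (by linarith) _
        gcongr

/-- Convexity of the `p`-th power, read off from Bernoulli's inequality for `α / β`. -/
theorem rpow_sub_rpow_le {p α β : ℝ} (hp : 1 < p) (hα : 0 ≤ α) (hβ : 0 < β) :
    β ^ p - α ^ p ≤ p * β ^ (p - 1) * (β - α) := by
  have h := one_add_mul_self_le_rpow_one_add (s := α / β - 1)
    (by have : 0 ≤ α / β := by positivity
        linarith) hp.le
  rw [add_sub_cancel, Real.div_rpow hα hβ.le, le_div_iff₀ (by positivity)] at h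
  have e : β ^ p = β ^ (p - 1) * β := by
    rw [← Real.rpow_add_one hβ.ne']; congr 1; ring
  have h' : (1 + p * (α / β - 1)) * β ^ p = β ^ p - p * β ^ (p - 1) * (β - α) := by
    rw [e]; field_simp; ring
  linarith

/-- Young's inequality by cases: if `2pδ ≤ X` the left side is at most half of `X^p`, and otherwise
`X^(p-1)` is controlled by `δ^(p-1)`. -/
theorem mul_rpow_sub_one_le {p X δ : ℝ} (hp : 1 < p) (hX : 0 ≤ X) (hδ : 0 ≤ δ) :
    p * X ^ (p - 1) * δ ≤ 1 / 2 * X ^ p + p * (2 * p) ^ (p - 1) * δ ^ p := by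
  have split : ∀ z : ℝ, 0 ≤ z → z ^ p = z ^ (p - 1) * z := fun z hz => by
    rw [← Real.rpow_add_one' hz (by linarith)]; congr 1; ring
  have hX' := Real.rpow_nonneg hX (p - 1)
  have hδ' := Real.rpow_nonneg hδ (p - 1)
  have hp' : (0 : ℝ) ≤ (2 * p) ^ (p - 1) := Real.rpow_nonneg (by linarith) _
  rw [split X hX, split δ hδ]
  rcases le_total (2 * p * δ) X with h | h
  · have : 0 ≤ p * (2 * p) ^ (p - 1) * (δ ^ (p - 1) * δ) := by positivity
    nlinarith
  · have h1 : X ^ (p - 1) ≤ (2 * p) ^ (p - 1) * δ ^ (p - 1) := by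
      rw [← Real.mul_rpow (by linarith) hδ]
      exact Real.rpow_le_rpow hX h (by linarith)
    have : 0 ≤ 1 / 2 * (X ^ (p - 1) * X) := by positivity
    have h2 : p * X ^ (p - 1) * δ ≤ p * ((2 * p) ^ (p - 1) * δ ^ (p - 1)) * δ := by gcongr
    linarith

theorem add_rpow_le_two_rpow {p a b : ℝ} (hp : 1 ≤ p) (ha : 0 ≤ a) (hb : 0 ≤ b) :
    (a + b) ^ p ≤ 2 ^ (p - 1) * (a ^ p + b ^ p) := by
  have := NNReal.rpow_add_le_mul_rpow_add_rpow ⟨a, ha⟩ ⟨b, hb⟩ hp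
  exact_mod_cast this

/-- The constant in `energy_le_form`. -/
noncomputable def formConst (p : ℝ) : ℝ := 2 ^ p * (p * (2 * p) ^ (p - 1)) + 2 ^ p

theorem formConst_nonneg {p : ℝ} (hp : 1 < p) : 0 ≤ formConst p := by
  have : (0 : ℝ) ≤ (2 * p) ^ (p - 1) := Real.rpow_nonneg (by linarith) _
  have : (0 : ℝ) ≤ 2 ^ p := by positivity
  unfold formConst; positivity

/-- When the larger cut-off value sits at the larger point `a`, enlarging `β` to `α` only lowers the
form and nothing is lost. Otherwise the loss is `(a-b)^(p-1) H(a) (β^p - α^p)`. Convexity and Young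
bound it by half of the good term plus `W(a)^p |α-β|^p`; doubling then absorbs the half, whence the
factors `2`. -/
theorem form_lower_bound {p q M a b α β : ℝ} (hp : 1 < p) (hq : 0 ≤ q) (hM : 0 < M) (hb : 0 < b)
    (hab : b ≤ a) (hα : 0 ≤ α) (hβ : 0 ≤ β) :
    (1 + q) ^ (1 - p) * ((truncMul q M a - truncMul q M b) ^ p * max α β ^ p) ≤
      2 * ((a - b) ^ (p - 1) * (truncMul (p * q) M a * α ^ p - truncMul (p * q) M b * β ^ p)) +
        2 * (p * (2 * p) ^ (p - 1)) * (truncMul q M a ^ p * |α - β| ^ p) := by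
  have ha : 0 < a := hb.trans_le hab
  have hma : 0 < min a M := lt_min ha hM
  have hpq : 0 ≤ p * q := mul_nonneg (by linarith) hq
  set Ha := truncMul (p * q) M a
  set Hb := truncMul (p * q) M b
  have hHb : 0 ≤ Hb := truncMul_nonneg hM.le hb.le
  have hHa : 0 ≤ Ha := truncMul_nonneg hM.le ha.le
  have hHab : Hb ≤ Ha := truncMul_mono hpq hM hb hab
  have hW : 0 ≤ truncMul q M a := truncMul_nonneg hM.le ha.le
  have hA : 0 ≤ (a - b) ^ (p - 1) := Real.rpow_nonneg (by linarith) _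
  have hC : (0 : ℝ) ≤ p * (2 * p) ^ (p - 1) :=
    mul_nonneg (by linarith) (Real.rpow_nonneg (by linarith) _)
  have key : (1 + q) ^ (1 - p) * (truncMul q M a - truncMul q M b) ^ p ≤
      (a - b) ^ (p - 1) * (Ha - Hb) := by
    have h := truncMul_sub_rpow_le hp hq hM hb hab
    have e : (1 + q) ^ (1 - p) * (1 + q) ^ (p - 1) = 1 := by
      rw [← Real.rpow_add (by linarith)]; simp
    calc _ ≤ (1 + q) ^ (1 - p) * ((1 + q) ^ (p - 1) * ((a - b) ^ (p - 1) * (Ha - Hb))) :=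
          mul_le_mul_of_nonneg_left h (Real.rpow_nonneg (by linarith) _)
      _ = _ := by rw [← mul_assoc, e, one_mul]
  have hαp := Real.rpow_nonneg hα p
  have hβp := Real.rpow_nonneg hβ p
  have herr : 0 ≤ 2 * (p * (2 * p) ^ (p - 1)) * (truncMul q M a ^ p * |α - β| ^ p) := by
    have := Real.rpow_nonneg hW p
    positivity
  rw [← mul_assoc]
  rcases le_or_gt β α with h | h
  · rw [max_eq_left h]
    have h1 : (1 + q) ^ (1 - p) * (truncMul q M a - truncMul q M b) ^ p * α ^ p ≤
      (a - b) ^ (p - 1) * (Ha - Hb) * α ^ p := by gcongr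
    have h0 : 0 ≤ (a - b) ^ (p - 1) * (Ha - Hb) * α ^ p :=
      mul_nonneg (mul_nonneg hA (by linarith)) hαp
    have h2 : β ^ p ≤ α ^ p := Real.rpow_le_rpow hβ h (by linarith)
    have h3 : (Ha - Hb) * α ^ p ≤ Ha * α ^ p - Hb * β ^ p := by nlinarith
    have h4 := mul_le_mul_of_nonneg_left h3 hA
    nlinarith
  · rw [max_eq_right h.le]
    have hβ0 : 0 < β := hα.trans_lt h
    have h1 : (1 + q) ^ (1 - p) * (truncMul q M a - truncMul q M b) ^ p * β ^ p ≤
      (a - b) ^ (p - 1) * (Ha - Hb) * β ^ p := by gcongr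
    have h2 := rpow_sub_rpow_le hp hα hβ0
    -- This is the identity `W(a)^p = a^(p-1) H(a)`, exact above and below `M`; it expresses the
    -- loss through the scale-free quantity `1 - b/a`.
    have e1 : (a - b) ^ (p - 1) * Ha = truncMul q M a ^ p * (1 - b / a) ^ (p - 1) := by
      have : a - b = a * (1 - b / a) := by field_simp
      rw [this, Real.mul_rpow ha.le (sub_nonneg.2 ((div_le_one ha).2 hab))]
      simp only [Ha, truncMul]
      rw [Real.mul_rpow ha.le (Real.rpow_nonneg hma.le _), ← Real.rpow_mul hma.le,
        mul_comm q p]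
      have : a ^ p = a ^ (p - 1) * a := by rw [← Real.rpow_add_one ha.ne']; congr 1; ring
      rw [this]; ring
    have ht : 0 ≤ 1 - b / a := sub_nonneg.2 ((div_le_one ha).2 hab)
    have h3 := mul_rpow_sub_one_le hp (mul_nonneg ht hβ) (sub_nonneg.2 h.le)
    rw [Real.mul_rpow ht hβ, Real.mul_rpow ht hβ] at h3
    have h4 : truncMul q M a ^ p * (1 - b / a) ^ p ≤ (a - b) ^ (p - 1) * (Ha - Hb) := by
      have e : (1 - b / a) ^ p = (1 - b / a) ^ (p - 1) * (1 - b / a) := by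
        rw [← Real.rpow_add_one' ht (by linarith)]; congr 1; ring
      rw [e, ← mul_assoc, ← e1, mul_assoc]
      apply mul_le_mul_of_nonneg_left _ hA
      have h5 := le_truncMul_sub hpq hM hb hab
      have : Ha * (1 - b / a) = min a M ^ (p * q) * (a - b) := by
        simp only [Ha, truncMul]; field_simp
      rw [this]; exact h5
    have h6 : (a - b) ^ (p - 1) * Ha * (β ^ p - α ^ p) ≤
        truncMul q M a ^ p * (1 / 2 * ((1 - b / a) ^ p * β ^ p) +
          p * (2 * p) ^ (p - 1) * (β - α) ^ p) := by
      calc _ ≤ (a - b) ^ (p - 1) * Ha * (p * β ^ (p - 1) * (β - α)) := by gcongr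
        _ = truncMul q M a ^ p * (p * ((1 - b / a) ^ (p - 1) * β ^ (p - 1)) * (β - α)) := by
            rw [e1]; ring
        _ ≤ _ := mul_le_mul_of_nonneg_left h3 (Real.rpow_nonneg hW _)
    have h7 := mul_le_mul_of_nonneg_right h4 hβp
    rw [abs_sub_comm, abs_of_pos (sub_pos.2 h)]
    nlinarith

theorem energy_le_form_of_le {p q M a b α β : ℝ} (hp : 1 < p) (hq : 0 ≤ q) (hM : 0 < M)
    (hb : 0 < b) (hab : b ≤ a) :
    (1 + q) ^ (1 - p) * |truncMul q M a * α - truncMul q M b * β| ^ p ≤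
      2 ^ p * ((a - b) ^ (p - 1) *
        (truncMul (p * q) M a * |α| ^ p - truncMul (p * q) M b * |β| ^ p)) +
        formConst p * (truncMul q M a ^ p * |α - β| ^ p) := by
  have ha : 0 < a := hb.trans_le hab
  have hW : 0 ≤ truncMul q M a := truncMul_nonneg hM.le ha.le
  have hWb : 0 ≤ truncMul q M b := truncMul_nonneg hM.le hb.le
  have hWab : truncMul q M b ≤ truncMul q M a := truncMul_mono hq hM hb hab
  have hlow := form_lower_bound (α := |α|) (β := |β|) hp hq hM hb hab (abs_nonneg _) (abs_nonneg _)
  have hc1 : (1 + q) ^ (1 - p) ≤ 1 :=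
    Real.rpow_le_one_of_one_le_of_nonpos (by linarith) (by linarith)
  have hc0 : 0 ≤ (1 + q) ^ (1 - p) := Real.rpow_nonneg (by linarith) _
  have h2p : (2 : ℝ) ^ p = 2 * 2 ^ (p - 1) := by
    rw [mul_comm, ← Real.rpow_add_one two_ne_zero]; congr 1; ring
  have h2 : (0 : ℝ) ≤ 2 ^ (p - 1) := by positivity
  have habs : |(|α| - |β|)| ^ p ≤ |α - β| ^ p :=
    Real.rpow_le_rpow (abs_nonneg _) (abs_abs_sub_abs_le_abs_sub α β) (by linarith)
  have hWp := Real.rpow_nonneg hW p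
  have hC : (0 : ℝ) ≤ p * (2 * p) ^ (p - 1) :=
    mul_nonneg (by linarith) (Real.rpow_nonneg (by linarith) _)
  have hmain : |truncMul q M a * α - truncMul q M b * β| ^ p ≤ 2 ^ (p - 1) *
      ((truncMul q M a - truncMul q M b) ^ p * max |α| |β| ^ p +
        truncMul q M a ^ p * |α - β| ^ p) := by
    have hX : 0 ≤ truncMul q M a - truncMul q M b := sub_nonneg.2 hWab
    have hm : 0 ≤ max |α| |β| := le_max_of_le_left (abs_nonneg _)
    rw [← Real.mul_rpow hX hm, ← Real.mul_rpow hW (abs_nonneg _)]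
    refine le_trans ?_ (add_rpow_le_two_rpow hp.le (mul_nonneg hX hm)
      (mul_nonneg hW (abs_nonneg _)))
    refine Real.rpow_le_rpow (abs_nonneg _) ?_ (by linarith)
    -- Either splitting of the product difference is possible; this one lets the larger weight
    -- `W(a)` multiply the cut-off difference, as the error term of `form_lower_bound` does.
    have e : truncMul q M a * α - truncMul q M b * β =
      (truncMul q M a - truncMul q M b) * β + truncMul q M a * (α - β) := by ring
    rw [e]
    refine (abs_add_le _ _).trans ?_
    rw [abs_mul, abs_mul, abs_of_nonneg hX, abs_of_nonneg hW]
    gcongr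
    exact le_max_right _ _
  have hE : 0 ≤ truncMul q M a ^ p * |α - β| ^ p := mul_nonneg hWp (by positivity)
  have h1 := mul_le_mul_of_nonneg_left hmain hc0
  have h3 : truncMul q M a ^ p * |(|α| - |β|)| ^ p ≤ truncMul q M a ^ p * |α - β| ^ p := by gcongr
  have h4 := mul_le_mul_of_nonneg_left h3 hC
  have h5 := mul_le_mul_of_nonneg_left hlow h2
  have h6 := mul_le_mul_of_nonneg_left h4 h2
  have h7 : (1 + q) ^ (1 - p) * (2 ^ (p - 1) * (truncMul q M a ^ p * |α - β| ^ p)) ≤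
      2 ^ (p - 1) * (truncMul q M a ^ p * |α - β| ^ p) :=
    mul_le_of_le_one_left (by positivity) hc1
  unfold formConst
  rw [h2p]
  nlinarith [mul_nonneg h2 hE]

/-- Pointwise Caccioppoli inequality for the truncated powers `truncMul`. -/
theorem energy_le_form {p q M a b α β : ℝ} (hp : 1 < p) (hq : 0 ≤ q) (hM : 0 < M)
    (ha : 0 < a) (hb : 0 < b) :
    (1 + q) ^ (1 - p) * |truncMul q M a * α - truncMul q M b * β| ^ p ≤
      2 ^ p * (|a - b| ^ (p - 2) * (a - b) *
        (truncMul (p * q) M a * |α| ^ p - truncMul (p * q) M b * |β| ^ p)) +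
        formConst p * (max (truncMul q M a) (truncMul q M b) ^ p * |α - β| ^ p) := by
  have hsplit : ∀ z : ℝ, 0 ≤ z → |z| ^ (p - 2) * z = z ^ (p - 1) := fun z hz => by
    rw [abs_of_nonneg hz, ← Real.rpow_add_one' hz (by linarith)]; congr 1; ring
  rcases le_total b a with h | h
  · rw [hsplit _ (sub_nonneg.2 h), max_eq_left (truncMul_mono hq hM hb h)]
    exact energy_le_form_of_le hp hq hM hb h
  · have := energy_le_form_of_le (α := β) (β := α) hp hq hM ha h
    rw [max_eq_right (truncMul_mono hq hM ha h), abs_sub_comm α β,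
      abs_sub_comm (truncMul q M a * α), abs_sub_comm a b]
    have e := hsplit _ (sub_nonneg.2 h)
    rw [← e] at this
    linarith

/-! ### Mollification in time -/

/-- An even, nonnegative, continuously differentiable kernel of unit mass supported in `[-h, h]`. -/
structure IsTimeKernel (h : ℝ) (κ : ℝ → ℝ) : Prop where
  contDiff : ContDiff ℝ 1 κ
  nonneg : ∀ σ, 0 ≤ κ σ
  even : ∀ σ, κ (-σ) = κ σ
  eq_zero : ∀ σ, h < |σ| → κ σ = 0
  integral_eq_one : ∫ σ, κ σ = 1

theorem IsMollifier.isTimeKernel {ρ : ℝ → ℝ} (hρ : IsMollifier ρ) {h : ℝ} (hh : 0 < h) :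
    IsTimeKernel h (fun σ => h⁻¹ * ρ (σ / h)) where
  contDiff := by
    have := hρ.smooth.of_le (m := 1) (by exact_mod_cast le_top)
    fun_prop
  nonneg σ := mul_nonneg (inv_nonneg.2 hh.le) (hρ.nonneg _)
  even σ := by rw [neg_div, hρ.even]
  eq_zero σ hσ := by
    have : ρ (σ / h) = 0 := by
      apply image_eq_zero_of_notMem_tsupport
      intro hmem
      have := abs_le.2 (hρ.support_subset hmem)
      rw [abs_div, abs_of_pos hh, div_le_one hh] at this
      linarith
    rw [this, mul_zero]
  integral_eq_one := by
    rw [integral_const_mul, Measure.integral_comp_div, hρ.integral_eq_one, abs_of_pos hh]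
    simp [hh.ne']

theorem IsTimeKernel.hasCompactSupport {h : ℝ} {κ : ℝ → ℝ} (hκ : IsTimeKernel h κ) :
    HasCompactSupport κ :=
  HasCompactSupport.intro (isCompact_closedBall (0 : ℝ) h) fun σ hσ =>
    hκ.eq_zero σ (by simpa using hσ)

theorem IsTimeKernel.continuous {h : ℝ} {κ : ℝ → ℝ} (hκ : IsTimeKernel h κ) : Continuous κ :=
  hκ.contDiff.continuous

theorem IsTimeKernel.integrable {h : ℝ} {κ : ℝ → ℝ} (hκ : IsTimeKernel h κ) : Integrable κ :=
  hκ.continuous.integrable_of_hasCompactSupport hκ.hasCompactSupport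

theorem IsTimeKernel.lintegral_eq_one {h : ℝ} {κ : ℝ → ℝ} (hκ : IsTimeKernel h κ) :
    ∫⁻ σ, ENNReal.ofReal (κ σ) = 1 := by
  rw [← ofReal_integral_eq_lintegral_ofReal hκ.integrable (ae_of_all _ hκ.nonneg),
    hκ.integral_eq_one, ENNReal.ofReal_one]

/-- The convolution in the time variable `(t, z) ↦ ∫ f(σ, z) κ(t - σ) dσ`. -/
noncomputable def tmol {Z : Type*} (κ : ℝ → ℝ) (f : ℝ × Z → ℝ) (q : ℝ × Z) : ℝ :=
  ∫ σ, f (σ, q.2) * κ (q.1 - σ)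

theorem measurable_tmol {Z : Type*} [MeasurableSpace Z] {κ : ℝ → ℝ} {f : ℝ × Z → ℝ}
    (hκ : Measurable κ) (hf : Measurable f) : Measurable (tmol κ f) := by
  have : StronglyMeasurable (Function.uncurry fun (q : ℝ × Z) (σ : ℝ) =>
      f (σ, q.2) * κ (q.1 - σ)) := by
    apply Measurable.stronglyMeasurable
    unfold Function.uncurry
    fun_prop
  exact this.integral_prod_right.measurable

theorem tmol_eq {Z : Type*} (κ : ℝ → ℝ) (f : ℝ × Z → ℝ) (q : ℝ × Z) :
    tmol κ f q = ∫ s, f (q.1 - s, q.2) * κ s := by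
  unfold tmol
  rw [← integral_sub_left_eq_self _ volume q.1]
  simp

theorem eLpNorm_ofReal_rpow {α : Type*} [MeasurableSpace α] {μ : Measure α} {p : ℝ} (hp : 0 < p)
    (f : α → ℝ) : eLpNorm f (ENNReal.ofReal p) μ ^ p = ∫⁻ a, ‖f a‖ₑ ^ p ∂μ := by
  rw [eLpNorm_eq_lintegral_rpow_enorm_toReal (by simpa using hp) ENNReal.ofReal_ne_top,
    ENNReal.toReal_ofReal hp.le, ← ENNReal.rpow_mul, one_div, inv_mul_cancel₀ hp.ne',
    ENNReal.rpow_one]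

theorem lintegral_enorm_rpow_le {α : Type*} [MeasurableSpace α] {ν : Measure α}
    [IsProbabilityMeasure ν] {p : ℝ} (hp : 1 ≤ p) {g : α → ℝ} (hg : Measurable g) :
    (∫⁻ a, ‖g a‖ₑ ∂ν) ^ p ≤ ∫⁻ a, ‖g a‖ₑ ^ p ∂ν := by
  rw [← eLpNorm_ofReal_rpow (by linarith), ← eLpNorm_one_eq_lintegral_enorm]
  gcongr
  exact eLpNorm_le_eLpNorm_of_exponent_le (by simpa using ENNReal.ofReal_le_ofReal hp)
    hg.aestronglyMeasurable

/-- Jensen's inequality for the probability measure with density `κ`. -/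
theorem enorm_integral_mul_kernel_rpow_le {h : ℝ} {κ : ℝ → ℝ} (hκ : IsTimeKernel h κ) {p : ℝ}
    (hp : 1 ≤ p) {g : ℝ → ℝ} (hg : Measurable g) :
    ‖∫ s, g s * κ s‖ₑ ^ p ≤ ∫⁻ s, ‖g s‖ₑ ^ p * ENNReal.ofReal (κ s) := by
  have hκm : Measurable fun s => ENNReal.ofReal (κ s) := hκ.continuous.measurable.ennreal_ofReal
  set ν := (volume : Measure ℝ).withDensity fun s => ENNReal.ofReal (κ s)
  have : IsProbabilityMeasure ν := ⟨by
    rw [withDensity_apply _ MeasurableSet.univ, Measure.restrict_univ, hκ.lintegral_eq_one]⟩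
  have e : ∀ F : ℝ → ℝ≥0∞, Measurable F → ∫⁻ s, F s ∂ν = ∫⁻ s, F s * ENNReal.ofReal (κ s) := by
    intro F hF
    rw [lintegral_withDensity_eq_lintegral_mul _ hκm hF]
    simp [mul_comm]
  calc ‖∫ s, g s * κ s‖ₑ ^ p ≤ (∫⁻ s, ‖g s‖ₑ ∂ν) ^ p := by
        gcongr
        rw [e _ hg.enorm]
        refine (enorm_integral_le_lintegral_enorm _).trans_eq ?_
        congr 1; ext s
        rw [enorm_mul, Real.enorm_of_nonneg (hκ.nonneg s)]
    _ ≤ _ := (lintegral_enorm_rpow_le hp hg).trans_eq (e _ (hg.enorm.pow_const p))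

theorem enorm_tmol_rpow_le {Z : Type*} [MeasurableSpace Z] {h : ℝ} {κ : ℝ → ℝ}
    (hκ : IsTimeKernel h κ) {p : ℝ} (hp : 1 ≤ p) {f : ℝ × Z → ℝ} (hf : Measurable f) (q : ℝ × Z) :
    ‖tmol κ f q‖ₑ ^ p ≤ ∫⁻ s, ‖f (q.1 - s, q.2)‖ₑ ^ p * ENNReal.ofReal (κ s) := by
  rw [tmol_eq]
  exact enorm_integral_mul_kernel_rpow_le hκ hp (by fun_prop)

theorem measurePreserving_time_sub {Z : Type*} [MeasureSpace Z] [SFinite (volume : Measure Z)]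
    (s : ℝ) : MeasurePreserving (fun q : ℝ × Z => (q.1 - s, q.2)) :=
  (measurePreserving_sub_right volume s).prod (MeasurePreserving.id volume)

/-- Jensen at each point, then Tonelli and invariance under time translations: mollification is a
contraction of `L^p`. -/
theorem lintegral_tmol_rpow_le {Z : Type*} [MeasureSpace Z] [SFinite (volume : Measure Z)] {h : ℝ}
    {κ : ℝ → ℝ} (hκ : IsTimeKernel h κ) {p : ℝ} (hp : 1 ≤ p) {f : ℝ × Z → ℝ} (hf : Measurable f) :
    ∫⁻ q, ‖tmol κ f q‖ₑ ^ p ≤ ∫⁻ q, ‖f q‖ₑ ^ p := by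
  have hκm := hκ.continuous.measurable
  calc ∫⁻ q, ‖tmol κ f q‖ₑ ^ p
      ≤ ∫⁻ q : ℝ × Z, ∫⁻ s, ‖f (q.1 - s, q.2)‖ₑ ^ p * ENNReal.ofReal (κ s) :=
        lintegral_mono fun q => enorm_tmol_rpow_le hκ hp hf q
    _ = ∫⁻ s, ∫⁻ q : ℝ × Z, ‖f (q.1 - s, q.2)‖ₑ ^ p * ENNReal.ofReal (κ s) :=
        lintegral_lintegral_swap (by fun_prop)
    _ = ∫⁻ s, (∫⁻ q : ℝ × Z, ‖f q‖ₑ ^ p) * ENNReal.ofReal (κ s) := by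
        congr 1; ext s
        rw [lintegral_mul_const _ (by fun_prop)]
        congr 1
        exact (measurePreserving_time_sub s).lintegral_comp (f := fun q => ‖f q‖ₑ ^ p)
          (by fun_prop)
    _ = _ := by
        rw [lintegral_const_mul _ (by fun_prop), hκ.lintegral_eq_one, mul_one]

theorem eLpNorm_tmol_le {Z : Type*} [MeasureSpace Z] [SFinite (volume : Measure Z)] {h : ℝ}
    {κ : ℝ → ℝ} (hκ : IsTimeKernel h κ) {p : ℝ} (hp : 1 ≤ p) {f : ℝ × Z → ℝ} (hf : Measurable f) :
    eLpNorm (tmol κ f) (ENNReal.ofReal p) volume ≤ eLpNorm f (ENNReal.ofReal p) volume := by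
  rw [← ENNReal.rpow_le_rpow_iff (z := p) (by linarith), eLpNorm_ofReal_rpow (by linarith),
    eLpNorm_ofReal_rpow (by linarith)]
  exact lintegral_tmol_rpow_le hκ hp hf

/-- Off a null set of `z` the convolution integrals converge. This matters because a divergent
Bochner integral is zero by convention, so linearity of `tmol` in `f` holds only along such slices.
-/
theorem ae_integrable_slice {Z : Type*} [MeasureSpace Z] [SFinite (volume : Measure Z)] {p : ℝ}
    (hp : 1 ≤ p) {f : ℝ × Z → ℝ} (hfm : Measurable f) (hf : MemLp f (ENNReal.ofReal p)) :
    ∀ᵐ z : Z, LocallyIntegrable fun σ => f (σ, z) := by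
  have h1 : ∫⁻ q, ‖f q‖ₑ ^ p < ⊤ := by
    rw [← eLpNorm_ofReal_rpow (by linarith)]
    exact ENNReal.rpow_lt_top_of_nonneg (by linarith) hf.2.ne
  rw [Measure.volume_eq_prod, lintegral_prod_symm _ (by fun_prop)] at h1
  filter_upwards [ae_lt_top (by fun_prop) h1.ne] with z hz
  have : MemLp (fun σ => f (σ, z)) (ENNReal.ofReal p) := by
    refine ⟨(by fun_prop : Measurable _).aestronglyMeasurable, ?_⟩
    rw [← eLpNorm_ofReal_rpow (by linarith)] at hz
    by_contra hcon
    rw [not_lt_top_iff.1 hcon, ENNReal.top_rpow_of_pos (by linarith)] at hz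
    exact lt_irrefl _ hz
  exact this.locallyIntegrable (by simpa using ENNReal.ofReal_le_ofReal hp)

theorem _root_.MeasureTheory.LocallyIntegrable.integrable_mul_kernel {f κ : ℝ → ℝ}
    (hf : LocallyIntegrable f) (hκ : Continuous κ) (hc : HasCompactSupport κ) (t : ℝ) :
    Integrable fun σ => f σ * κ (t - σ) := by
  have := hf.integrable_smul_left_of_hasCompactSupport (g := fun σ => κ (t - σ)) (by fun_prop)
    (hc.comp_homeomorph (Homeomorph.subLeft t))
  simpa [mul_comm] using this

theorem enorm_tmol_sub_rpow_le {Z : Type*} [MeasurableSpace Z] {h : ℝ} {κ : ℝ → ℝ}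
    (hκ : IsTimeKernel h κ) {p : ℝ} (hp : 1 ≤ p) {f : ℝ × Z → ℝ} (hf : Measurable f) (q : ℝ × Z)
    (hq : LocallyIntegrable fun σ => f (σ, q.2)) :
    ‖tmol κ f q - f q‖ₑ ^ p ≤
      ∫⁻ s, ‖f (q.1 - s, q.2) - f q‖ₑ ^ p * ENNReal.ofReal (κ s) := by
  have h1 : tmol κ f q - f q = ∫ s, (f (q.1 - s, q.2) - f q) * κ s := by
    have hint : Integrable fun s => f (q.1 - s, q.2) * κ s := by
      have := (hq.integrable_mul_kernel hκ.continuous hκ.hasCompactSupport q.1).comp_sub_left q.1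
      simpa using this
    simp_rw [sub_mul]
    rw [integral_sub hint (hκ.integrable.const_mul _), integral_const_mul, hκ.integral_eq_one,
      mul_one, tmol_eq]
  rw [h1]
  exact enorm_integral_mul_kernel_rpow_le hκ hp (by fun_prop)

/-! ### Strong convergence of time mollifications in `L^p` -/

section Convergence

variable {Z : Type*} [NormedAddCommGroup Z] [ProperSpace Z] [SecondCountableTopology Z]
  [MeasureSpace Z] [BorelSpace Z] [(volume : Measure Z).IsAddHaarMeasure]

/-- Continuity of translations in `L^p`: the shifts form a continuous family of measure-preserving
maps, and composition with such a family is continuous in `L^p`. -/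
theorem tendsto_lintegral_time_sub {p : ℝ} (hp : 1 ≤ p) {f : ℝ × Z → ℝ}
    (hf : MemLp f (ENNReal.ofReal p)) :
    Tendsto (fun s : ℝ => ∫⁻ q : ℝ × Z, ‖f (q.1 - s, q.2) - f q‖ₑ ^ p) (𝓝 0) (𝓝 0) := by
  have : Fact (1 ≤ ENNReal.ofReal p) := ⟨by simpa using ENNReal.ofReal_le_ofReal hp⟩
  let g : ℝ → C(ℝ × Z, ℝ × Z) := fun s => ⟨fun q => (q.1 - s, q.2), by fun_prop⟩
  have hg : Continuous g :=
    ContinuousMap.continuous_of_continuous_uncurry _ (by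
      change Continuous fun r : ℝ × (ℝ × Z) => (r.2.1 - r.1, r.2.2)
      fun_prop)
  have hgm : ∀ s, MeasurePreserving (g s) volume volume := fun s => measurePreserving_time_sub s
  let T : ℝ → Lp ℝ (ENNReal.ofReal p) (volume : Measure (ℝ × Z)) := fun s =>
    Lp.compMeasurePreserving (g s) (hgm s) (hf.toLp f)
  have hF : Continuous T := (continuous_const (y := hf.toLp f)).compMeasurePreservingLp hg hgm
    ENNReal.ofReal_ne_top
  have h0 := (Lp.tendsto_Lp_iff_tendsto_eLpNorm' _ _).1 (hF.tendsto 0)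
  have h1 : ∀ s, eLpNorm (⇑(T s) - ⇑(T 0)) (ENNReal.ofReal p) volume =
      eLpNorm (fun q : ℝ × Z => f (q.1 - s, q.2) - f q) (ENNReal.ofReal p) volume := by
    intro s
    apply eLpNorm_congr_ae
    have e : ∀ s, ⇑(T s) =ᵐ[volume] fun q : ℝ × Z => f (q.1 - s, q.2) := fun s =>
      (Lp.coeFn_compMeasurePreserving _ (hgm s)).trans
        ((hgm s).quasiMeasurePreserving.ae_eq_comp hf.coeFn_toLp)
    filter_upwards [e s, e 0] with q h1 h2
    simp [h1, h2]
  simp_rw [h1] at h0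
  have h2 := h0.ennrpow_const p
  simp_rw [eLpNorm_ofReal_rpow (by linarith : 0 < p),
    ENNReal.zero_rpow_of_pos (by linarith : 0 < p)] at h2
  exact h2

/-- By Jensen and Tonelli the error is an average of the translation errors over shifts `|s| ≤ h k`,
all of which are small once `h k` is. -/
theorem tendsto_eLpNorm_tmol_sub {p : ℝ} (hp : 1 ≤ p) {f : ℝ × Z → ℝ} (hfm : Measurable f)
    (hf : MemLp f (ENNReal.ofReal p)) {h : ℕ → ℝ} {κ : ℕ → ℝ → ℝ}
    (hκ : ∀ k, IsTimeKernel (h k) (κ k)) (hh : Tendsto h atTop (𝓝 0)) :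
    Tendsto (fun k => eLpNorm (fun q => tmol (κ k) f q - f q) (ENNReal.ofReal p) volume)
      atTop (𝓝 0) := by
  have hp0 : 0 < p := by linarith
  suffices H : Tendsto (fun k => ∫⁻ q, ‖tmol (κ k) f q - f q‖ₑ ^ p) atTop (𝓝 0) by
    have := H.ennrpow_const p⁻¹
    simp_rw [← eLpNorm_ofReal_rpow hp0, ← ENNReal.rpow_mul, mul_inv_cancel₀ hp0.ne',
      ENNReal.rpow_one, ENNReal.zero_rpow_of_pos (inv_pos.2 hp0)] at this
    exact this
  rw [ENNReal.tendsto_nhds_zero]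
  intro ε hε
  obtain ⟨δ, hδ, hball⟩ := Metric.eventually_nhds_iff.1
    ((ENNReal.tendsto_nhds_zero.1 (tendsto_lintegral_time_sub hp hf)) ε hε)
  filter_upwards [hh.eventually (gt_mem_nhds hδ)] with k hk
  have hκm := (hκ k).continuous.measurable
  have hslice : ∀ᵐ q : ℝ × Z, LocallyIntegrable fun σ => f (σ, q.2) :=
    Measure.quasiMeasurePreserving_snd.ae (ae_integrable_slice hp hfm hf)
  calc ∫⁻ q, ‖tmol (κ k) f q - f q‖ₑ ^ p
      ≤ ∫⁻ q : ℝ × Z, ∫⁻ s, ‖f (q.1 - s, q.2) - f q‖ₑ ^ p * ENNReal.ofReal (κ k s) :=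
        lintegral_mono_ae (hslice.mono fun q hq => enorm_tmol_sub_rpow_le (hκ k) hp hfm q hq)
    _ = ∫⁻ s, ∫⁻ q : ℝ × Z, ‖f (q.1 - s, q.2) - f q‖ₑ ^ p * ENNReal.ofReal (κ k s) :=
        lintegral_lintegral_swap (by fun_prop)
    _ ≤ ∫⁻ s, ε * ENNReal.ofReal (κ k s) := by
        refine lintegral_mono fun s => ?_
        rw [lintegral_mul_const _ (by fun_prop)]
        rcases lt_or_ge (h k) |s| with hs | hs
        · simp [(hκ k).eq_zero s hs]
        · gcongr
          exact hball (by simpa using hs.trans_lt hk)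
    _ = ε := by rw [lintegral_const_mul _ (by fun_prop), (hκ k).lintegral_eq_one, mul_one]

end Convergence

theorem hasDerivAt_tmol {Z : Type*} {κ : ℝ → ℝ} (hκ : ContDiff ℝ 1 κ) (hc : HasCompactSupport κ)
    {f : ℝ × Z → ℝ} {z : Z} (hf : LocallyIntegrable fun σ => f (σ, z)) (t : ℝ) :
    HasDerivAt (fun τ => tmol κ f (τ, z)) (tmol (deriv κ) f (t, z)) t :=
  hc.hasDerivAt_convolution_right (ContinuousLinearMap.mul ℝ ℝ) hf hκ t

theorem continuous_tmol {Z : Type*} {κ : ℝ → ℝ} (hκ : Continuous κ) (hc : HasCompactSupport κ)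
    {f : ℝ × Z → ℝ} {z : Z} (hf : LocallyIntegrable fun σ => f (σ, z)) :
    Continuous fun t => tmol κ f (t, z) :=
  hc.continuous_convolution_right (ContinuousLinearMap.mul ℝ ℝ) hf hκ

variable {n : ℕ} {s p : ℝ}

/-! ### Weighted differences -/

theorem singKernel_nonneg (s p : ℝ) (x y : Rn n) : 0 ≤ singKernel s p x y :=
  Real.rpow_nonneg (norm_nonneg _) _

theorem singKernel_comm (s p : ℝ) (x y : Rn n) : singKernel s p x y = singKernel s p y x := by
  unfold singKernel; rw [norm_sub_rev]

@[fun_prop]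
theorem measurable_singKernel {α : Type*} [MeasurableSpace α] {f g : α → Rn n}
    (hf : Measurable f) (hg : Measurable g) : Measurable fun a => singKernel s p (f a) (g a) := by
  unfold singKernel; fun_prop

theorem ofReal_abs_rpow (hp : 0 ≤ p) (a : ℝ) : ENNReal.ofReal (|a| ^ p) = ‖a‖ₑ ^ p := by
  rw [Real.enorm_eq_ofReal_abs, ENNReal.ofReal_rpow_of_nonneg (abs_nonneg a) hp]

/-- `(f(t,x) - f(t,y)) |x - y|^(-(n + sp)/p)`. -/
noncomputable def gd (s p : ℝ) (f : ℝ × Rn n → ℝ) (q : ℝ × Rn n × Rn n) : ℝ :=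
  (f (q.1, q.2.1) - f (q.1, q.2.2)) * singKernel s p q.2.1 q.2.2 ^ (1 / p)

theorem measurable_gd {f : ℝ × Rn n → ℝ} (hf : Measurable f) : Measurable (gd s p f) := by
  unfold gd; fun_prop

theorem enorm_mul_singKernel_rpow (hp : 0 < p) (a : ℝ) (x y : Rn n) :
    ‖a * singKernel s p x y ^ (1 / p)‖ₑ ^ p = ENNReal.ofReal (|a| ^ p * singKernel s p x y) := by
  rw [← ofReal_abs_rpow hp.le, abs_mul, Real.mul_rpow (abs_nonneg _) (abs_nonneg _),
    abs_of_nonneg (Real.rpow_nonneg (singKernel_nonneg s p x y) _),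
    ← Real.rpow_mul (singKernel_nonneg s p x y), one_div, inv_mul_cancel₀ hp.ne', Real.rpow_one]

/-- Turns the time-integrated Gagliardo seminorm into an ordinary `L^p` norm of one function, to
which the contraction and convergence results for mollifications apply directly. -/
theorem lintegral_gd_rpow (hp : 0 < p) {f : ℝ × Rn n → ℝ} (hf : Measurable f) :
    ∫⁻ q, ‖gd s p f q‖ₑ ^ p = ∫⁻ t, gagliardo s p univ fun x => f (t, x) := by
  have hg : Measurable (gd s p f) := measurable_gd hf
  have hm : Measurable fun q => ‖gd s p f q‖ₑ ^ p := by fun_prop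
  rw [Measure.volume_eq_prod, lintegral_prod _ hm.aemeasurable]
  congr 1; ext t
  rw [Measure.volume_eq_prod, lintegral_prod _ (by fun_prop)]
  unfold gagliardo
  simp only [Measure.restrict_univ]
  congr 1; ext x; congr 1; ext y
  exact enorm_mul_singKernel_rpow hp _ _ _

theorem memLp_iff_lintegral {α : Type*} [MeasurableSpace α] {μ : Measure α} (hp : 0 < p)
    {f : α → ℝ} (hf : AEStronglyMeasurable f μ) :
    MemLp f (ENNReal.ofReal p) μ ↔ ∫⁻ a, ‖f a‖ₑ ^ p ∂μ < ⊤ := by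
  rw [← eLpNorm_ofReal_rpow hp, ENNReal.rpow_lt_top_iff_of_pos hp]
  exact ⟨fun h => h.2, fun h => ⟨hf, h⟩⟩

/-- The singular weight does not depend on time, so it passes through the time integral. -/
theorem gd_tmol {κ : ℝ → ℝ} (hκ : Continuous κ) (hc : HasCompactSupport κ) {f : ℝ × Rn n → ℝ}
    (q : ℝ × Rn n × Rn n) (hx : LocallyIntegrable fun σ => f (σ, q.2.1))
    (hy : LocallyIntegrable fun σ => f (σ, q.2.2)) :
    gd s p (tmol κ f) q = tmol κ (gd s p f) q := by
  unfold gd tmol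
  simp only
  rw [← integral_sub (hx.integrable_mul_kernel hκ hc _) (hy.integrable_mul_kernel hκ hc _),
    ← integral_mul_const]
  congr 1; ext σ; ring

/-! ### Mollified functions as test functions -/

theorem locallyIntegrable_of_bounded {f : ℝ → ℝ} (hf : Measurable f) {C : ℝ}
    (hC : ∀ t, |f t| ≤ C) : LocallyIntegrable f := by
  refine (locallyIntegrable_const C).mono hf.aestronglyMeasurable (ae_of_all _ fun t => ?_)
  exact (hC t).trans (le_abs_self C)

theorem abs_tmol_le {Z : Type*} {κ : ℝ → ℝ} (hκ : Integrable κ)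
    {f : ℝ × Z → ℝ} {C : ℝ} (hC : ∀ q, |f q| ≤ C) (q : ℝ × Z) :
    |tmol κ f q| ≤ C * ∫ σ, |κ σ| := by
  rw [tmol_eq, ← integral_const_mul, ← Real.norm_eq_abs]
  refine norm_integral_le_of_norm_le (hκ.abs.const_mul C) (ae_of_all _ fun σ => ?_)
  rw [norm_mul]
  exact mul_le_mul_of_nonneg_right (hC _) (abs_nonneg _)

theorem tmol_eq_zero_of_slice {Z : Type*} {κ : ℝ → ℝ} {f : ℝ × Z → ℝ} {q : ℝ × Z}
    (h : ∀ σ, f (σ, q.2) = 0) : tmol κ f q = 0 := by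
  simp [tmol, h]

theorem MemW.memLp (hp : 1 < p) {D : Set (Rn n)} {f : Rn n → ℝ} (hf : MemW s p D f) :
    MemLp f (ENNReal.ofReal p) (volume.restrict D) := by
  rw [memLp_iff_lintegral (by linarith) hf.1]
  have h := (le_self_add.trans_lt hf.2 :
    (∫⁻ x in D, ENNReal.ofReal (|f x| ^ p)) ^ (1 / p) < ⊤)
  rw [ENNReal.rpow_lt_top_iff_of_pos (by simp; linarith)] at h
  simpa only [ofReal_abs_rpow (by linarith : 0 ≤ p)] using h

theorem MemW.integrableOn (hp : 1 < p) {D : Set (Rn n)} (hD : volume D ≠ ⊤) {f : Rn n → ℝ}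
    (hf : MemW s p D f) : IntegrableOn f D := by
  have : IsFiniteMeasure (volume.restrict D) := ⟨by simpa using hD.lt_top⟩
  exact (hf.memLp hp).integrable (by simpa using ENNReal.ofReal_le_ofReal hp.le)

theorem lintegral_enorm_le_sobolevNorm (hp : 1 < p) {D : Set (Rn n)} {f : Rn n → ℝ}
    (hf : AEStronglyMeasurable f (volume.restrict D)) :
    ∫⁻ x in D, ‖f x‖ₑ ≤ volume D ^ (1 - 1 / p) * sobolevNorm s p D f := by
  have h1 := eLpNorm_le_eLpNorm_mul_rpow_measure_univ (p := 1) (q := ENNReal.ofReal p)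
    (μ := volume.restrict D) (by simpa using ENNReal.ofReal_le_ofReal hp.le) hf
  rw [eLpNorm_one_eq_lintegral_enorm, ENNReal.toReal_ofReal (by linarith),
    Measure.restrict_apply_univ] at h1
  simp only [ENNReal.toReal_one, div_one] at h1
  refine h1.trans ?_
  rw [mul_comm]
  gcongr
  rw [sobolevNorm]
  refine le_trans (le_of_eq ?_) le_self_add
  simp_rw [ofReal_abs_rpow (by linarith : 0 ≤ p)]
  rw [← eLpNorm_ofReal_rpow (by linarith), ← ENNReal.rpow_mul, mul_one_div_cancel (by linarith),
    ENNReal.rpow_one]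

/-- The time derivative falls on `κ`, so it is a bounded function and, by Hölder on the finite
measure set `B`, a functional on `W^{s,p}(B)` bounded uniformly in time. The jumps of `G` at `t₁`
and `t₂` are smoothed, and the margins wider than `h` make the mollified function vanish at `τ₁` and
`τ₂`. -/
theorem isTestFunction_tmol {κ : ℝ → ℝ} {h : ℝ} (hp : 1 < p) (hκ : IsTimeKernel h κ)
    {B : Set (Rn n)} (hB : MeasurableSet B) (hBfin : volume B ≠ ⊤) {τ₁ τ₂ t₁ t₂ : ℝ}
    (h1 : τ₁ + h < t₁) (h2 : t₂ + h < τ₂)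
    {G : ℝ × Rn n → ℝ} (hG : Measurable G) {C : ℝ} (hC : ∀ q, |G q| ≤ C)
    (hGx : ∀ t, ∀ x ∉ B, G (t, x) = 0) (hGt : ∀ t ∉ Icc t₁ t₂, ∀ x, G (t, x) = 0)
    (hgd : MemLp (gd s p G) (ENNReal.ofReal p)) :
    IsTestFunction s p B τ₁ τ₂ (fun x t => tmol κ G (t, x))
      (fun t f => ∫ x in B, tmol (deriv κ) G (t, x) * f x) := by
  have hp0 : 0 < p := by linarith
  have hκd : Continuous (deriv κ) := hκ.contDiff.continuous_deriv le_rfl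
  have hκc : HasCompactSupport (deriv κ) := hκ.hasCompactSupport.deriv
  have hκi : Integrable (deriv κ) := hκd.integrable_of_hasCompactSupport hκc
  have hm := measurable_tmol hκ.continuous.measurable hG
  have hm' := measurable_tmol hκd.measurable hG
  have hslice : ∀ x, LocallyIntegrable fun σ => G (σ, x) := fun x =>
    locallyIntegrable_of_bounded (by fun_prop) fun t => hC (t, x)
  have hC0 : 0 ≤ C := (abs_nonneg _).trans (hC (0, 0))
  have : IsFiniteMeasure (volume.restrict B) := ⟨by simpa using hBfin.lt_top⟩
  set C' := C * ∫ σ, |deriv κ σ|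
  have hb' : ∀ q, |tmol (deriv κ) G q| ≤ C' := abs_tmol_le hκi hC
  have hint : ∀ t f, MemW s p B f →
      Integrable (fun x => tmol (deriv κ) G (t, x) * f x) (volume.restrict B) := fun t f hf =>
    (hf.integrableOn hp hBfin).bdd_mul (c := C')
      (by fun_prop : Measurable fun x => tmol (deriv κ) G (t, x)).aestronglyMeasurable
      (ae_of_all _ fun x => hb' (t, x))
  have hslice_int : ∀ t, Integrable (fun x => tmol κ G (t, x)) (volume.restrict B) := fun t => by
    refine Integrable.of_bound
      (by fun_prop : Measurable fun x => tmol κ G (t, x)).aestronglyMeasurable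
      (C * ∫ σ, |κ σ|) (ae_of_all _ fun x => ?_)
    exact abs_tmol_le hκ.integrable hC (t, x)
  refine ⟨⟨?_, ?_⟩, ?_, ⟨?_, ?_, ?_⟩, ?_, ?_, ?_⟩
  · exact (hm.comp measurable_swap).aestronglyMeasurable
  · have hA : ∫⁻ t, ∫⁻ x, ENNReal.ofReal (|tmol κ G (t, x)| ^ p) < ⊤ := by
      have e : ∫⁻ t, ∫⁻ x, ENNReal.ofReal (|tmol κ G (t, x)| ^ p) =
          ∫⁻ q, ‖tmol κ G q‖ₑ ^ p := by
        rw [Measure.volume_eq_prod, lintegral_prod _ (by fun_prop)]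
        simp_rw [ofReal_abs_rpow hp0.le]
      rw [e]
      refine (lintegral_tmol_rpow_le hκ hp.le hG).trans_lt ?_
      have hle : ∀ q, ‖G q‖ₑ ^ p ≤
          (Icc t₁ t₂ ×ˢ B).indicator (fun _ => ENNReal.ofReal C ^ p) q := by
        rintro ⟨t, x⟩
        by_cases hq : (t, x) ∈ Icc t₁ t₂ ×ˢ B
        · rw [indicator_of_mem hq]
          gcongr
          rw [Real.enorm_eq_ofReal_abs]
          exact ENNReal.ofReal_le_ofReal (hC _)
        · have : G (t, x) = 0 := by
            by_cases ht : t ∈ Icc t₁ t₂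
            · exact hGx t x fun hx => hq ⟨ht, hx⟩
            · exact hGt t ht x
          simp [this, hp0]
      refine (lintegral_mono hle).trans_lt ?_
      rw [lintegral_indicator_const (measurableSet_Icc.prod hB), Measure.volume_eq_prod,
        Measure.prod_prod]
      exact ENNReal.mul_lt_top (ENNReal.rpow_lt_top_of_nonneg hp0.le ENNReal.ofReal_ne_top)
        (ENNReal.mul_lt_top (by simp) hBfin.lt_top)
    have hB' : ∫⁻ t, gagliardo s p univ (fun x => tmol κ G (t, x)) < ⊤ := by
      rw [← lintegral_gd_rpow hp0 hm]
      have e : gd s p (tmol κ G) = tmol κ (gd s p G) := by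
        ext q
        exact gd_tmol hκ.continuous hκ.hasCompactSupport q (hslice _) (hslice _)
      rw [e]
      exact (lintegral_tmol_rpow_le hκ hp.le (measurable_gd hG)).trans_lt
        ((memLp_iff_lintegral hp0 (measurable_gd hG).aestronglyMeasurable).1 hgd)
    have hle : ∀ t, sobolevNorm s p univ (fun x => tmol κ G (t, x)) ^ p ≤
        2 ^ (p - 1) * ((∫⁻ x, ENNReal.ofReal (|tmol κ G (t, x)| ^ p)) +
          gagliardo s p univ (fun x => tmol κ G (t, x))) := by
      intro t
      unfold sobolevNorm
      refine (ENNReal.rpow_add_le_mul_rpow_add_rpow _ _ hp.le).trans ?_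
      rw [← ENNReal.rpow_mul, ← ENNReal.rpow_mul, one_div_mul_cancel hp0.ne', ENNReal.rpow_one,
        ENNReal.rpow_one, Measure.restrict_univ]
    refine (setLIntegral_le_lintegral _ _).trans_lt ((lintegral_mono hle).trans_lt ?_)
    have hmA : Measurable fun t => ∫⁻ x, ENNReal.ofReal (|tmol κ G (t, x)| ^ p) :=
      Measurable.lintegral_prod_right' (f := fun q => ENNReal.ofReal (|tmol κ G q| ^ p))
        (by fun_prop)
    rw [lintegral_const_mul' _ _ (by finiteness), lintegral_add_left hmA]
    exact ENNReal.mul_lt_top (by finiteness) (ENNReal.add_lt_top.2 ⟨hA, hB'⟩)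
  · exact ae_of_all _ fun t => ae_of_all _ fun x hx => tmol_eq_zero_of_slice fun σ => hGx σ x hx
  · refine ae_of_all _ fun t f g hf hg c => ?_
    rw [← integral_const_mul, ← integral_add ((hint t f hf).const_mul c) (hint t g hg)]
    congr 1; ext x; ring
  · intro f hf
    have : AEStronglyMeasurable (fun q : ℝ × Rn n => tmol (deriv κ) G q * f q.2)
        ((volume.restrict (Ioo τ₁ τ₂)).prod (volume.restrict B)) :=
      hm'.aestronglyMeasurable.mul hf.1.comp_snd
    exact this.integral_prod_right'
  · refine ⟨fun _ => ENNReal.ofReal C' * volume B ^ (1 - 1 / p), measurable_const, ?_, ?_⟩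
    · rw [lintegral_const]
      refine ENNReal.mul_lt_top (ENNReal.rpow_lt_top_of_nonneg ?_ ?_) (by simp)
      · exact div_nonneg hp0.le (by linarith)
      · refine ENNReal.mul_ne_top ENNReal.ofReal_ne_top
          (ENNReal.rpow_ne_top_of_nonneg ?_ hBfin)
        rw [sub_nonneg, div_le_one hp0]; exact hp.le
    · refine ae_of_all _ fun t f hf => ?_
      rw [← Real.enorm_eq_ofReal_abs, mul_assoc]
      refine (enorm_integral_le_lintegral_enorm _).trans ?_
      calc ∫⁻ x in B, ‖tmol (deriv κ) G (t, x) * f x‖ₑ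
          ≤ ∫⁻ x in B, ENNReal.ofReal C' * ‖f x‖ₑ := by
            refine lintegral_mono fun x => ?_
            simp only [enorm_mul]
            gcongr
            rw [Real.enorm_eq_ofReal_abs]
            exact ENNReal.ofReal_le_ofReal (hb' _)
        _ = ENNReal.ofReal C' * ∫⁻ x in B, ‖f x‖ₑ :=
            lintegral_const_mul' _ _ ENNReal.ofReal_ne_top
        _ ≤ _ := by gcongr; exact lintegral_enorm_le_sobolevNorm hp hf.1
  · exact fun t _ => hslice_int t
  -- Fubini reduces the identity to the fundamental theorem of calculus in time for each fixed `x`;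
  -- since `G` is bounded, every slice is locally integrable and no exceptional set arises.
  · rintro f hf ⟨M, hM⟩ a b _ hab _
    have hfi := hf.integrableOn hp hBfin
    have hprod : ∀ t, Integrable (fun x => tmol κ G (t, x) * f x) (volume.restrict B) := fun t =>
      hfi.bdd_mul (c := C * ∫ σ, |κ σ|)
        (by fun_prop : Measurable fun x => tmol κ G (t, x)).aestronglyMeasurable
        (ae_of_all _ fun x => abs_tmol_le hκ.integrable hC (t, x))
    have hI : Integrable (fun q : ℝ × Rn n => tmol (deriv κ) G q * f q.2)
        ((volume.restrict (Ioc a b)).prod (volume.restrict B)) :=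
      (Integrable.comp_snd hfi _).bdd_mul (c := C') hm'.aestronglyMeasurable
        (ae_of_all _ hb')
    rw [intervalIntegral.integral_of_le hab, integral_integral_swap hI,
      ← integral_sub (hprod b) (hprod a)]
    congr 1; ext x
    rw [integral_mul_const, ← intervalIntegral.integral_of_le hab,
      intervalIntegral.integral_eq_sub_of_hasDerivAt
        (fun t _ => hasDerivAt_tmol hκ.contDiff hκ.hasCompactSupport (hslice x) t)
        ((continuous_tmol hκd hκc (hslice x)).intervalIntegrable _ _)]
    ring
  · intro x _
    have key : ∀ t, (t ≤ τ₁ ∨ τ₂ ≤ t) → tmol κ G (t, x) = 0 := by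
      intro t ht
      unfold tmol
      rw [← integral_zero ℝ ℝ]
      congr 1; ext σ
      by_cases hσ : σ ∈ Icc t₁ t₂
      · rw [hκ.eq_zero (t - σ), mul_zero]
        rw [lt_abs]
        rcases ht with ht | ht
        · right; linarith [hσ.1]
        · left; linarith [hσ.2]
      · rw [hGt σ hσ x, zero_mul]
    exact ⟨key τ₁ (Or.inl le_rfl), key τ₂ (Or.inr le_rfl)⟩

/-! ### Cut-off functions -/

/-- In polar coordinates the radial integrand is at most `r^(p(1-s)-1)` near zero, by the linear
bound, and `r^(-sp-1)` at infinity, by the constant bound, up to constants. The first needs `s < 1`,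
the second `s > 0`. -/
theorem lintegral_min_rpow_mul_lt_top (hn : 1 ≤ n) (hs : 0 < s) (hs1 : s < 1) (hp : 1 < p)
    {L C : ℝ} (hL : 0 ≤ L) (hC : 0 ≤ C) :
    ∫⁻ z : Rn n, ENNReal.ofReal (min (L * ‖z‖) C ^ p * ‖z‖ ^ (-((n : ℝ) + s * p))) < ⊤ := by
  have : Nonempty (Fin n) := ⟨⟨0, hn⟩⟩
  set f : ℝ → ℝ := fun r => min (L * r) C ^ p * r ^ (-((n : ℝ) + s * p))
  have hdim : Module.finrank ℝ (Rn n) = n := by simp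
  have hfm : Measurable f := by unfold f; fun_prop
  have hsp : 0 < s * p := by positivity
  have hpow : ∀ r : ℝ, 0 < r → r ^ (n - 1) = r ^ ((n : ℝ) - 1) := fun r hr => by
    rw [← Real.rpow_natCast, Nat.cast_sub hn, Nat.cast_one]
  have hI : IntegrableOn (fun y : ℝ => y ^ (n - 1) • f y) (Ioi 0) := by
    rw [← Ioc_union_Ioi_eq_Ioi (zero_le_one' ℝ)]
    refine IntegrableOn.union ?_ ?_
    · have h0 : IntegrableOn (fun y : ℝ => L ^ p * y ^ (p * (1 - s) - 1)) (Ioc 0 1) := by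
        have : 0 < p * (1 - s) := mul_pos (by linarith) (by linarith)
        exact ((intervalIntegral.intervalIntegrable_rpow' (by linarith)).1).const_mul _
      refine h0.mono' (by fun_prop) ?_
      filter_upwards [ae_restrict_mem measurableSet_Ioc] with y hy
      have hy0 : 0 < y := hy.1
      have hm : 0 ≤ min (L * y) C := le_min (by positivity) hC
      rw [smul_eq_mul, Real.norm_of_nonneg (by positivity), hpow y hy0]
      calc y ^ ((n : ℝ) - 1) * (min (L * y) C ^ p * y ^ (-((n : ℝ) + s * p)))
          ≤ y ^ ((n : ℝ) - 1) * ((L * y) ^ p * y ^ (-((n : ℝ) + s * p))) := by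
            gcongr; exact min_le_left _ _
        _ = L ^ p * y ^ (p * (1 - s) - 1) := by
            rw [Real.mul_rpow hL hy0.le]
            have : y ^ (p * (1 - s) - 1) =
                y ^ ((n : ℝ) - 1) * (y ^ p * y ^ (-((n : ℝ) + s * p))) := by
              rw [← Real.rpow_add hy0, ← Real.rpow_add hy0]; congr 1; ring
            rw [this]; ring
    · have h0 : IntegrableOn (fun y : ℝ => C ^ p * y ^ (-(s * p) - 1)) (Ioi 1) :=
        (integrableOn_Ioi_rpow_of_lt (by linarith) one_pos).const_mul _
      refine h0.mono' (by fun_prop) ?_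
      filter_upwards [ae_restrict_mem measurableSet_Ioi] with y hy
      have hy0 : 0 < y := one_pos.trans hy
      have hm : 0 ≤ min (L * y) C := le_min (by positivity) hC
      rw [smul_eq_mul, Real.norm_of_nonneg (by positivity), hpow y hy0]
      calc y ^ ((n : ℝ) - 1) * (min (L * y) C ^ p * y ^ (-((n : ℝ) + s * p)))
          ≤ y ^ ((n : ℝ) - 1) * (C ^ p * y ^ (-((n : ℝ) + s * p))) := by
            gcongr; exact min_le_right _ _
        _ = C ^ p * y ^ (-(s * p) - 1) := by
            have : y ^ (-(s * p) - 1) = y ^ ((n : ℝ) - 1) * y ^ (-((n : ℝ) + s * p)) := by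
              rw [← Real.rpow_add hy0]; congr 1; ring
            rw [this]; ring
  have := (integrable_fun_norm_addHaar (volume : Measure (Rn n)) (f := f)).2 (by rwa [hdim])
  exact this.lintegral_lt_top

/-- Nonnegative bounded Lipschitz functions vanishing outside `B`. -/
structure IsCutoff (B : Set (Rn n)) (Ψ : Rn n → ℝ) : Prop where
  nonneg : ∀ x, 0 ≤ Ψ x
  bounded : ∃ C : ℝ, ∀ x, Ψ x ≤ C
  lipschitz : ∃ L : NNReal, LipschitzWith L Ψ
  eq_zero : ∀ x ∉ B, Ψ x = 0

theorem IsCutoff.measurable {B : Set (Rn n)} {Ψ : Rn n → ℝ} (hΨ : IsCutoff B Ψ) :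
    Measurable Ψ := by
  obtain ⟨L, hL⟩ := hΨ.lipschitz
  exact hL.continuous.measurable

/-- `(Ψ(x) - Ψ(y)) |x - y|^(-(n + sp)/p)`. -/
noncomputable def cutoffDiff (s p : ℝ) (Ψ : Rn n → ℝ) (z : Rn n × Rn n) : ℝ :=
  (Ψ z.1 - Ψ z.2) * singKernel s p z.1 z.2 ^ (1 / p)

@[fun_prop]
theorem measurable_cutoffDiff {Ψ : Rn n → ℝ} (hΨ : Measurable Ψ) :
    Measurable (cutoffDiff s p Ψ) := by
  unfold cutoffDiff; fun_prop

/-- After translation by `y`, Lipschitz continuity and boundedness of `Ψ` give one majorant; the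
uniformity in `y` is what later allows products with arbitrary `L^p` functions of `y`. -/
theorem IsCutoff.exists_bound (hn : 1 ≤ n) (hs : 0 < s) (hs1 : s < 1) (hp : 1 < p)
    {B : Set (Rn n)} {Ψ : Rn n → ℝ} (hΨ : IsCutoff B Ψ) :
    ∃ J : ℝ≥0∞, J < ⊤ ∧ ∀ y, ∫⁻ x, ‖cutoffDiff s p Ψ (x, y)‖ₑ ^ p ≤ J := by
  obtain ⟨C, hC⟩ := hΨ.bounded
  obtain ⟨L, hL⟩ := hΨ.lipschitz
  have hC0 : 0 ≤ C := (hΨ.nonneg 0).trans (hC 0)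
  refine ⟨_, lintegral_min_rpow_mul_lt_top hn hs hs1 hp L.coe_nonneg hC0, fun y => ?_⟩
  rw [← lintegral_sub_right_eq_self (fun z : Rn n => ENNReal.ofReal
    (min (L * ‖z‖) C ^ p * ‖z‖ ^ (-((n : ℝ) + s * p)))) y]
  refine lintegral_mono fun x => ?_
  unfold cutoffDiff
  rw [enorm_mul_singKernel_rpow (by linarith)]
  apply ENNReal.ofReal_le_ofReal
  unfold singKernel
  gcongr
  refine le_min ?_ ?_
  · simpa [dist_eq_norm] using hL.dist_le_mul x y
  · rw [abs_le]; constructor <;> linarith [hC x, hC y, hΨ.nonneg x, hΨ.nonneg y]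

theorem cutoffDiff_swap (Ψ : Rn n → ℝ) (x y : Rn n) :
    ‖cutoffDiff s p Ψ (x, y)‖ₑ = ‖cutoffDiff s p Ψ (y, x)‖ₑ := by
  unfold cutoffDiff
  rw [singKernel_comm, ← enorm_neg]
  congr 1; ring

/-- The difference vanishes unless one of the two points lies in `B`. Integrating the other point
first gives the uniform bound, and `B` has finite measure. -/
theorem IsCutoff.lintegral_cutoffDiff_lt_top (hn : 1 ≤ n) (hs : 0 < s) (hs1 : s < 1) (hp : 1 < p)
    {B : Set (Rn n)} (hB : MeasurableSet B) (hBfin : volume B ≠ ⊤) {Ψ : Rn n → ℝ}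
    (hΨ : IsCutoff B Ψ) : ∫⁻ z, ‖cutoffDiff s p Ψ z‖ₑ ^ p < ⊤ := by
  obtain ⟨J, hJ, hJb⟩ := hΨ.exists_bound hn hs hs1 hp
  have hm := hΨ.measurable
  have hp0 : 0 < p := by linarith
  have hfin : ∫⁻ y, B.indicator (fun _ => J) y < ⊤ := by
    rw [lintegral_indicator_const hB]
    exact ENNReal.mul_lt_top hJ hBfin.lt_top
  have hmz : Measurable fun z : Rn n × Rn n => ‖cutoffDiff s p Ψ z‖ₑ ^ p := by fun_prop
  have hm1 : Measurable fun z : Rn n × Rn n =>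
      B.indicator (fun _ => (1 : ℝ≥0∞)) z.2 * ‖cutoffDiff s p Ψ z‖ₑ ^ p :=
    ((measurable_const.indicator hB).comp measurable_snd).mul hmz
  have hm2 : Measurable fun z : Rn n × Rn n =>
      B.indicator (fun _ => (1 : ℝ≥0∞)) z.1 * ‖cutoffDiff s p Ψ z‖ₑ ^ p :=
    ((measurable_const.indicator hB).comp measurable_fst).mul hmz
  have hle : ∀ z, ‖cutoffDiff s p Ψ z‖ₑ ^ p ≤
      B.indicator (fun _ => (1 : ℝ≥0∞)) z.2 * ‖cutoffDiff s p Ψ z‖ₑ ^ p +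
      B.indicator (fun _ => (1 : ℝ≥0∞)) z.1 * ‖cutoffDiff s p Ψ z‖ₑ ^ p := by
    rintro ⟨x, y⟩
    by_cases hx : x ∈ B
    · simp [hx]
    by_cases hy : y ∈ B
    · simp [hy]
    · simp [cutoffDiff, hΨ.eq_zero x hx, hΨ.eq_zero y hy, hp0]
  refine (lintegral_mono hle).trans_lt ?_
  rw [lintegral_add_left hm1]
  refine ENNReal.add_lt_top.2 ⟨?_, ?_⟩
  · rw [Measure.volume_eq_prod, lintegral_prod_symm _ hm1.aemeasurable]
    refine (lintegral_mono fun y => ?_).trans_lt hfin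
    simp only
    rw [lintegral_const_mul _ (by fun_prop)]
    by_cases hy : y ∈ B
    · simpa [hy] using hJb y
    · simp [hy]
  · rw [Measure.volume_eq_prod, lintegral_prod _ hm2.aemeasurable]
    refine (lintegral_mono fun x => ?_).trans_lt hfin
    simp only
    rw [lintegral_const_mul _ (by fun_prop)]
    simp_rw [cutoffDiff_swap Ψ x]
    by_cases hx : x ∈ B
    · simpa [hx] using hJb x
    · simp [hx]

theorem IsCutoff.memLp_time_mul (hn : 1 ≤ n) (hs : 0 < s) (hs1 : s < 1) (hp : 1 < p)
    {B : Set (Rn n)} (hB : MeasurableSet B) (hBfin : volume B ≠ ⊤) {Ψ : Rn n → ℝ}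
    (hΨ : IsCutoff B Ψ) {c : ℝ → ℝ} (hc : Measurable c) (hcp : MemLp c (ENNReal.ofReal p)) :
    MemLp (fun q : ℝ × Rn n × Rn n => c q.1 * cutoffDiff s p Ψ q.2) (ENNReal.ofReal p) := by
  have hp0 : 0 < p := by linarith
  have hm := hΨ.measurable
  rw [memLp_iff_lintegral hp0 (by fun_prop : Measurable _).aestronglyMeasurable]
  simp_rw [enorm_mul, ENNReal.mul_rpow_of_nonneg _ _ hp0.le]
  rw [Measure.volume_eq_prod, lintegral_prod_mul (f := fun t => ‖c t‖ₑ ^ p)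
    (g := fun z => ‖cutoffDiff s p Ψ z‖ₑ ^ p) (by fun_prop) (by fun_prop)]
  exact ENNReal.mul_lt_top ((memLp_iff_lintegral hp0 hc.aestronglyMeasurable).1 hcp)
    (hΨ.lintegral_cutoffDiff_lt_top hn hs hs1 hp hB hBfin)

theorem IsCutoff.memLp_mul (hn : 1 ≤ n) (hs : 0 < s) (hs1 : s < 1) (hp : 1 < p)
    {B : Set (Rn n)} {Ψ : Rn n → ℝ} (hΨ : IsCutoff B Ψ) {f : ℝ × Rn n → ℝ} (hf : Measurable f)
    (hfp : MemLp f (ENNReal.ofReal p)) :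
    MemLp (fun q : ℝ × Rn n × Rn n => f (q.1, q.2.2) * cutoffDiff s p Ψ q.2)
      (ENNReal.ofReal p) := by
  have hp0 : 0 < p := by linarith
  have hm := hΨ.measurable
  obtain ⟨J, hJ, hJb⟩ := hΨ.exists_bound hn hs hs1 hp
  rw [memLp_iff_lintegral hp0 (by fun_prop : Measurable _).aestronglyMeasurable]
  rw [memLp_iff_lintegral hp0 hf.aestronglyMeasurable] at hfp
  simp_rw [enorm_mul, ENNReal.mul_rpow_of_nonneg _ _ hp0.le]
  rw [Measure.volume_eq_prod, lintegral_prod _ (by fun_prop)]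
  rw [Measure.volume_eq_prod, lintegral_prod _ (by fun_prop)] at hfp
  calc _ ≤ ∫⁻ t, (∫⁻ y, ‖f (t, y)‖ₑ ^ p) * J := by
        refine lintegral_mono fun t => ?_
        simp only
        rw [Measure.volume_eq_prod, lintegral_prod_symm _ (by fun_prop),
          ← lintegral_mul_const _ (by fun_prop)]
        refine lintegral_mono fun y => ?_
        simp only
        rw [lintegral_const_mul _ (by fun_prop)]
        gcongr
        exact hJb y
    _ = (∫⁻ t, ∫⁻ y, ‖f (t, y)‖ₑ ^ p) * J := lintegral_mul_const' _ _ hJ.ne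
    _ < ⊤ := ENNReal.mul_lt_top hfp hJ

theorem IsCutoff.abs_gd_mul_le {B : Set (Rn n)} {Ψ : Rn n → ℝ} (hΨ : IsCutoff B Ψ) {C : ℝ}
    (hC : ∀ x, Ψ x ≤ C) (f : ℝ × Rn n → ℝ) (c : ℝ → ℝ) (q : ℝ × Rn n × Rn n) :
    |gd s p (fun q => f q * Ψ q.2 * c q.1) q| ≤
      |c q.1| * (C * |gd s p f q| + |f (q.1, q.2.2)| * |cutoffDiff s p Ψ q.2|) := by
  have e : gd s p (fun q => f q * Ψ q.2 * c q.1) q =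
      c q.1 * (Ψ q.2.1 * gd s p f q + f (q.1, q.2.2) * cutoffDiff s p Ψ q.2) := by
    unfold gd cutoffDiff; ring
  rw [e, abs_mul]
  gcongr
  refine (abs_add_le _ _).trans ?_
  rw [abs_mul, abs_mul, abs_of_nonneg (hΨ.nonneg _)]
  gcongr
  exact hC _

theorem abs_gd_comp_le {Γ : ℝ → ℝ} {L : ℝ} (hL : ∀ a b, |Γ a - Γ b| ≤ L * |a - b|)
    (f : ℝ × Rn n → ℝ) (q : ℝ × Rn n × Rn n) :
    |gd s p (fun q => Γ (f q)) q| ≤ L * |gd s p f q| := by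
  unfold gd
  rw [abs_mul, abs_mul, ← mul_assoc]
  gcongr
  exact hL _ _

/-! ### The flux -/

/-- `𝒜U(x,y,t) |x - y|^((n + sp)/p)`. -/
noncomputable def flux (s p : ℝ) (K : Rn n → Rn n → ℝ → ℝ) (U : ℝ × Rn n → ℝ)
    (q : ℝ × Rn n × Rn n) : ℝ :=
  opA p K (fun x t => U (t, x)) q.2.1 q.2.2 q.1 * singKernel s p q.2.1 q.2.2 ^ (-(1 / p))

theorem opA_self (K : Rn n → Rn n → ℝ → ℝ) (u : Rn n → ℝ → ℝ) (x : Rn n) (t : ℝ) :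
    opA p K u x x t = 0 := by simp [opA]

theorem singKernel_pos {x y : Rn n} (h : x ≠ y) : 0 < singKernel s p x y :=
  Real.rpow_pos_of_pos (norm_pos_iff.2 (sub_ne_zero.2 h)) _

/-- The singular weight is split between the two factors so that the nonlocal form becomes a pairing
of `L^(p')` with `L^p`. Off the diagonal the weights cancel; on it both sides vanish. -/
theorem flux_mul_gd (K : Rn n → Rn n → ℝ → ℝ) (U f : ℝ × Rn n → ℝ) (q : ℝ × Rn n × Rn n) :
    flux s p K U q * gd s p f q =
      opA p K (fun x t => U (t, x)) q.2.1 q.2.2 q.1 * (f (q.1, q.2.1) - f (q.1, q.2.2)) := by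
  by_cases h : q.2.1 = q.2.2
  · simp [flux, gd, h, opA_self]
  · have hk := singKernel_pos (s := s) (p := p) h
    have e : singKernel s p q.2.1 q.2.2 ^ (-(1 / p)) * singKernel s p q.2.1 q.2.2 ^ (1 / p) = 1 := by
      rw [← Real.rpow_add hk]; simp
    unfold flux gd
    linear_combination (opA p K (fun x t => U (t, x)) q.2.1 q.2.2 q.1 *
      (f (q.1, q.2.1) - f (q.1, q.2.2))) * e

theorem measurable_flux {Λ : ℝ} {K : Rn n → Rn n → ℝ → ℝ} (hK : IsEllipticKernel s p Λ K)
    {U : ℝ × Rn n → ℝ} (hU : Measurable U) : Measurable (flux s p K U) := by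
  have : Measurable fun q : ℝ × Rn n × Rn n => K q.2.1 q.2.2 q.1 :=
    hK.measurable.comp (g := fun q : Rn n × Rn n × ℝ => K q.1 q.2.1 q.2.2)
      (f := fun q : ℝ × Rn n × Rn n => (q.2.1, q.2.2, q.1)) (by fun_prop)
  unfold flux opA
  exact ((this.mul (by fun_prop)).mul (by fun_prop)).mul (by fun_prop)

theorem IsEllipticKernel.nonneg {Λ : ℝ} (hΛ : 1 ≤ Λ) {K : Rn n → Rn n → ℝ → ℝ}
    (hK : IsEllipticKernel s p Λ K) {x y : Rn n} (h : x ≠ y) (t : ℝ) : 0 ≤ K x y t :=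
  (mul_nonneg (inv_nonneg.2 (by linarith)) (singKernel_nonneg s p x y)).trans (hK.lower x y t h)

theorem abs_flux_le (hp : 1 < p) {Λ : ℝ} (hΛ : 1 ≤ Λ) {K : Rn n → Rn n → ℝ → ℝ}
    (hK : IsEllipticKernel s p Λ K) (U : ℝ × Rn n → ℝ) (q : ℝ × Rn n × Rn n) :
    |flux s p K U q| ≤ Λ * |gd s p U q| ^ (p - 1) := by
  have hΛ0 : 0 ≤ Λ := by linarith
  by_cases h : q.2.1 = q.2.2
  · simp only [flux, h, opA_self, zero_mul, abs_zero]
    positivity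
  · have hk := singKernel_pos (s := s) (p := p) h
    have hK0 := hK.nonneg hΛ h q.1
    unfold flux opA gd
    set a := U (q.1, q.2.1) - U (q.1, q.2.2)
    set k := singKernel s p q.2.1 q.2.2
    have hsplit : |a| ^ (p - 2) * |a| = |a| ^ (p - 1) := by
      rw [← Real.rpow_add_one' (abs_nonneg _) (by linarith)]; congr 1; ring
    rw [abs_mul, abs_mul, abs_mul, abs_of_nonneg hK0, abs_of_nonneg (Real.rpow_nonneg hk.le _),
      abs_of_nonneg (Real.rpow_nonneg (abs_nonneg _) _), abs_mul,
      abs_of_nonneg (Real.rpow_nonneg hk.le _), Real.mul_rpow (abs_nonneg _)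
      (Real.rpow_nonneg hk.le _), ← Real.rpow_mul hk.le, mul_assoc (K _ _ _), hsplit]
    have e : k ^ (1 / p * (p - 1)) = k * k ^ (-(1 / p)) := by
      conv_rhs => rw [← Real.rpow_one k]
      rw [Real.rpow_one, ← Real.rpow_one_add' hk.le]
      · congr 1; field_simp; ring
      · have : 1 / p < 1 := by rw [div_lt_one (by linarith)]; exact hp
        linarith
    rw [e]
    calc K q.2.1 q.2.2 q.1 * |a| ^ (p - 1) * k ^ (-(1 / p))
        ≤ (Λ * k) * |a| ^ (p - 1) * k ^ (-(1 / p)) := by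
          gcongr
          exact hK.upper _ _ _ h
      _ = _ := by ring

theorem memLp_flux (hp : 1 < p) {Λ : ℝ} (hΛ : 1 ≤ Λ) {K : Rn n → Rn n → ℝ → ℝ}
    (hK : IsEllipticKernel s p Λ K) {U : ℝ × Rn n → ℝ} (hU : Measurable U)
    (hgd : MemLp (gd s p U) (ENNReal.ofReal p)) :
    MemLp (flux s p K U) (ENNReal.ofReal (p / (p - 1))) := by
  have hp1 : 0 < p - 1 := by linarith
  have hp0 : 0 < p := by linarith
  have hp' : 0 < p / (p - 1) := by positivity
  rw [memLp_iff_lintegral hp' (measurable_flux hK hU).aestronglyMeasurable]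
  rw [memLp_iff_lintegral hp0 (measurable_gd hU).aestronglyMeasurable] at hgd
  have hle : ∀ q, ‖flux s p K U q‖ₑ ^ (p / (p - 1)) ≤
      ENNReal.ofReal (Λ ^ (p / (p - 1))) * ‖gd s p U q‖ₑ ^ p := by
    intro q
    rw [← ofReal_abs_rpow hp'.le, ← ofReal_abs_rpow hp0.le,
      ← ENNReal.ofReal_mul (Real.rpow_nonneg (by linarith) _)]
    apply ENNReal.ofReal_le_ofReal
    calc |flux s p K U q| ^ (p / (p - 1)) ≤ (Λ * |gd s p U q| ^ (p - 1)) ^ (p / (p - 1)) := by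
          gcongr
          exact abs_flux_le hp hΛ hK U q
      _ = _ := by
          rw [Real.mul_rpow (by linarith) (by positivity), ← Real.rpow_mul (abs_nonneg _),
            mul_div_cancel₀ _ hp1.ne']
  refine (lintegral_mono hle).trans_lt ?_
  rw [lintegral_const_mul' _ _ ENNReal.ofReal_ne_top]
  exact ENNReal.mul_lt_top ENNReal.ofReal_lt_top hgd

theorem holderConjugate_ofReal (hp : 1 < p) :
    (ENNReal.ofReal (p / (p - 1))).HolderConjugate (ENNReal.ofReal p) := by
  have := (Real.HolderConjugate.conjExponent hp).symm
  exact this.ennrealOfReal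

/-! ### The subsolution inequality for mollified test functions -/

/-- `U` is a Borel representative of `u` on `ℝⁿ × (τ₁, τ₂)`, with the time variable first and
extended by zero in time. -/
structure IsRep (s p : ℝ) (τ₁ τ₂ : ℝ) (u : Rn n → ℝ → ℝ) (U : ℝ × Rn n → ℝ) : Prop where
  measurable : Measurable U
  ae_eq : ∀ᵐ t ∂(volume.restrict (Ioo τ₁ τ₂)), ∀ᵐ x, u x t = U (t, x)
  eq_zero : ∀ t ∉ Ioo τ₁ τ₂, ∀ x, U (t, x) = 0
  memLp : MemLp U (ENNReal.ofReal p)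
  memLp_gd : MemLp (gd s p U) (ENNReal.ofReal p)

theorem integrable_mul_gd (hp : 1 < p) {F g : ℝ × Rn n × Rn n → ℝ}
    (hF : MemLp F (ENNReal.ofReal (p / (p - 1)))) (hg : MemLp g (ENNReal.ofReal p)) :
    Integrable fun q => F q * g q := by
  have := holderConjugate_ofReal hp
  exact hF.integrable_mul hg

theorem integral_prod_eq_iterated {F : ℝ × Rn n × Rn n → ℝ} (hF : Integrable F) :
    ∫ q, F q = ∫ t, ∫ x, ∫ y, F (t, x, y) := by
  rw [Measure.volume_eq_prod] at hF ⊢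
  rw [integral_prod _ hF]
  apply integral_congr_ae
  filter_upwards [hF.prod_right_ae] with t ht
  rw [Measure.volume_eq_prod] at ht ⊢
  exact integral_prod _ ht

theorem memLp_gd_tmol {κ : ℝ → ℝ} {h : ℝ} (hp : 1 < p) (hκ : IsTimeKernel h κ)
    {f : ℝ × Rn n → ℝ} (hf : Measurable f) (hslice : ∀ᵐ x, LocallyIntegrable fun σ => f (σ, x))
    (hgd : MemLp (gd s p f) (ENNReal.ofReal p)) :
    (gd s p (tmol κ f) =ᵐ[volume] tmol κ (gd s p f)) ∧
      MemLp (gd s p (tmol κ f)) (ENNReal.ofReal p) := by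
  have e : gd s p (tmol κ f) =ᵐ[volume] tmol κ (gd s p f) := by
    have h1 : ∀ᵐ q : ℝ × Rn n × Rn n, LocallyIntegrable fun σ => f (σ, q.2.1) :=
      (Measure.quasiMeasurePreserving_fst.comp Measure.quasiMeasurePreserving_snd).ae hslice
    have h2 : ∀ᵐ q : ℝ × Rn n × Rn n, LocallyIntegrable fun σ => f (σ, q.2.2) :=
      (Measure.quasiMeasurePreserving_snd.comp Measure.quasiMeasurePreserving_snd).ae hslice
    filter_upwards [h1, h2] with q hx hy
    exact gd_tmol hκ.continuous hκ.hasCompactSupport q hx hy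
  refine ⟨e, (memLp_congr_ae e).2 ⟨?_, ?_⟩⟩
  · exact (measurable_tmol hκ.continuous.measurable (measurable_gd hf)).aestronglyMeasurable
  · exact (eLpNorm_tmol_le hκ hp.le (measurable_gd hf)).trans_lt hgd.2

/-- Rewrites the iterated integrals of the weak formulation as a single integral over the product
space, which Hölder integrability permits, and replaces `u` by its Borel representative, whose zero
extension makes the restriction to `(τ₁, τ₂)` harmless. -/
theorem IsSubsolution.integral_flux_le (hp : 1 < p) {Λ : ℝ} (hΛ : 1 ≤ Λ)
    {K : Rn n → Rn n → ℝ → ℝ} (hK : IsEllipticKernel s p Λ K) {κ : ℝ → ℝ} {h : ℝ}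
    (hκ : IsTimeKernel h κ) {B : Set (Rn n)} (hB : MeasurableSet B) (hBfin : volume B ≠ ⊤)
    {τ₁ τ₂ t₁ t₂ : ℝ} (h1 : τ₁ + h < t₁) (h2 : t₂ + h < τ₂) {u : Rn n → ℝ → ℝ}
    {U : ℝ × Rn n → ℝ} (hU : IsRep s p τ₁ τ₂ u U) (hu : IsSubsolution s p K B τ₁ τ₂ u)
    {G : ℝ × Rn n → ℝ} (hG : Measurable G) {C : ℝ} (hC : ∀ q, |G q| ≤ C) (hG0 : ∀ q, 0 ≤ G q)
    (hGx : ∀ t, ∀ x ∉ B, G (t, x) = 0) (hGt : ∀ t ∉ Icc t₁ t₂, ∀ x, G (t, x) = 0)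
    (hgd : MemLp (gd s p G) (ENNReal.ofReal p)) :
    ∫ q, flux s p K U q * gd s p (tmol κ G) q ≤
      ∫ t in Ioo τ₁ τ₂, ∫ x in B, tmol (deriv κ) G (t, x) * U (t, x) := by
  have htest := isTestFunction_tmol hp hκ hB hBfin h1 h2 hG hC hGx hGt hgd
  have hpos : ∀ x, ∀ t ∈ Icc τ₁ τ₂, 0 ≤ tmol κ G (t, x) := fun x t _ =>
    integral_nonneg fun σ => mul_nonneg (hG0 _) (hκ.nonneg _)
  have hineq := hu.ineq _ _ htest hpos
  have hslice : ∀ᵐ x : Rn n, LocallyIntegrable fun σ => G (σ, x) := ae_of_all _ fun x =>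
    locallyIntegrable_of_bounded (by fun_prop) fun t => hC (t, x)
  have hI := integrable_mul_gd hp (memLp_flux hp hΛ hK hU.measurable hU.memLp_gd)
    (memLp_gd_tmol hp hκ hG hslice hgd).2
  have e1 : (∫ t in Ioo τ₁ τ₂, ∫ x, ∫ y, opA p K u x y t *
      (tmol κ G (t, x) - tmol κ G (t, y))) = ∫ q, flux s p K U q * gd s p (tmol κ G) q := by
    have e0 : (∫ t, ∫ x, ∫ y, flux s p K U (t, x, y) * gd s p (tmol κ G) (t, x, y)) =
        ∫ t in Ioo τ₁ τ₂, ∫ x, ∫ y, flux s p K U (t, x, y) * gd s p (tmol κ G) (t, x, y) := by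
      refine (setIntegral_eq_integral_of_forall_compl_eq_zero fun t ht => ?_).symm
      have : ∀ x y, flux s p K U (t, x, y) = 0 := fun x y => by
        simp [flux, opA, hU.eq_zero t ht]
      simp [this]
    rw [integral_prod_eq_iterated hI, e0]
    apply integral_congr_ae
    filter_upwards [hU.ae_eq] with t ht
    apply integral_congr_ae
    filter_upwards [ht] with x hx
    apply integral_congr_ae
    filter_upwards [ht] with y hy
    rw [flux_mul_gd]
    simp only [opA, hx, hy]
  have e2 : (∫ t in Ioo τ₁ τ₂, ∫ x in B, tmol (deriv κ) G (t, x) * u x t) =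
      ∫ t in Ioo τ₁ τ₂, ∫ x in B, tmol (deriv κ) G (t, x) * U (t, x) := by
    apply integral_congr_ae
    filter_upwards [hU.ae_eq] with t ht
    apply integral_congr_ae
    filter_upwards [ae_restrict_of_ae ht] with x hx
    rw [hx]
  rw [e1, e2] at hineq
  linarith

/-- Bounded nonnegative Lipschitz functions `Γ` with a primitive `P`. -/
structure IsProfile (Γ P : ℝ → ℝ) : Prop where
  nonneg : ∀ a, 0 ≤ Γ a
  bounded : ∃ C : ℝ, ∀ a, Γ a ≤ C
  lipschitz : ∃ L : ℝ, ∀ a b, |Γ a - Γ b| ≤ L * |a - b|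
  hasDerivAt : ∀ a, HasDerivAt P (Γ a) a

theorem IsProfile.continuous {Γ P : ℝ → ℝ} (h : IsProfile Γ P) : Continuous Γ := by
  obtain ⟨L, hL⟩ := h.lipschitz
  exact (LipschitzWith.of_dist_le' (K := L) fun a b => by
    simpa [Real.dist_eq] using hL a b).continuous

theorem IsProfile.continuous_primitive {Γ P : ℝ → ℝ} (h : IsProfile Γ P) : Continuous P :=
  continuous_iff_continuousAt.2 fun a => (h.hasDerivAt a).continuousAt

theorem IsProfile.abs_sub_le {Γ P : ℝ → ℝ} (h : IsProfile Γ P) {C : ℝ} (hC : ∀ a, Γ a ≤ C)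
    (a b : ℝ) : |P a - P b| ≤ C * |a - b| :=
  convex_univ.norm_image_sub_le_of_norm_hasDerivWithin_le (f := P) (f' := Γ) (C := C)
    (fun x _ => (h.hasDerivAt x).hasDerivWithinAt)
    (fun x _ => by rw [Real.norm_of_nonneg (h.nonneg x)]; exact hC x) (mem_univ b) (mem_univ a)

/-- The function `Γ(m) Ψ ζ 1_[t₁,t₂]`. -/
noncomputable def cutProfile (Γ : ℝ → ℝ) (Ψ : Rn n → ℝ) (Z : ℝ → ℝ) (t₁ t₂ : ℝ)
    (m : ℝ × Rn n → ℝ) (q : ℝ × Rn n) : ℝ :=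
  Γ (m q) * Ψ q.2 * (Icc t₁ t₂).indicator Z q.1

theorem measurable_cutProfile {Γ P : ℝ → ℝ} (hΓ : IsProfile Γ P) {B : Set (Rn n)} {Ψ : Rn n → ℝ}
    (hΨ : IsCutoff B Ψ) {Z : ℝ → ℝ} (hZ : Continuous Z) {t₁ t₂ : ℝ} {m : ℝ × Rn n → ℝ}
    (hm : Measurable m) : Measurable (cutProfile Γ Ψ Z t₁ t₂ m) := by
  have h1 := hΓ.continuous.measurable
  have h2 := hΨ.measurable
  have h3 : Measurable ((Icc t₁ t₂).indicator Z) := hZ.measurable.indicator measurableSet_Icc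
  unfold cutProfile
  fun_prop

theorem exists_bound_indicator {Z : ℝ → ℝ} (hZ : Continuous Z) (t₁ t₂ : ℝ) :
    ∃ C : ℝ, 0 ≤ C ∧ ∀ t, |(Icc t₁ t₂).indicator Z t| ≤ C := by
  obtain ⟨C, hC⟩ := isCompact_Icc.exists_bound_of_continuousOn (s := Icc t₁ t₂) hZ.continuousOn
  refine ⟨max C 0, le_max_right _ _, fun t => ?_⟩
  by_cases ht : t ∈ Icc t₁ t₂
  · rw [indicator_of_mem ht]; exact (hC t ht).trans (le_max_left _ _)
  · rw [indicator_of_notMem ht, abs_zero]; exact le_max_right _ _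

theorem memLp_indicator_Icc {Z : ℝ → ℝ} (hZ : Continuous Z) (t₁ t₂ : ℝ) (r : ℝ≥0∞) :
    MemLp ((Icc t₁ t₂).indicator Z) r := by
  rw [memLp_indicator_iff_restrict measurableSet_Icc]
  obtain ⟨C, hC⟩ := isCompact_Icc.exists_bound_of_continuousOn (s := Icc t₁ t₂) hZ.continuousOn
  refine MemLp.of_bound hZ.aestronglyMeasurable C ?_
  filter_upwards [ae_restrict_mem measurableSet_Icc] with t ht using hC t ht

/-- A discrete Leibniz rule combined with the Lipschitz bound for `Γ`. The constants do not depend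
on `m`, so one bound serves all mollifications `u_h` and their limit. -/
theorem abs_gd_cutProfile_le {Γ P : ℝ → ℝ} (hΓ : IsProfile Γ P) {B : Set (Rn n)} {Ψ : Rn n → ℝ}
    (hΨ : IsCutoff B Ψ) {Z : ℝ → ℝ} (hZ : Continuous Z) (t₁ t₂ : ℝ) :
    ∃ C₁ C₂ : ℝ, ∀ (m : ℝ × Rn n → ℝ) (q : ℝ × Rn n × Rn n),
      |gd s p (cutProfile Γ Ψ Z t₁ t₂ m) q| ≤ C₁ * |gd s p m q| +
        C₂ * |(Icc t₁ t₂).indicator Z q.1 * cutoffDiff s p Ψ q.2| := by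
  obtain ⟨CΨ, hCΨ⟩ := hΨ.bounded
  obtain ⟨CΓ, hCΓ⟩ := hΓ.bounded
  obtain ⟨L, hL⟩ := hΓ.lipschitz
  obtain ⟨CZ, hCZ0, hCZ⟩ := exists_bound_indicator hZ t₁ t₂
  refine ⟨CZ * (CΨ * L), CΓ, fun m q => ?_⟩
  have hCΨ0 : 0 ≤ CΨ := (hΨ.nonneg 0).trans (hCΨ 0)
  have hL0 : 0 ≤ L := by simpa using (abs_nonneg _).trans (hL 1 0)
  refine (hΨ.abs_gd_mul_le hCΨ (fun q => Γ (m q)) _ q).trans ?_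
  rw [mul_add]
  apply add_le_add
  · rw [mul_assoc, mul_assoc]
    gcongr
    · exact hCZ _
    · exact abs_gd_comp_le hL m q
  · rw [abs_mul, abs_of_nonneg (hΓ.nonneg _)]
    have := hCΓ (m (q.1, q.2.2))
    calc _ ≤ |(Icc t₁ t₂).indicator Z q.1| * (CΓ * |cutoffDiff s p Ψ q.2|) := by gcongr
      _ = _ := by ring

theorem memLp_gd_cutProfile (hn : 1 ≤ n) (hs : 0 < s) (hs1 : s < 1) (hp : 1 < p)
    {Γ P : ℝ → ℝ} (hΓ : IsProfile Γ P) {B : Set (Rn n)} (hB : MeasurableSet B)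
    (hBfin : volume B ≠ ⊤) {Ψ : Rn n → ℝ} (hΨ : IsCutoff B Ψ) {Z : ℝ → ℝ} (hZ : Continuous Z)
    (t₁ t₂ : ℝ) {m : ℝ × Rn n → ℝ} (hm : Measurable m)
    (hgd : MemLp (gd s p m) (ENNReal.ofReal p)) :
    MemLp (gd s p (cutProfile Γ Ψ Z t₁ t₂ m)) (ENNReal.ofReal p) := by
  obtain ⟨C₁, C₂, hC⟩ := abs_gd_cutProfile_le (s := s) (p := p) hΓ hΨ hZ t₁ t₂
  have h1 := hΨ.memLp_time_mul hn hs hs1 hp hB hBfin (hZ.measurable.indicator measurableSet_Icc)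
    (memLp_indicator_Icc hZ t₁ t₂ _)
  refine MemLp.mono' ((hgd.abs.const_mul C₁).add (h1.abs.const_mul C₂))
    (measurable_gd (measurable_cutProfile hΓ hΨ hZ hm)).aestronglyMeasurable
    (ae_of_all _ fun q => ?_)
  exact hC m q

/-! ### Integration by parts in time -/

theorem IsRep.integrable_time_prod (hp : 1 < p) {τ₁ τ₂ : ℝ} {u : Rn n → ℝ → ℝ}
    {U : ℝ × Rn n → ℝ} (hU : IsRep s p τ₁ τ₂ u U) {B : Set (Rn n)} (hBfin : volume B ≠ ⊤) :
    Integrable U (volume.prod (volume.restrict B)) := by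
  have : IsFiniteMeasure (volume.restrict B) := ⟨by simpa using hBfin.lt_top⟩
  have h0 : Integrable U ((volume.restrict (Ioo τ₁ τ₂)).prod (volume.restrict B)) := by
    refine MemLp.integrable (q := ENNReal.ofReal p)
      (by simpa using ENNReal.ofReal_le_ofReal hp.le) ?_
    refine hU.memLp.mono_measure ?_
    rw [Measure.volume_eq_prod]
    exact Measure.prod_mono Measure.restrict_le_self Measure.restrict_le_self
  rw [← integrableOn_univ, ← Measure.restrict_univ (μ := volume.restrict B),
    ← Measure.restrict_univ (μ := (volume : Measure ℝ)), Measure.prod_restrict]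
  have h1 : IntegrableOn U (Ioo τ₁ τ₂ ×ˢ univ) (volume.prod (volume.restrict B)) := by
    rw [IntegrableOn, ← Measure.prod_restrict, Measure.restrict_univ]
    exact h0
  rw [IntegrableOn, Measure.restrict_restrict MeasurableSet.univ, univ_inter]
  refine h1.of_forall_sdiff_eq_zero (MeasurableSet.univ.prod MeasurableSet.univ) ?_
  rintro ⟨t, x⟩ ⟨-, h⟩
  exact hU.eq_zero t (fun ht => h ⟨ht, mem_univ x⟩) x

theorem deriv_kernel_neg {h : ℝ} {κ : ℝ → ℝ} (hκ : IsTimeKernel h κ) (σ : ℝ) :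
    deriv κ (-σ) = -deriv κ σ := by
  have : (fun σ => κ (-σ)) = κ := funext hκ.even
  have h2 := deriv_comp_neg κ σ
  rw [this] at h2
  linarith

/-- Fubini moves the convolution from `g` to `v`. The kernel is even, so its derivative is odd: this
produces the minus sign of an integration by parts and returns the same mollifier on `v`. -/
theorem integral_tmol_deriv_mul {h : ℝ} {κ : ℝ → ℝ} (hκ : IsTimeKernel h κ) {t₁ t₂ C : ℝ}
    {g v : ℝ → ℝ} (hg : Measurable g) (hgC : ∀ t, |g t| ≤ C)
    (hgt : ∀ t ∉ Icc t₁ t₂, g t = 0) (hv : Integrable v) :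
    (∫ t, (∫ σ, g σ * deriv κ (t - σ)) * v t) =
      - ∫ σ, g σ * ∫ t, v t * deriv κ (σ - t) := by
  have hκd : Continuous (deriv κ) := hκ.contDiff.continuous_deriv le_rfl
  have hκc : HasCompactSupport (deriv κ) := hκ.hasCompactSupport.deriv
  obtain ⟨D, hD⟩ := hκc.exists_bound_of_continuous hκd
  have hgi : Integrable g := by
    have : IntegrableOn g (Icc t₁ t₂) :=
      Integrable.of_bound hg.aestronglyMeasurable C (ae_of_all _ hgC)
    exact this.integrable_of_forall_notMem_eq_zero hgt
  have hI : Integrable (fun z : ℝ × ℝ => deriv κ (z.1 - z.2) * (v z.1 * g z.2))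
      (volume.prod volume) :=
    (hv.mul_prod hgi).bdd_mul (c := D) (by fun_prop) (ae_of_all _ fun z => hD _)
  calc (∫ t, (∫ σ, g σ * deriv κ (t - σ)) * v t)
      = ∫ t, ∫ σ, deriv κ (t - σ) * (v t * g σ) := by
        congr 1; ext t
        rw [← integral_mul_const]
        congr 1; ext σ; ring
    _ = ∫ σ, ∫ t, deriv κ (t - σ) * (v t * g σ) := integral_integral_swap hI
    _ = _ := by
        rw [← integral_neg]
        congr 1; ext σ
        rw [← integral_const_mul, ← integral_neg]
        congr 1; ext t
        rw [← neg_sub σ t, deriv_kernel_neg hκ]; ring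

/-- Since `Γ(u_h) ∂ₜu_h = ∂ₜ P(u_h)`, the integrand is a total derivative up to the term containing
`Z'`. Here it is essential that `Γ` is evaluated at the mollified function and not at `u`. -/
theorem integral_cutProfile_mul_deriv {h : ℝ} {κ : ℝ → ℝ} (hκ : IsTimeKernel h κ)
    {Γ P : ℝ → ℝ} (hΓ : IsProfile Γ P) (Ψ : Rn n → ℝ)
    {Z : ℝ → ℝ} (hZ : ContDiff ℝ 1 Z) {t₁ t₂ : ℝ} (ht : t₁ ≤ t₂) {U : ℝ × Rn n → ℝ} {x : Rn n}
    (hU : LocallyIntegrable fun σ => U (σ, x)) :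
    ∫ σ, cutProfile Γ Ψ Z t₁ t₂ (tmol κ U) (σ, x) * tmol (deriv κ) U (σ, x) =
      P (tmol κ U (t₂, x)) * Ψ x * Z t₂ - P (tmol κ U (t₁, x)) * Ψ x * Z t₁ -
        ∫ t in t₁..t₂, P (tmol κ U (t, x)) * Ψ x * deriv Z t := by
  have hκd : Continuous (deriv κ) := hκ.contDiff.continuous_deriv le_rfl
  have hκc : HasCompactSupport (deriv κ) := hκ.hasCompactSupport.deriv
  have c1 := continuous_tmol hκ.continuous hκ.hasCompactSupport hU
  have c2 := continuous_tmol hκd hκc hU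
  have c3 := hΓ.continuous
  have c4 := hΓ.continuous_primitive
  have c5 := hZ.continuous
  have c6 := hZ.continuous_deriv le_rfl
  have hder : ∀ t ∈ uIcc t₁ t₂, HasDerivAt (fun t => P (tmol κ U (t, x)) * Ψ x * Z t)
      (Γ (tmol κ U (t, x)) * Ψ x * Z t * tmol (deriv κ) U (t, x) +
        P (tmol κ U (t, x)) * Ψ x * deriv Z t) t := by
    intro t _
    have d1 : HasDerivAt (fun t => P (tmol κ U (t, x)))
        (Γ (tmol κ U (t, x)) * tmol (deriv κ) U (t, x)) t :=
      (hΓ.hasDerivAt _).comp t (hasDerivAt_tmol hκ.contDiff hκ.hasCompactSupport hU t)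
    have d2 := (d1.mul_const (Ψ x)).mul ((hZ.differentiable one_ne_zero) t).hasDerivAt
    refine d2.congr_deriv ?_
    ring
  have hFTC := intervalIntegral.integral_eq_sub_of_hasDerivAt hder
    (Continuous.intervalIntegrable (by fun_prop) _ _)
  rw [intervalIntegral.integral_add (Continuous.intervalIntegrable (by fun_prop) _ _)
    (Continuous.intervalIntegrable (by fun_prop) _ _)] at hFTC
  have e : ∫ σ, cutProfile Γ Ψ Z t₁ t₂ (tmol κ U) (σ, x) * tmol (deriv κ) U (σ, x) =
      ∫ t in t₁..t₂, Γ (tmol κ U (t, x)) * Ψ x * Z t * tmol (deriv κ) U (t, x) := by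
    rw [intervalIntegral.integral_of_le ht, ← integral_Icc_eq_integral_Ioc,
      ← integral_indicator measurableSet_Icc]
    congr 1; ext σ
    unfold cutProfile
    by_cases hσ : σ ∈ Icc t₁ t₂ <;> simp [hσ]
  rw [e]
  linarith

theorem IsProfile.abs_primitive_le {Γ P : ℝ → ℝ} (h : IsProfile Γ P) {C : ℝ} (hC : ∀ a, Γ a ≤ C)
    (a : ℝ) : |P a| ≤ |P 0| + C * |a| := by
  have h1 := h.abs_sub_le hC a 0
  rw [sub_zero] at h1
  have h2 := abs_sub_abs_le_abs_sub (P a) (P 0)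
  linarith

/-- A crude bound whose constant blows up as the kernel concentrates; it is used only for
integrability with the kernel fixed. -/
theorem abs_tmol_le_slice {Z : Type*} {κ : ℝ → ℝ} {f : ℝ × Z → ℝ} {D : ℝ} (hD : ∀ σ, |κ σ| ≤ D)
    {z : Z} (hf : Integrable fun σ => f (σ, z)) (t : ℝ) :
    |tmol κ f (t, z)| ≤ D * ∫ σ, |f (σ, z)| := by
  rw [← integral_const_mul, ← Real.norm_eq_abs]
  refine norm_integral_le_of_norm_le (hf.abs.const_mul D) (ae_of_all _ fun σ => ?_)
  rw [norm_mul, mul_comm]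
  exact mul_le_mul_of_nonneg_right (hD _) (abs_nonneg _)

/-- The subsolution inequality with `Γ(u_h) Ψ ζ` on `[t₁, t₂]` as test function. -/
theorem IsSubsolution.mollified_le (hn : 1 ≤ n) (hs : 0 < s) (hs1 : s < 1) (hp : 1 < p)
    {Λ : ℝ} (hΛ : 1 ≤ Λ) {K : Rn n → Rn n → ℝ → ℝ} (hK : IsEllipticKernel s p Λ K) {κ : ℝ → ℝ}
    {h : ℝ} (hκ : IsTimeKernel h κ) {B : Set (Rn n)} (hB : MeasurableSet B)
    (hBfin : volume B ≠ ⊤) {τ₁ τ₂ t₁ t₂ : ℝ} (h1 : τ₁ + h < t₁) (h2 : t₂ + h < τ₂) (ht : t₁ ≤ t₂)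
    {u : Rn n → ℝ → ℝ} {U : ℝ × Rn n → ℝ} (hU : IsRep s p τ₁ τ₂ u U)
    (hu : IsSubsolution s p K B τ₁ τ₂ u) {Γ P : ℝ → ℝ} (hΓ : IsProfile Γ P) {Ψ : Rn n → ℝ}
    (hΨ : IsCutoff B Ψ) {Z : ℝ → ℝ} (hZ : ContDiff ℝ 1 Z) (hZ0 : ∀ t, 0 ≤ Z t) :
    (∫ q, flux s p K U q * gd s p (tmol κ (cutProfile Γ Ψ Z t₁ t₂ (tmol κ U))) q) +
        ∫ x in B, P (tmol κ U (t₂, x)) * Ψ x * Z t₂ ≤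
      (∫ x in B, P (tmol κ U (t₁, x)) * Ψ x * Z t₁) +
        ∫ x in B, ∫ t in t₁..t₂, P (tmol κ U (t, x)) * Ψ x * deriv Z t := by
  have : IsFiniteMeasure (volume.restrict B) := ⟨by simpa using hBfin.lt_top⟩
  obtain ⟨CΨ, hCΨ⟩ := hΨ.bounded
  obtain ⟨CΓ, hCΓ⟩ := hΓ.bounded
  obtain ⟨CZ, hCZ0, hCZ⟩ := exists_bound_indicator hZ.continuous t₁ t₂
  have hCΨ0 : 0 ≤ CΨ := (hΨ.nonneg 0).trans (hCΨ 0)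
  have hCΓ0 : 0 ≤ CΓ := (hΓ.nonneg 0).trans (hCΓ 0)
  have hκd : Continuous (deriv κ) := hκ.contDiff.continuous_deriv le_rfl
  have hκc : HasCompactSupport (deriv κ) := hκ.hasCompactSupport.deriv
  have hκi : Integrable (deriv κ) := hκd.integrable_of_hasCompactSupport hκc
  have hZd : Continuous (deriv Z) := hZ.continuous_deriv le_rfl
  have hΨm := hΨ.measurable
  have hUm := hU.measurable
  set m := tmol κ U with hm_def
  have hm : Measurable m := measurable_tmol hκ.continuous.measurable hUm
  have hslice := ae_integrable_slice hp.le hUm hU.memLp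
  set G := cutProfile Γ Ψ Z t₁ t₂ m
  have hGm : Measurable G := measurable_cutProfile hΓ hΨ hZ.continuous hm
  have hGC : ∀ q, |G q| ≤ CΓ * CΨ * CZ := fun q => by
    simp only [G, cutProfile]
    rw [abs_mul, abs_mul, abs_of_nonneg (hΓ.nonneg _), abs_of_nonneg (hΨ.nonneg _)]
    have := hΓ.nonneg (m q)
    have := hΨ.nonneg q.2
    gcongr
    exacts [hCΓ _, hCΨ _, hCZ _]
  have hG0 : ∀ q, 0 ≤ G q := fun q =>
    mul_nonneg (mul_nonneg (hΓ.nonneg _) (hΨ.nonneg _)) (indicator_nonneg (fun t _ => hZ0 t) _)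
  have hGx : ∀ t, ∀ x ∉ B, G (t, x) = 0 := fun t x hx => by
    simp [G, cutProfile, hΨ.eq_zero x hx]
  have hGt : ∀ t ∉ Icc t₁ t₂, ∀ x, G (t, x) = 0 := fun t ht' x => by
    simp only [G, cutProfile]
    rw [indicator_of_notMem ht', mul_zero]
  have hgd : MemLp (gd s p G) (ENNReal.ofReal p) :=
    memLp_gd_cutProfile hn hs hs1 hp hΓ hB hBfin hΨ hZ.continuous t₁ t₂ hm
      (memLp_gd_tmol hp hκ hUm hslice hU.memLp_gd).2
  have hineq := hu.integral_flux_le hp hΛ hK hκ hB hBfin h1 h2 hU hGm hGC hG0 hGx hGt hgd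
  -- the time derivative term
  have hUI := hU.integrable_time_prod hp hBfin
  have hGdm : Measurable (tmol (deriv κ) G) := measurable_tmol hκd.measurable hGm
  have hI : Integrable (fun q => tmol (deriv κ) G q * U q) (volume.prod (volume.restrict B)) :=
    hUI.bdd_mul hGdm.aestronglyMeasurable (ae_of_all _ (abs_tmol_le hκi hGC))
  have e1 : ∫ t in Ioo τ₁ τ₂, ∫ x in B, tmol (deriv κ) G (t, x) * U (t, x) =
      ∫ x in B, ∫ t, tmol (deriv κ) G (t, x) * U (t, x) := by
    rw [← integral_integral_swap (f := fun t x => tmol (deriv κ) G (t, x) * U (t, x)) hI]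
    refine setIntegral_eq_integral_of_forall_compl_eq_zero fun t ht => ?_
    simp [hU.eq_zero t ht]
  have hsliceI : ∀ᵐ x ∂(volume.restrict B), Integrable fun σ => U (σ, x) := hUI.prod_left_ae
  -- Transposition of the outer mollification followed by the chain rule in time, on almost every
  -- slice in `x`.
  have e2 : ∫ x in B, ∫ t, tmol (deriv κ) G (t, x) * U (t, x) =
      ∫ x in B, -(P (m (t₂, x)) * Ψ x * Z t₂ - P (m (t₁, x)) * Ψ x * Z t₁ -
        ∫ t in t₁..t₂, P (m (t, x)) * Ψ x * deriv Z t) := by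
    apply integral_congr_ae
    filter_upwards [hsliceI] with x hx
    rw [← integral_cutProfile_mul_deriv hκ hΓ Ψ hZ ht hx.locallyIntegrable]
    exact integral_tmol_deriv_mul hκ (by fun_prop : Measurable fun σ => G (σ, x))
      (fun t => hGC (t, x)) (fun t ht => hGt t ht x) hx
  -- integrability of the slices
  obtain ⟨D, hD⟩ := hκ.hasCompactSupport.exists_bound_of_continuous hκ.continuous
  have hA : Integrable (fun x => ∫ σ, |U (σ, x)|) (volume.restrict B) :=
    hUI.abs.integral_prod_right
  have hPm : Continuous P := hΓ.continuous_primitive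
  have hbound : ∀ x, Integrable (fun σ => U (σ, x)) → ∀ t, ∀ c : ℝ,
      |P (m (t, x)) * Ψ x * c| ≤ ((|P 0| + CΓ * (D * ∫ σ, |U (σ, x)|)) * CΨ) * |c| := by
    intro x hx t c
    rw [abs_mul, abs_mul, abs_of_nonneg (hΨ.nonneg x)]
    have hD0 : 0 ≤ D := (norm_nonneg _).trans (hD 0)
    have : 0 ≤ ∫ σ, |U (σ, x)| := integral_nonneg fun _ => abs_nonneg _
    have := hΨ.nonneg x
    gcongr
    · refine (hΓ.abs_primitive_le hCΓ _).trans ?_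
      gcongr
      exact abs_tmol_le_slice hD hx t
    · exact hCΨ x
  have hmaj : ∀ c : ℝ, Integrable (fun x => ((|P 0| + CΓ * (D * ∫ σ, |U (σ, x)|)) * CΨ) * |c|)
      (volume.restrict B) := fun c =>
    (((integrable_const _).add ((hA.const_mul D).const_mul CΓ)).mul_const _).mul_const _
  have hIs : ∀ t, Integrable (fun x => P (m (t, x)) * Ψ x * Z t) (volume.restrict B) := by
    intro t
    refine (hmaj (Z t)).mono' (Measurable.aestronglyMeasurable (by fun_prop)) ?_
    filter_upwards [hsliceI] with x hx using hbound x hx t _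
  obtain ⟨CZ', hCZ'⟩ := isCompact_Icc.exists_bound_of_continuousOn (s := Icc t₁ t₂) hZd.continuousOn
  have hCZ'0 : 0 ≤ CZ' := (norm_nonneg _).trans (hCZ' t₁ ⟨le_rfl, ht⟩)
  have hIt : Integrable (fun x => ∫ t in t₁..t₂, P (m (t, x)) * Ψ x * deriv Z t)
      (volume.restrict B) := by
    refine (((hmaj CZ').mul_const |t₂ - t₁|)).mono' ?_ ?_
    · have : StronglyMeasurable (Function.uncurry fun (x : Rn n) (t : ℝ) =>
          P (m (t, x)) * Ψ x * deriv Z t) := by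
        apply Measurable.stronglyMeasurable
        unfold Function.uncurry
        fun_prop
      simp_rw [intervalIntegral.integral_of_le ht]
      exact (this.integral_prod_right (ν := volume.restrict (Ioc t₁ t₂))).aestronglyMeasurable
    · filter_upwards [hsliceI] with x hx
      refine intervalIntegral.norm_integral_le_of_norm_le_const fun t ht' => ?_
      refine (hbound x hx t _).trans ?_
      rw [uIoc_of_le ht] at ht'
      have hCt := hCZ' t ⟨ht'.1.le, ht'.2⟩
      have hD0 : 0 ≤ D := (norm_nonneg _).trans (hD 0)
      have : 0 ≤ ∫ σ, |U (σ, x)| := integral_nonneg fun _ => abs_nonneg _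
      rw [abs_of_nonneg hCZ'0]
      gcongr
      exact hCt
  have hIsub : Integrable (fun x => P (m (t₂, x)) * Ψ x * Z t₂ - P (m (t₁, x)) * Ψ x * Z t₁)
      (volume.restrict B) := (hIs t₂).sub (hIs t₁)
  rw [e1, e2, integral_neg, integral_sub hIsub hIt,
    integral_sub (hIs t₂) (hIs t₁)] at hineq
  linarith

/-! ### Removing the mollification -/

/-- Dominated convergence with a majorant that is fixed up to a part `A k` vanishing in `L^p`. The
truncation `min |f k| |D|` is dominated in the usual sense, and what exceeds it is at most `|A k|`.
-/
theorem tendsto_eLpNorm_of_le_add {α : Type*} [MeasurableSpace α] {μ : Measure α} (hp : 1 ≤ p)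
    {f A : ℕ → α → ℝ} {D : α → ℝ} (hf : ∀ k, AEStronglyMeasurable (f k) μ)
    (hA : ∀ k, AEStronglyMeasurable (A k) μ) (hD : MemLp D (ENNReal.ofReal p) μ)
    (hle : ∀ k, ∀ᵐ a ∂μ, |f k a| ≤ |A k a| + |D a|)
    (hA0 : Tendsto (fun k => eLpNorm (A k) (ENNReal.ofReal p) μ) atTop (𝓝 0))
    (hf0 : ∀ᵐ a ∂μ, Tendsto (fun k => f k a) atTop (𝓝 0)) :
    Tendsto (fun k => eLpNorm (f k) (ENNReal.ofReal p) μ) atTop (𝓝 0) := by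
  have hp0 : 0 < p := by linarith
  set g : ℕ → α → ℝ := fun k a => min |f k a| |D a|
  have hgm : ∀ k, AEStronglyMeasurable (g k) μ := fun k => by
    have h1 := (hf k).norm
    have h2 := hD.1.norm
    exact h1.inf h2
  have hg : Tendsto (fun k => eLpNorm (g k) (ENNReal.ofReal p) μ) atTop (𝓝 0) := by
    have h1 : Tendsto (fun k => ∫⁻ a, ‖g k a‖ₑ ^ p ∂μ) atTop (𝓝 (∫⁻ _, 0 ∂μ)) := by
      refine tendsto_lintegral_of_dominated_convergence' (fun a => ‖D a‖ₑ ^ p)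
        (fun k => (hgm k).enorm.pow_const p) (fun k => ae_of_all _ fun a => ?_) ?_ ?_
      · refine ENNReal.rpow_le_rpow ?_ hp0.le
        rw [Real.enorm_eq_ofReal_abs, Real.enorm_eq_ofReal_abs]
        apply ENNReal.ofReal_le_ofReal
        rw [abs_of_nonneg (le_min (abs_nonneg _) (abs_nonneg _))]
        exact min_le_right _ _
      · exact ((memLp_iff_lintegral hp0 hD.1).1 hD).ne
      · filter_upwards [hf0] with a ha
        have h2 : Tendsto (fun k => g k a) atTop (𝓝 0) :=
          squeeze_zero (fun k => le_min (abs_nonneg _) (abs_nonneg _)) (fun k => min_le_left _ _)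
            (by simpa using ha.abs)
        have h3 := (h2.enorm).ennrpow_const p
        simpa [hp0] using h3
    rw [lintegral_zero] at h1
    have h2 := h1.ennrpow_const p⁻¹
    simp_rw [← eLpNorm_ofReal_rpow hp0, ← ENNReal.rpow_mul, mul_inv_cancel₀ hp0.ne',
      ENNReal.rpow_one, ENNReal.zero_rpow_of_pos (inv_pos.2 hp0)] at h2
    exact h2
  have hsum := hA0.add hg
  rw [add_zero] at hsum
  refine tendsto_of_tendsto_of_tendsto_of_le_of_le tendsto_const_nhds hsum (fun _ => bot_le)
    fun k => ?_
  calc eLpNorm (f k) (ENNReal.ofReal p) μ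
      ≤ eLpNorm ((fun a => |A k a|) + g k) (ENNReal.ofReal p) μ := by
        refine eLpNorm_mono_ae_real ?_
        filter_upwards [hle k] with a ha
        simp only [Pi.add_apply, g, Real.norm_eq_abs]
        rcases le_total |f k a| |D a| with h | h
        · rw [min_eq_left h]; linarith [abs_nonneg (A k a)]
        · rwa [min_eq_right h]
    _ ≤ eLpNorm (fun a => |A k a|) (ENNReal.ofReal p) μ + eLpNorm (g k) (ENNReal.ofReal p) μ :=
        eLpNorm_add_le (hA k).norm (hgm k) (by simpa using ENNReal.ofReal_le_ofReal hp)
    _ = _ := by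
        congr 1
        exact eLpNorm_norm (A k)

theorem tendsto_integral_mul_of_eLpNorm (hp : 1 < p) {F : ℝ × Rn n × Rn n → ℝ}
    (hF : MemLp F (ENNReal.ofReal (p / (p - 1)))) {f : ℕ → ℝ × Rn n × Rn n → ℝ}
    {g : ℝ × Rn n × Rn n → ℝ} (hf : ∀ k, MemLp (f k) (ENNReal.ofReal p))
    (hg : MemLp g (ENNReal.ofReal p))
    (h : Tendsto (fun k => eLpNorm (fun q => f k q - g q) (ENNReal.ofReal p) volume)
      atTop (𝓝 0)) :
    Tendsto (fun k => ∫ q, F q * f k q) atTop (𝓝 (∫ q, F q * g q)) := by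
  have hp0 : 0 < p := by linarith
  have hp' : 0 < p / (p - 1) := div_pos hp0 (by linarith)
  refine tendsto_integral_of_L1 _ (integrable_mul_gd hp hF hg).1
    (Eventually.of_forall fun k => integrable_mul_gd hp hF (hf k)) ?_
  have h2 : Tendsto (fun k => eLpNorm F (ENNReal.ofReal (p / (p - 1))) volume *
      eLpNorm (fun q => f k q - g q) (ENNReal.ofReal p) volume) atTop (𝓝 0) := by
    have := ENNReal.Tendsto.const_mul (a := eLpNorm F (ENNReal.ofReal (p / (p - 1))) volume) h
      (Or.inr hF.2.ne)
    simpa using this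
  refine tendsto_of_tendsto_of_tendsto_of_le_of_le tendsto_const_nhds h2 (fun _ => bot_le)
    fun k => ?_
  have hH := ENNReal.lintegral_mul_le_Lp_mul_Lq (volume : Measure (ℝ × Rn n × Rn n))
    (Real.HolderConjugate.conjExponent hp).symm hF.1.enorm ((hf k).sub hg).1.enorm
  have e : ∀ {r : ℝ} (hr : 0 < r) (φ : ℝ × Rn n × Rn n → ℝ),
      (∫⁻ q, ‖φ q‖ₑ ^ r) ^ (1 / r) = eLpNorm φ (ENNReal.ofReal r) volume := fun hr φ => by
    rw [← eLpNorm_ofReal_rpow hr, ← ENNReal.rpow_mul, mul_one_div_cancel hr.ne', ENNReal.rpow_one]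
  have hconj : p.conjExponent = p / (p - 1) := rfl
  rw [hconj, e hp', e hp0] at hH
  refine le_trans (le_of_eq ?_) hH
  congr 1; ext q
  simp only [Pi.mul_apply, Pi.sub_apply]
  rw [← mul_sub, enorm_mul]

theorem IsProfile.integrable_mul {α : Type*} [MeasurableSpace α] {μ : Measure α}
    [IsFiniteMeasure μ] {Γ P : ℝ → ℝ} (h : IsProfile Γ P) {f g : α → ℝ} (hf : Integrable f μ)
    (hg : AEStronglyMeasurable g μ) {C : ℝ} (hgC : ∀ᵐ a ∂μ, |g a| ≤ C) :
    Integrable (fun a => P (f a) * g a) μ := by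
  obtain ⟨CΓ, hCΓ⟩ := h.bounded
  have h1 : Integrable (fun a => P (f a)) μ := by
    refine ((integrable_const |P 0|).add (hf.abs.const_mul CΓ)).mono'
      (h.continuous_primitive.comp_aestronglyMeasurable hf.1) (ae_of_all _ fun a => ?_)
    exact h.abs_primitive_le hCΓ _
  exact h1.mul_bdd (c := C) hg hgC

/-- A primitive of a bounded function is Lipschitz, so `L¹` convergence of the arguments suffices;
this is the benefit of the cap on the profile. -/
theorem IsProfile.tendsto_integral {α : Type*} [MeasurableSpace α] {μ : Measure α}
    [IsFiniteMeasure μ] {Γ P : ℝ → ℝ} (h : IsProfile Γ P) {f : ℕ → α → ℝ} {f₀ g : α → ℝ}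
    (hf : ∀ k, Integrable (f k) μ) (hf₀ : AEStronglyMeasurable f₀ μ)
    (hg : AEStronglyMeasurable g μ) {C : ℝ} (hgC : ∀ᵐ a ∂μ, |g a| ≤ C)
    (hlim : Tendsto (fun k => ∫⁻ a, ‖f k a - f₀ a‖ₑ ∂μ) atTop (𝓝 0)) :
    Integrable f₀ μ ∧ Tendsto (fun k => ∫ a, P (f k a) * g a ∂μ) atTop
      (𝓝 (∫ a, P (f₀ a) * g a ∂μ)) := by
  obtain ⟨CΓ, hCΓ⟩ := h.bounded
  have hCΓ0 : 0 ≤ CΓ := (h.nonneg 0).trans (hCΓ 0)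
  have hi₀ : Integrable f₀ μ := by
    obtain ⟨k, hk⟩ := (hlim.eventually (gt_mem_nhds ENNReal.zero_lt_top)).exists
    have h1 : Integrable (fun a => f k a - f₀ a) μ := ⟨(hf k).1.sub hf₀, hk⟩
    exact ((hf k).sub h1).congr (ae_of_all _ fun a => by simp)
  refine ⟨hi₀, tendsto_integral_of_L1 _ (h.integrable_mul hi₀ hg hgC).1
    (Eventually.of_forall fun k => h.integrable_mul (hf k) hg hgC) ?_⟩
  have h2 : Tendsto (fun k => ENNReal.ofReal (CΓ * C) * ∫⁻ a, ‖f k a - f₀ a‖ₑ ∂μ) atTop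
      (𝓝 0) := by
    have := ENNReal.Tendsto.const_mul (a := ENNReal.ofReal (CΓ * C)) hlim
      (Or.inr ENNReal.ofReal_ne_top)
    simpa using this
  refine tendsto_of_tendsto_of_tendsto_of_le_of_le tendsto_const_nhds h2 (fun _ => bot_le)
    fun k => ?_
  rw [← lintegral_const_mul' _ _ ENNReal.ofReal_ne_top]
  refine lintegral_mono_ae ?_
  filter_upwards [hgC] with a ha
  have hC0 : 0 ≤ C := (abs_nonneg _).trans ha
  rw [Real.enorm_eq_ofReal_abs, Real.enorm_eq_ofReal_abs, ← ENNReal.ofReal_mul (by positivity)]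
  apply ENNReal.ofReal_le_ofReal
  rw [← sub_mul, abs_mul]
  calc _ ≤ (CΓ * |f k a - f₀ a|) * C := by
        gcongr
        exact h.abs_sub_le hCΓ _ _
    _ = _ := by ring

theorem IsRep.integrable_tmol_slice (hp : 1 < p) {τ₁ τ₂ : ℝ} {u : Rn n → ℝ → ℝ}
    {U : ℝ × Rn n → ℝ} (hU : IsRep s p τ₁ τ₂ u U) {B : Set (Rn n)} (hBfin : volume B ≠ ⊤)
    {κ : ℝ → ℝ} {h : ℝ} (hκ : IsTimeKernel h κ) (t : ℝ) :
    Integrable (fun x => tmol κ U (t, x)) (volume.restrict B) := by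
  have hUI := hU.integrable_time_prod hp hBfin
  have hUm := hU.measurable
  have hm : Measurable (tmol κ U) := measurable_tmol hκ.continuous.measurable hUm
  obtain ⟨D, hD⟩ := hκ.hasCompactSupport.exists_bound_of_continuous hκ.continuous
  refine (hUI.abs.integral_prod_right.const_mul D).mono'
    (by fun_prop : Measurable fun x => tmol κ U (t, x)).aestronglyMeasurable ?_
  filter_upwards [hUI.prod_left_ae] with x hx
  exact abs_tmol_le_slice hD hx t

theorem isAddHaarMeasure_volume_prod :
    (volume : Measure (Rn n × Rn n)).IsAddHaarMeasure :=
  inferInstanceAs ((volume : Measure (Rn n)).prod (volume : Measure (Rn n))).IsAddHaarMeasure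

theorem tendsto_gd_cutProfile {Γ P : ℝ → ℝ} (hΓ : IsProfile Γ P) {Ψ : Rn n → ℝ}
    {Z : ℝ → ℝ} {t₁ t₂ : ℝ} {m : ℕ → ℝ × Rn n → ℝ} {U : ℝ × Rn n → ℝ}
    (h : ∀ᵐ q, Tendsto (fun k => m k q) atTop (𝓝 (U q))) :
    ∀ᵐ q, Tendsto (fun k => gd s p (cutProfile Γ Ψ Z t₁ t₂ (m k)) q) atTop
      (𝓝 (gd s p (cutProfile Γ Ψ Z t₁ t₂ U) q)) := by
  have hid : Measure.QuasiMeasurePreserving (id : ℝ → ℝ) :=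
    (MeasurePreserving.id volume).quasiMeasurePreserving
  have h1 : ∀ᵐ q : ℝ × Rn n × Rn n,
      Tendsto (fun k => m k (q.1, q.2.1)) atTop (𝓝 (U (q.1, q.2.1))) :=
    (MeasureTheory.QuasiMeasurePreserving.prodMap hid Measure.quasiMeasurePreserving_fst).ae h
  have h2 : ∀ᵐ q : ℝ × Rn n × Rn n,
      Tendsto (fun k => m k (q.1, q.2.2)) atTop (𝓝 (U (q.1, q.2.2))) :=
    (MeasureTheory.QuasiMeasurePreserving.prodMap hid Measure.quasiMeasurePreserving_snd).ae h
  filter_upwards [h1, h2] with q hx hy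
  have c := hΓ.continuous
  unfold gd cutProfile
  exact ((((c.tendsto _).comp hx).mul_const _).mul_const _ |>.sub
    ((((c.tendsto _).comp hy).mul_const _).mul_const _)).mul_const _

/-- The subsolution inequality tested with `Γ(u) Ψ ζ` on `[t₁, t₂]`, for instants at which the
time mollifications converge in `L¹`. -/
theorem IsSubsolution.profile_le (hn : 1 ≤ n) (hs : 0 < s) (hs1 : s < 1) (hp : 1 < p)
    {Λ : ℝ} (hΛ : 1 ≤ Λ) {K : Rn n → Rn n → ℝ → ℝ} (hK : IsEllipticKernel s p Λ K)
    {κ : ℕ → ℝ → ℝ} {h : ℕ → ℝ} (hκ : ∀ k, IsTimeKernel (h k) (κ k))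
    (hh : Tendsto h atTop (𝓝 0)) {B : Set (Rn n)} (hB : MeasurableSet B)
    (hBfin : volume B ≠ ⊤) {τ₁ τ₂ t₁ t₂ : ℝ} (h1 : τ₁ < t₁) (h2 : t₂ < τ₂) (ht : t₁ ≤ t₂)
    {u : Rn n → ℝ → ℝ} {U : ℝ × Rn n → ℝ} (hU : IsRep s p τ₁ τ₂ u U)
    (hu : IsSubsolution s p K B τ₁ τ₂ u) {U₁ U₂ : Rn n → ℝ}
    (hU₁m : AEStronglyMeasurable U₁ (volume.restrict B))
    (hU₂m : AEStronglyMeasurable U₂ (volume.restrict B))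
    (hU₁ : Tendsto (fun k => ∫⁻ x in B, ‖tmol (κ k) U (t₁, x) - U₁ x‖ₑ) atTop (𝓝 0))
    (hU₂ : Tendsto (fun k => ∫⁻ x in B, ‖tmol (κ k) U (t₂, x) - U₂ x‖ₑ) atTop (𝓝 0))
    {Γ P : ℝ → ℝ} (hΓ : IsProfile Γ P) {Ψ : Rn n → ℝ}
    (hΨ : IsCutoff B Ψ) {Z : ℝ → ℝ} (hZ : ContDiff ℝ 1 Z) (hZ0 : ∀ t, 0 ≤ Z t) :
    (∫ q, flux s p K U q * gd s p (cutProfile Γ Ψ Z t₁ t₂ U) q) +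
        ∫ x in B, P (U₂ x) * (Ψ x * Z t₂) ≤
      (∫ x in B, P (U₁ x) * (Ψ x * Z t₁)) +
        ∫ q, P (U q) * (Ψ q.2 * deriv Z q.1)
          ∂((volume.restrict (Ioc t₁ t₂)).prod (volume.restrict B)) := by
  have : IsFiniteMeasure (volume.restrict B) := ⟨by simpa using hBfin.lt_top⟩
  have := isAddHaarMeasure_volume_prod (n := n)
  have hp1 : 1 ≤ ENNReal.ofReal p := by simpa using ENNReal.ofReal_le_ofReal hp.le
  have hUm := hU.measurable
  have hΨm := hΨ.measurable
  have hZd : Continuous (deriv Z) := hZ.continuous_deriv le_rfl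
  have hm : ∀ k, Measurable (tmol (κ k) U) := fun k =>
    measurable_tmol (hκ k).continuous.measurable hUm
  have hslice := ae_integrable_slice hp.le hUm hU.memLp
  have hconv := tendsto_eLpNorm_tmol_sub hp.le hUm hU.memLp hκ hh
  -- a subsequence converges almost everywhere
  obtain ⟨ns, hns, hae⟩ := (tendstoInMeasure_of_tendsto_eLpNorm
    (by simp; linarith : ENNReal.ofReal p ≠ 0) (fun k => (hm k).aestronglyMeasurable)
    hUm.aestronglyMeasurable hconv).exists_seq_tendsto_ae
  have hns' := hns.tendsto_atTop
  set μT : Measure (ℝ × Rn n) := (volume.restrict (Ioc t₁ t₂)).prod (volume.restrict B)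
  have hμT : μT ≤ volume := by
    rw [Measure.volume_eq_prod]
    exact Measure.prod_mono Measure.restrict_le_self Measure.restrict_le_self
  have hmp : ∀ k, MemLp (tmol (κ k) U) (ENNReal.ofReal p) := fun k =>
    ⟨(hm k).aestronglyMeasurable, (eLpNorm_tmol_le (hκ k) hp.le hUm).trans_lt hU.memLp.2⟩
  -- convergence of the flux term
  have hgdm : ∀ k, MemLp (gd s p (tmol (κ k) U)) (ENNReal.ofReal p) := fun k =>
    (memLp_gd_tmol hp (hκ k) hUm hslice hU.memLp_gd).2
  have hG : ∀ k, MemLp (gd s p (cutProfile Γ Ψ Z t₁ t₂ (tmol (κ k) U))) (ENNReal.ofReal p) :=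
    fun k => memLp_gd_cutProfile hn hs hs1 hp hΓ hB hBfin hΨ hZ.continuous t₁ t₂ (hm k) (hgdm k)
  have hG₀ : MemLp (gd s p (cutProfile Γ Ψ Z t₁ t₂ U)) (ENNReal.ofReal p) :=
    memLp_gd_cutProfile hn hs hs1 hp hΓ hB hBfin hΨ hZ.continuous t₁ t₂ hUm hU.memLp_gd
  have hGm : ∀ k, Measurable (cutProfile Γ Ψ Z t₁ t₂ (tmol (κ k) U)) := fun k =>
    measurable_cutProfile hΓ hΨ hZ.continuous (hm k)
  have hG₀m : Measurable (cutProfile Γ Ψ Z t₁ t₂ U) :=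
    measurable_cutProfile hΓ hΨ hZ.continuous hUm
  have hgdconv : Tendsto (fun k => eLpNorm (fun q => gd s p (tmol (κ k) U) q - gd s p U q)
      (ENNReal.ofReal p) volume) atTop (𝓝 0) := by
    refine (tendsto_eLpNorm_tmol_sub hp.le (measurable_gd hUm) hU.memLp_gd hκ hh).congr
      fun k => ?_
    apply eLpNorm_congr_ae
    filter_upwards [(memLp_gd_tmol hp (hκ k) hUm hslice hU.memLp_gd).1] with q hq
    rw [hq]
  obtain ⟨C₁, C₂, hC⟩ := abs_gd_cutProfile_le (s := s) (p := p) hΓ hΨ hZ.continuous t₁ t₂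
  have hcΨ := hΨ.memLp_time_mul hn hs hs1 hp hB hBfin
    (hZ.continuous.measurable.indicator measurableSet_Icc)
    (memLp_indicator_Icc hZ.continuous t₁ t₂ (ENNReal.ofReal p))
  have hGconv : Tendsto (fun k => eLpNorm (fun q =>
      gd s p (cutProfile Γ Ψ Z t₁ t₂ (tmol (κ (ns k)) U)) q -
        gd s p (cutProfile Γ Ψ Z t₁ t₂ U) q) (ENNReal.ofReal p) volume) atTop (𝓝 0) := by
    -- The difference is at most `C₁(|a| + |b|) + 2 C₂ |c|`, with `a`, `b` the weighted differences
    -- of `u_h` and `u`, and `c` that of the cut-off. Writing `|a| ≤ |a - b| + |b|` leaves a part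
    -- tending to zero in `L^p` and a fixed majorant with factors `2`.
    refine tendsto_eLpNorm_of_le_add hp.le
      (A := fun k q => C₁ * (gd s p (tmol (κ (ns k)) U) q - gd s p U q))
      (D := fun q => 2 * |C₁| * |gd s p U q| +
        2 * |C₂| * |(Icc t₁ t₂).indicator Z q.1 * cutoffDiff s p Ψ q.2|)
      (fun k => (hG _).1.sub hG₀.1) (fun k => ((hgdm _).sub hU.memLp_gd).1.const_mul _)
      ((hU.memLp_gd.abs.const_mul _).add (hcΨ.abs.const_mul _))
      (fun k => ae_of_all _ fun q => ?_) ?_ ?_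
    · have a1 := hC (tmol (κ (ns k)) U) q
      have a2 := hC U q
      set a := gd s p (tmol (κ (ns k)) U) q
      set b := gd s p U q
      set c := (Icc t₁ t₂).indicator Z q.1 * cutoffDiff s p Ψ q.2
      have a3 : C₁ * |a| ≤ |C₁| * |a - b| + |C₁| * |b| := by
        rw [← mul_add]
        have : |a| ≤ |a - b| + |b| := by simpa using abs_add_le (a - b) b
        exact mul_le_mul (le_abs_self _) this (abs_nonneg _) (abs_nonneg _)
      have a4 : C₁ * |b| ≤ |C₁| * |b| := mul_le_mul_of_nonneg_right (le_abs_self _) (abs_nonneg _)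
      have a5 : C₂ * |c| ≤ |C₂| * |c| := mul_le_mul_of_nonneg_right (le_abs_self _) (abs_nonneg _)
      have a6 := abs_sub (gd s p (cutProfile Γ Ψ Z t₁ t₂ (tmol (κ (ns k)) U)) q)
        (gd s p (cutProfile Γ Ψ Z t₁ t₂ U) q)
      rw [abs_mul, abs_of_nonneg (by positivity : 0 ≤ 2 * |C₁| * |b| + 2 * |C₂| * |c|)]
      linarith
    · have := ENNReal.Tendsto.const_mul (a := ‖C₁‖ₑ) (hgdconv.comp hns') (Or.inr enorm_ne_top)
      rw [mul_zero] at this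
      refine this.congr fun k => ?_
      exact (eLpNorm_const_smul C₁ _ _ _).symm
    · filter_upwards [tendsto_gd_cutProfile (s := s) (p := p) hΓ (Ψ := Ψ) (Z := Z) (t₁ := t₁) (t₂ := t₂)
        hae] with q hq
      simpa using hq.sub_const (gd s p (cutProfile Γ Ψ Z t₁ t₂ U) q)
  have hGslice : ∀ k, ∀ᵐ z, LocallyIntegrable fun σ =>
      gd s p (cutProfile Γ Ψ Z t₁ t₂ (tmol (κ k) U)) (σ, z) := fun k =>
    ae_integrable_slice hp.le (measurable_gd (hGm k)) (hG k)
  have hG₀slice : ∀ᵐ z, LocallyIntegrable fun σ =>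
      gd s p (cutProfile Γ Ψ Z t₁ t₂ U) (σ, z) :=
    ae_integrable_slice hp.le (measurable_gd hG₀m) hG₀
  have hGxslice : ∀ k, ∀ᵐ x, LocallyIntegrable fun σ =>
      cutProfile Γ Ψ Z t₁ t₂ (tmol (κ k) U) (σ, x) := by
    intro k
    obtain ⟨CΓ, hCΓ⟩ := hΓ.bounded
    obtain ⟨CZ, hCZ0, hCZ⟩ := exists_bound_indicator hZ.continuous t₁ t₂
    have hCΓ0 : 0 ≤ CΓ := (hΓ.nonneg 0).trans (hCΓ 0)
    refine ae_of_all _ fun x => locallyIntegrable_of_bounded (C := CΓ * Ψ x * CZ)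
      (by have := hGm k; fun_prop) fun σ => ?_
    unfold cutProfile
    rw [abs_mul, abs_mul, abs_of_nonneg (hΓ.nonneg _), abs_of_nonneg (hΨ.nonneg _)]
    have := hΨ.nonneg x
    gcongr
    exacts [hCΓ _, hCZ _]
  have hTG : ∀ k, gd s p (tmol (κ k) (cutProfile Γ Ψ Z t₁ t₂ (tmol (κ k) U))) =ᵐ[volume]
      tmol (κ k) (gd s p (cutProfile Γ Ψ Z t₁ t₂ (tmol (κ k) U))) := fun k =>
    (memLp_gd_tmol hp (hκ k) (hGm k) (hGxslice k) (hG k)).1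
  have hTGp : ∀ k, MemLp (gd s p (tmol (κ k) (cutProfile Γ Ψ Z t₁ t₂ (tmol (κ k) U))))
      (ENNReal.ofReal p) := fun k =>
    (memLp_gd_tmol hp (hκ k) (hGm k) (hGxslice k) (hG k)).2
  have hflux : Tendsto (fun k => ∫ q, flux s p K U q *
      gd s p (tmol (κ (ns k)) (cutProfile Γ Ψ Z t₁ t₂ (tmol (κ (ns k)) U))) q) atTop
      (𝓝 (∫ q, flux s p K U q * gd s p (cutProfile Γ Ψ Z t₁ t₂ U) q)) := by
    refine tendsto_integral_mul_of_eLpNorm hp (memLp_flux hp hΛ hK hUm hU.memLp_gd)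
      (fun k => hTGp (ns k)) hG₀ ?_
    -- The test function is mollified twice. With `g`, `g₀` the weighted differences built from
    -- `u_h` and `u`, the error is `κ * (g - g₀)` plus `κ * g₀ - g₀`: the contraction property
    -- handles the first, convergence for a fixed function the second.
    have h3 := hGconv.add ((tendsto_eLpNorm_tmol_sub hp.le (measurable_gd hG₀m) hG₀ hκ hh).comp
      hns')
    rw [add_zero] at h3
    refine tendsto_of_tendsto_of_tendsto_of_le_of_le tendsto_const_nhds h3 (fun _ => bot_le)
      fun k => ?_
    set κk := κ (ns k)
    set g := gd s p (cutProfile Γ Ψ Z t₁ t₂ (tmol κk U))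
    set g₀ := gd s p (cutProfile Γ Ψ Z t₁ t₂ U)
    have hgm : Measurable g := measurable_gd (hGm _)
    have hg₀m : Measurable g₀ := measurable_gd hG₀m
    have hκc := (hκ (ns k)).continuous
    have hκs := (hκ (ns k)).hasCompactSupport
    calc eLpNorm (fun q => gd s p (tmol κk (cutProfile Γ Ψ Z t₁ t₂ (tmol κk U))) q - g₀ q)
          (ENNReal.ofReal p) volume
        = eLpNorm (tmol κk (fun q => g q - g₀ q) + fun q => tmol κk g₀ q - g₀ q)
          (ENNReal.ofReal p) volume := by
          apply eLpNorm_congr_ae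
          have a1 : ∀ᵐ q : ℝ × Rn n × Rn n, LocallyIntegrable fun σ => g (σ, q.2) :=
            Measure.quasiMeasurePreserving_snd.ae (hGslice (ns k))
          have a2 : ∀ᵐ q : ℝ × Rn n × Rn n, LocallyIntegrable fun σ => g₀ (σ, q.2) :=
            Measure.quasiMeasurePreserving_snd.ae hG₀slice
          filter_upwards [hTG (ns k), a1, a2] with q hq h1 h2
          rw [hq, Pi.add_apply]
          have : tmol κk (fun q => g q - g₀ q) q = tmol κk g q - tmol κk g₀ q := by
            unfold tmol
            rw [← integral_sub (h1.integrable_mul_kernel hκc hκs _)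
              (h2.integrable_mul_kernel hκc hκs _)]
            congr 1; ext σ; ring
          rw [this]; ring
      _ ≤ eLpNorm (tmol κk (fun q => g q - g₀ q)) (ENNReal.ofReal p) volume +
          eLpNorm (fun q => tmol κk g₀ q - g₀ q) (ENNReal.ofReal p) volume :=
          eLpNorm_add_le (measurable_tmol hκc.measurable (hgm.sub hg₀m)).aestronglyMeasurable
            ((measurable_tmol hκc.measurable hg₀m).sub hg₀m).aestronglyMeasurable hp1
      _ ≤ _ := by
          refine add_le_add ?_ le_rfl
          exact eLpNorm_tmol_le (hκ (ns k)) hp.le (hgm.sub hg₀m)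
  -- convergence of the slices
  obtain ⟨CΨ, hCΨ⟩ := hΨ.bounded
  have hCΨ0 : 0 ≤ CΨ := (hΨ.nonneg 0).trans (hCΨ 0)
  have hΨb : ∀ x c, |Ψ x * c| ≤ CΨ * |c| := fun x c => by
    rw [abs_mul, abs_of_nonneg (hΨ.nonneg x)]
    gcongr
    exact hCΨ x
  have hl1 := (hΓ.tendsto_integral (μ := volume.restrict B) (g := fun x => Ψ x * Z t₁)
    (fun k => hU.integrable_tmol_slice hp hBfin (hκ (ns k)) t₁) hU₁m
    (by fun_prop) (ae_of_all _ fun x => hΨb x _) (hU₁.comp hns')).2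
  have hl2 := (hΓ.tendsto_integral (μ := volume.restrict B) (g := fun x => Ψ x * Z t₂)
    (fun k => hU.integrable_tmol_slice hp hBfin (hκ (ns k)) t₂) hU₂m
    (by fun_prop) (ae_of_all _ fun x => hΨb x _) (hU₂.comp hns')).2
  -- convergence of the term with the time derivative
  obtain ⟨CZ', hCZ'⟩ := isCompact_Icc.exists_bound_of_continuousOn (s := Icc t₁ t₂) hZd.continuousOn
  have hgT : ∀ᵐ q ∂μT, |Ψ q.2 * deriv Z q.1| ≤ CΨ * CZ' := by
    have : ∀ᵐ q ∂μT, q.1 ∈ Ioc t₁ t₂ :=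
      Measure.quasiMeasurePreserving_fst.ae (ae_restrict_mem measurableSet_Ioc)
    filter_upwards [this] with q hq
    refine (hΨb _ _).trans ?_
    gcongr
    exact hCZ' _ ⟨hq.1.le, hq.2⟩
  have hmT : ∀ k, Integrable (tmol (κ k) U) μT := fun k =>
    ((hmp k).mono_measure hμT).integrable hp1
  have hl3 := (hΓ.tendsto_integral (μ := μT) (g := fun q => Ψ q.2 * deriv Z q.1)
    (fun k => hmT (ns k)) hUm.aestronglyMeasurable
    (Measurable.aestronglyMeasurable (by fun_prop)) hgT (by
      have a1 : ∀ k, ∫⁻ q, ‖tmol (κ k) U q - U q‖ₑ ∂μT ≤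
          eLpNorm (fun q => tmol (κ k) U q - U q) (ENNReal.ofReal p) volume *
            μT univ ^ (1 - 1 / p) := by
        intro k
        have := eLpNorm_le_eLpNorm_mul_rpow_measure_univ (μ := μT) hp1
          ((hm k).sub hUm).aestronglyMeasurable
        rw [eLpNorm_one_eq_lintegral_enorm, ENNReal.toReal_ofReal (by linarith)] at this
        simp only [ENNReal.toReal_one, div_one] at this
        refine this.trans ?_
        gcongr
        exact eLpNorm_mono_measure _ hμT
      have a2 := ENNReal.Tendsto.mul_const (b := μT univ ^ (1 - 1 / p)) (hconv.comp hns')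
        (Or.inr (ENNReal.rpow_ne_top_of_nonneg (by
          rw [sub_nonneg, div_le_one (by linarith)]; exact hp.le) (measure_ne_top _ _)))
      rw [zero_mul] at a2
      exact tendsto_of_tendsto_of_tendsto_of_le_of_le tendsto_const_nhds a2 (fun _ => bot_le)
        fun k => a1 (ns k))).2
  refine le_of_tendsto_of_tendsto (hflux.add hl2) (hl1.add hl3) ?_
  have hev1 : ∀ᶠ k in atTop, h (ns k) < t₁ - τ₁ :=
    (hh.comp hns').eventually (gt_mem_nhds (by linarith))
  have hev2 : ∀ᶠ k in atTop, h (ns k) < τ₂ - t₂ :=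
    (hh.comp hns').eventually (gt_mem_nhds (by linarith))
  filter_upwards [hev1, hev2] with k hk1 hk2
  have hfin := hu.mollified_le hn hs hs1 hp hΛ hK (hκ (ns k)) hB hBfin (by linarith) (by linarith)
    ht hU hΓ hΨ hZ hZ0
  have e3 : ∫ q, P (tmol (κ (ns k)) U q) * (Ψ q.2 * deriv Z q.1) ∂μT =
      ∫ x in B, ∫ t in t₁..t₂, P (tmol (κ (ns k)) U (t, x)) * Ψ x * deriv Z t := by
    rw [integral_prod_symm _ (hΓ.integrable_mul (hmT (ns k))
      (Measurable.aestronglyMeasurable (by fun_prop)) hgT)]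
    simp_rw [intervalIntegral.integral_of_le ht, mul_assoc]
  rw [e3]
  simpa only [mul_assoc] using hfin

/-! ### Truncated power profiles -/

/-- `Γ(τ) = (τ₊ + d) min(τ₊ + d, M)^(ξ-1)`. -/
noncomputable def powProfile (ξ d M τ : ℝ) : ℝ := truncMul (ξ - 1) M (max τ 0 + d)

/-- `powProfile` frozen beyond `τ = N`. -/
noncomputable def cappedProfile (ξ d M N τ : ℝ) : ℝ := powProfile ξ d M (min τ N)

/-- The primitive of `cappedProfile` with value `d^(1+ξ)/(1+ξ)` at zero. -/
noncomputable def cappedPrimitive (ξ d M N τ : ℝ) : ℝ :=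
  d ^ (1 + ξ) / (1 + ξ) + ∫ σ in (0 : ℝ)..τ, cappedProfile ξ d M N σ

theorem abs_truncMul_sub_le {q M a b : ℝ} (hq : 0 ≤ q) (hM : 0 < M) (ha : 0 < a) (hb : 0 < b) :
    |truncMul q M a - truncMul q M b| ≤ (1 + q) * M ^ q * |a - b| := by
  have key : ∀ {a b : ℝ}, 0 < b → b ≤ a →
      |truncMul q M a - truncMul q M b| ≤ (1 + q) * M ^ q * |a - b| := by
    intro a b hb hab
    rw [abs_of_nonneg (sub_nonneg.2 (truncMul_mono hq hM hb hab)),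
      abs_of_nonneg (sub_nonneg.2 hab)]
    refine (truncMul_sub_le hq hM hb hab).trans ?_
    have : min a M ^ q ≤ M ^ q :=
      Real.rpow_le_rpow (le_min (hb.le.trans hab) hM.le) (min_le_right _ _) hq
    have : 0 ≤ a - b := sub_nonneg.2 hab
    gcongr
  rcases le_total b a with h | h
  · exact key hb h
  · rw [abs_sub_comm, abs_sub_comm a b]; exact key ha h

section

variable {ξ d M N : ℝ}

theorem powProfile_nonneg (hd : 0 < d) (hM : 0 < M) (τ : ℝ) : 0 ≤ powProfile ξ d M τ :=
  truncMul_nonneg hM.le (by positivity)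

theorem abs_powProfile_sub_le (hξ : 1 ≤ ξ) (hd : 0 < d) (hM : 0 < M) (a b : ℝ) :
    |powProfile ξ d M a - powProfile ξ d M b| ≤ ξ * M ^ (ξ - 1) * |a - b| := by
  refine (abs_truncMul_sub_le (by linarith) hM (by positivity) (by positivity)).trans ?_
  have h1 : |max a 0 + d - (max b 0 + d)| ≤ |a - b| := by
    rw [add_sub_add_right_eq_sub]
    exact abs_max_sub_max_le_abs a b 0
  have : 0 ≤ M ^ (ξ - 1) := Real.rpow_nonneg hM.le _
  rw [show 1 + (ξ - 1) = ξ by ring]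
  gcongr

theorem powProfile_le (hξ : 1 ≤ ξ) (hd : 0 < d) (hM : 0 < M) (τ : ℝ) :
    powProfile ξ d M τ ≤ M ^ (ξ - 1) * (|τ| + d) := by
  have h0 : 0 ≤ min (max τ 0 + d) M := le_min (by positivity) hM.le
  unfold powProfile truncMul
  rw [mul_comm]
  have h1 : min (max τ 0 + d) M ^ (ξ - 1) ≤ M ^ (ξ - 1) :=
    Real.rpow_le_rpow h0 (min_le_right _ _) (by linarith)
  have h2 : max τ 0 ≤ |τ| := max_le (le_abs_self _) (abs_nonneg _)
  have : 0 ≤ M ^ (ξ - 1) := Real.rpow_nonneg hM.le _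
  gcongr

theorem powProfile_mono (hξ : 1 ≤ ξ) (hd : 0 < d) (hM : 0 < M) {a b : ℝ} (h : a ≤ b) :
    powProfile ξ d M a ≤ powProfile ξ d M b :=
  truncMul_mono (by linarith) hM (by positivity) (by gcongr)

theorem powProfile_le_rpow (hξ : 1 ≤ ξ) (hd : 0 < d) (hM : 0 < M) {τ : ℝ} (hτ : 0 ≤ τ) :
    powProfile ξ d M τ ≤ (τ + d) ^ ξ := by
  have hpos : 0 < τ + d := by positivity
  unfold powProfile truncMul
  rw [max_eq_left hτ]
  calc (τ + d) * min (τ + d) M ^ (ξ - 1) ≤ (τ + d) * (τ + d) ^ (ξ - 1) := by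
        have : min (τ + d) M ^ (ξ - 1) ≤ (τ + d) ^ (ξ - 1) :=
          Real.rpow_le_rpow (le_min hpos.le hM.le) (min_le_left _ _) (by linarith)
        gcongr
    _ = (τ + d) ^ ξ := by
        rw [mul_comm, ← Real.rpow_add_one hpos.ne']; congr 1; ring

theorem powProfile_eq_rpow (hd : 0 < d) {τ : ℝ} (hτ : 0 ≤ τ) (hτM : τ + d ≤ M) :
    powProfile ξ d M τ = (τ + d) ^ ξ := by
  have hpos : 0 < τ + d := by positivity
  unfold powProfile truncMul
  rw [max_eq_left hτ, min_eq_left hτM, mul_comm, ← Real.rpow_add_one hpos.ne']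
  congr 1; ring

theorem abs_cappedProfile_sub_le (hξ : 1 ≤ ξ) (hd : 0 < d) (hM : 0 < M) (a b : ℝ) :
    |cappedProfile ξ d M N a - cappedProfile ξ d M N b| ≤ ξ * M ^ (ξ - 1) * |a - b| := by
  refine (abs_powProfile_sub_le hξ hd hM _ _).trans ?_
  have : 0 ≤ M ^ (ξ - 1) := Real.rpow_nonneg hM.le _
  have h : |min a N - min b N| ≤ |a - b| := by simpa using abs_min_sub_min_le_max a N b N
  gcongr

theorem cappedProfile_le (hξ : 1 ≤ ξ) (hd : 0 < d) (hM : 0 < M) (τ : ℝ) :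
    cappedProfile ξ d M N τ ≤ powProfile ξ d M τ :=
  powProfile_mono hξ hd hM (min_le_left _ _)

theorem continuous_cappedProfile (hξ : 1 ≤ ξ) (hd : 0 < d) (hM : 0 < M) :
    Continuous (cappedProfile ξ d M N) :=
  (LipschitzWith.of_dist_le' (K := ξ * M ^ (ξ - 1)) fun a b => by
    simpa [Real.dist_eq] using abs_cappedProfile_sub_le hξ hd hM a b).continuous

theorem isProfile_capped (hξ : 1 ≤ ξ) (hd : 0 < d) (hM : 0 < M) :
    IsProfile (cappedProfile ξ d M N) (cappedPrimitive ξ d M N) where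
  nonneg a := powProfile_nonneg hd hM _
  bounded := ⟨powProfile ξ d M N, fun a => powProfile_mono hξ hd hM (min_le_right _ _)⟩
  lipschitz := ⟨_, abs_cappedProfile_sub_le hξ hd hM⟩
  hasDerivAt a := by
    have hc := continuous_cappedProfile (N := N) hξ hd hM
    exact (intervalIntegral.integral_hasDerivAt_right (hc.intervalIntegrable _ _)
      (hc.stronglyMeasurableAtFilter _ _) hc.continuousAt).const_add _

theorem integral_add_rpow (hξ : 1 ≤ ξ) (d τ : ℝ) :
    ∫ σ in (0 : ℝ)..τ, (σ + d) ^ ξ = (τ + d) ^ (1 + ξ) / (1 + ξ) - d ^ (1 + ξ) / (1 + ξ) := by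
  rw [intervalIntegral.integral_comp_add_right (fun σ => σ ^ ξ) d,
    integral_rpow (Or.inl (by linarith)), zero_add, add_comm ξ 1, sub_div]

theorem intervalIntegrable_add_rpow (hξ : 1 ≤ ξ) (d a b : ℝ) :
    IntervalIntegrable (fun σ : ℝ => (σ + d) ^ ξ) volume a b :=
  (Continuous.rpow_const (by fun_prop) fun _ => Or.inr (by linarith)).intervalIntegrable _ _

/-- The additive constant in the primitive is chosen for this comparison: it makes the untruncated
primitive equal to `(τ + d)^(1+ξ)/(1+ξ)` with no remainder. -/
theorem cappedPrimitive_le (hξ : 1 ≤ ξ) (hd : 0 < d) (hM : 0 < M) {τ : ℝ} (hτ : 0 ≤ τ) :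
    cappedPrimitive ξ d M N τ ≤ (τ + d) ^ (1 + ξ) / (1 + ξ) := by
  have h := intervalIntegral.integral_mono_on hτ
    ((continuous_cappedProfile (N := N) hξ hd hM).intervalIntegrable _ _)
    (intervalIntegrable_add_rpow hξ d 0 τ) fun σ hσ =>
      (cappedProfile_le hξ hd hM σ).trans (powProfile_le_rpow hξ hd hM hσ.1)
  rw [integral_add_rpow hξ] at h
  unfold cappedPrimitive
  linarith

theorem cappedPrimitive_mono (hξ : 1 ≤ ξ) (hd : 0 < d) (hM : 0 < M) {N' : ℝ} (hN : N ≤ N')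
    {τ : ℝ} (hτ : 0 ≤ τ) : cappedPrimitive ξ d M N τ ≤ cappedPrimitive ξ d M N' τ := by
  unfold cappedPrimitive
  gcongr
  exact intervalIntegral.integral_mono_on hτ
    ((continuous_cappedProfile hξ hd hM).intervalIntegrable _ _)
    ((continuous_cappedProfile hξ hd hM).intervalIntegrable _ _) fun σ _ =>
      powProfile_mono hξ hd hM (min_le_min_left σ hN)

theorem cappedPrimitive_nonneg (hξ : 1 ≤ ξ) (hd : 0 < d) (hM : 0 < M) {τ : ℝ} (hτ : 0 ≤ τ) :
    0 ≤ cappedPrimitive ξ d M N τ := by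
  have h := intervalIntegral.integral_nonneg (f := cappedProfile ξ d M N) (μ := volume) hτ
    fun σ _ => powProfile_nonneg hd hM _
  have : 0 ≤ d ^ (1 + ξ) / (1 + ξ) := by positivity
  unfold cappedPrimitive
  linarith

theorem cappedPrimitive_eq (hξ : 1 ≤ ξ) (hd : 0 < d) {τ : ℝ} (hτ : 0 ≤ τ) (hN : τ ≤ N)
    (hτM : τ + d ≤ M) : cappedPrimitive ξ d M N τ = (τ + d) ^ (1 + ξ) / (1 + ξ) := by
  have h : ∫ σ in (0 : ℝ)..τ, cappedProfile ξ d M N σ = ∫ σ in (0 : ℝ)..τ, (σ + d) ^ ξ := by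
    apply intervalIntegral.integral_congr
    intro σ hσ
    rw [uIcc_of_le hτ] at hσ
    unfold cappedProfile
    rw [min_eq_left (hσ.2.trans hN)]
    exact powProfile_eq_rpow hd hσ.1 (by linarith [hσ.2])
  unfold cappedPrimitive
  rw [h, integral_add_rpow hξ]
  ring

end

/-! ### Removing the cap -/

/-- The majorant depends on `Γ` only through its Lipschitz constant and linear growth, so it is
common to the capped profiles for all `N` and to the uncapped one. The linear growth costs the
product of `U` with the cut-off difference, which is in `L^p` by `IsCutoff.memLp_mul`. -/
theorem exists_dominating (hn : 1 ≤ n) (hs : 0 < s) (hs1 : s < 1) (hp : 1 < p)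
    {B : Set (Rn n)} (hB : MeasurableSet B) (hBfin : volume B ≠ ⊤) {Ψ : Rn n → ℝ}
    (hΨ : IsCutoff B Ψ) {Z : ℝ → ℝ} (hZ : Continuous Z) (t₁ t₂ : ℝ) {U : ℝ × Rn n → ℝ}
    (hUm : Measurable U) (hU : MemLp U (ENNReal.ofReal p))
    (hgd : MemLp (gd s p U) (ENNReal.ofReal p)) {L A d : ℝ} (hA : 0 ≤ A) :
    ∃ D : ℝ × Rn n × Rn n → ℝ, MemLp D (ENNReal.ofReal p) ∧
      ∀ Γ : ℝ → ℝ, (∀ a, 0 ≤ Γ a) → (∀ a b, |Γ a - Γ b| ≤ L * |a - b|) →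
        (∀ a, Γ a ≤ A * (|a| + d)) →
        ∀ q, |gd s p (cutProfile Γ Ψ Z t₁ t₂ U) q| ≤ D q := by
  obtain ⟨CΨ, hCΨ⟩ := hΨ.bounded
  obtain ⟨CZ, hCZ0, hCZ⟩ := exists_bound_indicator hZ t₁ t₂
  have hCΨ0 : 0 ≤ CΨ := (hΨ.nonneg 0).trans (hCΨ 0)
  have h1 := hΨ.memLp_time_mul hn hs hs1 hp hB hBfin (hZ.measurable.indicator measurableSet_Icc)
    (memLp_indicator_Icc hZ t₁ t₂ (ENNReal.ofReal p))
  have h2 := hΨ.memLp_mul hn hs hs1 hp hUm hU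
  refine ⟨fun q => CZ * (CΨ * L) * |gd s p U q| + CZ * A * |U (q.1, q.2.2) * cutoffDiff s p Ψ q.2|
    + A * d * |(Icc t₁ t₂).indicator Z q.1 * cutoffDiff s p Ψ q.2|,
    ((hgd.abs.const_mul _).add (h2.abs.const_mul _)).add (h1.abs.const_mul _), ?_⟩
  intro Γ hΓ0 hΓL hΓA q
  have hL0 : 0 ≤ L := by simpa using (abs_nonneg _).trans (hΓL 1 0)
  refine (hΨ.abs_gd_mul_le hCΨ (fun q => Γ (U q)) _ q).trans ?_
  have e1 : |(Icc t₁ t₂).indicator Z q.1| * (CΨ * |gd s p (fun q => Γ (U q)) q|) ≤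
      CZ * (CΨ * L) * |gd s p U q| := by
    rw [mul_assoc, mul_assoc]
    gcongr
    · exact hCZ _
    · exact abs_gd_comp_le hΓL U q
  have e2 : |(Icc t₁ t₂).indicator Z q.1| * (|Γ (U (q.1, q.2.2))| * |cutoffDiff s p Ψ q.2|) ≤
      CZ * A * |U (q.1, q.2.2) * cutoffDiff s p Ψ q.2| +
        A * d * |(Icc t₁ t₂).indicator Z q.1 * cutoffDiff s p Ψ q.2| := by
    rw [abs_of_nonneg (hΓ0 _), abs_mul, abs_mul]
    have hz := hCZ q.1
    have hz0 := abs_nonneg ((Icc t₁ t₂).indicator Z q.1)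
    calc _ ≤ |(Icc t₁ t₂).indicator Z q.1| *
          (A * (|U (q.1, q.2.2)| + d) * |cutoffDiff s p Ψ q.2|) := by
          gcongr
          exact hΓA _
      _ = |(Icc t₁ t₂).indicator Z q.1| * A * (|U (q.1, q.2.2)| * |cutoffDiff s p Ψ q.2|) +
          A * d * (|(Icc t₁ t₂).indicator Z q.1| * |cutoffDiff s p Ψ q.2|) := by ring
      _ ≤ _ := by gcongr
  rw [mul_add]
  linarith

/-- The cap must disappear from the flux, because the pointwise inequality needs the homogeneous
profile, but it may remain in the final slice. The inequality is therefore used at caps `N' ≥ N`: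
the slice is lowered to `N` by monotonicity while `N' → ∞` in the flux. The bound `R` has to be
uniform in the cap. -/
theorem IsSubsolution.powProfile_le (hn : 1 ≤ n) (hs : 0 < s) (hs1 : s < 1) (hp : 1 < p)
    {Λ : ℝ} (hΛ : 1 ≤ Λ) {K : Rn n → Rn n → ℝ → ℝ} (hK : IsEllipticKernel s p Λ K)
    {κ : ℕ → ℝ → ℝ} {h : ℕ → ℝ} (hκ : ∀ k, IsTimeKernel (h k) (κ k))
    (hh : Tendsto h atTop (𝓝 0)) {B : Set (Rn n)} (hB : MeasurableSet B)
    (hBfin : volume B ≠ ⊤) {τ₁ τ₂ t₁ t₂ : ℝ} (h1 : τ₁ < t₁) (h2 : t₂ < τ₂) (ht : t₁ ≤ t₂)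
    {u : Rn n → ℝ → ℝ} {U : ℝ × Rn n → ℝ} (hU : IsRep s p τ₁ τ₂ u U)
    (hu : IsSubsolution s p K B τ₁ τ₂ u) {U₁ U₂ : Rn n → ℝ}
    (hU₁m : AEStronglyMeasurable U₁ (volume.restrict B))
    (hU₂m : AEStronglyMeasurable U₂ (volume.restrict B))
    (hU₁ : Tendsto (fun k => ∫⁻ x in B, ‖tmol (κ k) U (t₁, x) - U₁ x‖ₑ) atTop (𝓝 0))
    (hU₂ : Tendsto (fun k => ∫⁻ x in B, ‖tmol (κ k) U (t₂, x) - U₂ x‖ₑ) atTop (𝓝 0))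
    (hU₂0 : ∀ᵐ x ∂(volume.restrict B), 0 ≤ U₂ x)
    {Ψ : Rn n → ℝ} (hΨ : IsCutoff B Ψ) {Z : ℝ → ℝ} (hZ : ContDiff ℝ 1 Z) (hZ0 : ∀ t, 0 ≤ Z t)
    {ξ d M R : ℝ} (hξ : 1 ≤ ξ) (hd : 0 < d) (hM : 0 < M)
    (hR : ∀ N : ℕ, (∫ x in B, cappedPrimitive ξ d M N (U₁ x) * (Ψ x * Z t₁)) +
      (∫ q, cappedPrimitive ξ d M N (U q) * (Ψ q.2 * deriv Z q.1)
        ∂((volume.restrict (Ioc t₁ t₂)).prod (volume.restrict B))) ≤ R) (N : ℕ) :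
    Integrable (fun q => flux s p K U q *
        gd s p (cutProfile (powProfile ξ d M) Ψ Z t₁ t₂ U) q) ∧
      Integrable (fun x => cappedPrimitive ξ d M N (U₂ x) * (Ψ x * Z t₂)) (volume.restrict B) ∧
      (∫ q, flux s p K U q * gd s p (cutProfile (powProfile ξ d M) Ψ Z t₁ t₂ U) q) +
        ∫ x in B, cappedPrimitive ξ d M N (U₂ x) * (Ψ x * Z t₂) ≤ R := by
  have : IsFiniteMeasure (volume.restrict B) := ⟨by simpa using hBfin.lt_top⟩
  have hMξ : 0 ≤ M ^ (ξ - 1) := Real.rpow_nonneg hM.le _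
  have hUm := hU.measurable
  obtain ⟨D, hD, hdom⟩ := exists_dominating hn hs hs1 hp hB hBfin hΨ hZ.continuous t₁ t₂ hUm
    hU.memLp hU.memLp_gd (L := ξ * M ^ (ξ - 1)) (d := d) hMξ
  have hdomN : ∀ N : ℕ, ∀ q, |gd s p (cutProfile (cappedProfile ξ d M N) Ψ Z t₁ t₂ U) q| ≤ D q :=
    fun N => hdom _ (fun a => powProfile_nonneg hd hM _) (abs_cappedProfile_sub_le hξ hd hM)
      fun a => (cappedProfile_le hξ hd hM a).trans (FracParabolic.powProfile_le hξ hd hM a)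
  have hdom0 : ∀ q, |gd s p (cutProfile (powProfile ξ d M) Ψ Z t₁ t₂ U) q| ≤ D q :=
    hdom _ (fun a => powProfile_nonneg hd hM _) (abs_powProfile_sub_le hξ hd hM)
      (FracParabolic.powProfile_le hξ hd hM)
  have hF := memLp_flux hp hΛ hK hUm hU.memLp_gd
  have hcont : Continuous (powProfile ξ d M) :=
    (LipschitzWith.of_dist_le' (K := ξ * M ^ (ξ - 1)) fun a b => by
      simpa [Real.dist_eq] using abs_powProfile_sub_le hξ hd hM a b).continuous
  have hG0m : Measurable (cutProfile (powProfile ξ d M) Ψ Z t₁ t₂ U) := by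
    have h1 := hcont.measurable
    have h2 := hΨ.measurable
    have h3 : Measurable ((Icc t₁ t₂).indicator Z) :=
      hZ.continuous.measurable.indicator measurableSet_Icc
    unfold cutProfile
    fun_prop
  have hgm := measurable_gd (s := s) (p := p) hG0m
  have hFD := integrable_mul_gd hp hF.abs hD
  have hint : Integrable (fun q => flux s p K U q *
      gd s p (cutProfile (powProfile ξ d M) Ψ Z t₁ t₂ U) q) := by
    refine hFD.mono' (hF.1.mul hgm.aestronglyMeasurable) (ae_of_all _ fun q => ?_)
    rw [norm_mul]
    exact mul_le_mul_of_nonneg_left (hdom0 q) (norm_nonneg _)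
  -- Only the integrability of the limit is extracted here, so the zero weight is enough.
  have hU₂i : Integrable U₂ (volume.restrict B) :=
    ((isProfile_capped (N := N) hξ hd hM).tendsto_integral
      (fun k => hU.integrable_tmol_slice hp hBfin (hκ k) t₂) hU₂m
      (g := fun _ => 0) aestronglyMeasurable_const (C := 0) (ae_of_all _ fun _ => by simp) hU₂).1
  obtain ⟨CΨ, hCΨ⟩ := hΨ.bounded
  have hgi : ∀ N : ℕ, Integrable (fun x => cappedPrimitive ξ d M N (U₂ x) * (Ψ x * Z t₂))
      (volume.restrict B) := fun N =>
    (isProfile_capped hξ hd hM).integrable_mul hU₂i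
      (hΨ.measurable.mul_const _).aestronglyMeasurable (C := CΨ * Z t₂) (ae_of_all _ fun x => by
        rw [abs_mul, abs_of_nonneg (hΨ.nonneg x), abs_of_nonneg (hZ0 _)]
        exact mul_le_mul_of_nonneg_right (hCΨ x) (hZ0 _))
  refine ⟨hint, hgi N, ?_⟩
  have hlim : Tendsto (fun N' : ℕ => ∫ q, flux s p K U q *
      gd s p (cutProfile (cappedProfile ξ d M N') Ψ Z t₁ t₂ U) q) atTop
      (𝓝 (∫ q, flux s p K U q * gd s p (cutProfile (powProfile ξ d M) Ψ Z t₁ t₂ U) q)) := by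
    refine tendsto_integral_of_dominated_convergence _ (fun N' => ?_) hFD
      (fun N' => ae_of_all _ fun q => ?_) (ae_of_all _ fun q => ?_)
    · exact hF.1.mul (measurable_gd (measurable_cutProfile (isProfile_capped hξ hd hM) hΨ
        hZ.continuous hUm)).aestronglyMeasurable
    · rw [norm_mul]
      exact mul_le_mul_of_nonneg_left (hdomN N' q) (norm_nonneg _)
    -- At a fixed pair of points the cap is inactive as soon as it exceeds both values of `U`.
    · apply tendsto_const_nhds.congr'
      have e : ∀ a : ℝ, ∀ᶠ N' : ℕ in atTop, cappedProfile ξ d M N' a = powProfile ξ d M a := by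
        intro a
        filter_upwards [(tendsto_natCast_atTop_atTop (R := ℝ)).eventually_ge_atTop a] with N' hN'
        unfold cappedProfile
        rw [min_eq_left hN']
      filter_upwards [e (U (q.1, q.2.1)), e (U (q.1, q.2.2))] with N' hx hy
      simp only [gd, cutProfile, hx, hy]
  refine le_of_tendsto (hlim.add_const _) ?_
  filter_upwards [eventually_ge_atTop N] with N' hN'
  have hmain := hu.profile_le hn hs hs1 hp hΛ hK hκ hh hB hBfin h1 h2 ht hU hU₁m hU₂m hU₁ hU₂
    (isProfile_capped (N := N') hξ hd hM) hΨ hZ hZ0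
  have hmono : ∫ x in B, cappedPrimitive ξ d M N (U₂ x) * (Ψ x * Z t₂) ≤
      ∫ x in B, cappedPrimitive ξ d M N' (U₂ x) * (Ψ x * Z t₂) := by
    refine integral_mono_ae (hgi N) (hgi N') ?_
    filter_upwards [hU₂0] with x hx
    exact mul_le_mul_of_nonneg_right (cappedPrimitive_mono hξ hd hM (by exact_mod_cast hN') hx)
      (mul_nonneg (hΨ.nonneg x) (hZ0 _))
  linarith [hR N']

/-! ### The lower bound for the tested flux -/

/-- `|W φ(x,t) - W φ(y,t)|^p K(x,y,t)`. -/
noncomputable def energyDensity (p : ℝ) (K : Rn n → Rn n → ℝ → ℝ) (W φ : Rn n → ℝ → ℝ)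
    (q : ℝ × Rn n × Rn n) : ℝ :=
  |W q.2.1 q.1 * φ q.2.1 q.1 - W q.2.2 q.1 * φ q.2.2 q.1| ^ p * K q.2.1 q.2.2 q.1

/-- `max{w(x,t), w(y,t)}^p |φ(x,t) - φ(y,t)|^p |x - y|^(-(n+sp))`. -/
noncomputable def cutoffDensity (s p ξ : ℝ) (v φ : Rn n → ℝ → ℝ) (q : ℝ × Rn n × Rn n) : ℝ :=
  max (wPow p ξ v q.2.1 q.1) (wPow p ξ v q.2.2 q.1) ^ p * |φ q.2.1 q.1 - φ q.2.2 q.1| ^ p *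
    singKernel s p q.2.1 q.2.2

/-- `u₊(y,t)^(p-1) |x - y|^(-(n+sp)) v(x,t)^ξ φ(x,t)^p`. -/
noncomputable def tailDensity (s p ξ : ℝ) (u v φ : Rn n → ℝ → ℝ) (t : ℝ) (x y : Rn n) : ℝ :=
  max (u y t) 0 ^ (p - 1) * singKernel s p x y * (v x t ^ ξ * |φ x t| ^ p)

/-- The expression is negative only when `b > a ≥ 0`, and then `b - a ≤ b`. This is why interactions
with the exterior are controlled by the positive part of `u` alone. -/
theorem neg_le_signed_rpow (hp : 1 < p) {a b : ℝ} (ha : 0 ≤ a) :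
    -(max b 0 ^ (p - 1)) ≤ |a - b| ^ (p - 2) * (a - b) := by
  have hm : 0 ≤ max b 0 ^ (p - 1) := by positivity
  rcases le_total b a with h | h
  · have : 0 ≤ |a - b| ^ (p - 2) * (a - b) := mul_nonneg (by positivity) (sub_nonneg.2 h)
    linarith
  · have e : |a - b| ^ (p - 2) * (a - b) = -(b - a) ^ (p - 1) := by
      rw [abs_sub_comm, abs_of_nonneg (sub_nonneg.2 h)]
      have : (b - a) ^ (p - 1) = (b - a) ^ (p - 2) * (b - a) := by
        rw [← Real.rpow_add_one' (sub_nonneg.2 h) (by linarith)]; congr 1; ring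
      rw [this]; ring
    rw [e, neg_le_neg_iff]
    exact Real.rpow_le_rpow (sub_nonneg.2 h) (le_max_of_le_left (by linarith)) (by linarith)

theorem truncMul_le_rpow {r M τ : ℝ} (hr : 0 ≤ r) (hM : 0 < M) (hτ : 0 < τ) :
    truncMul r M τ ≤ τ ^ (1 + r) := by
  unfold truncMul
  rw [Real.rpow_add hτ, Real.rpow_one]
  gcongr
  exact min_le_left _ _

theorem truncMul_eq_rpow {r M τ : ℝ} (hτ : 0 < τ) (h : τ ≤ M) :
    truncMul r M τ = τ ^ (1 + r) := by
  unfold truncMul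
  rw [Real.rpow_add hτ, Real.rpow_one, min_eq_left h]

/-- The truncation of `w`. -/
noncomputable def wTrunc (p ξ M : ℝ) (v : Rn n → ℝ → ℝ) (x : Rn n) (t : ℝ) : ℝ :=
  truncMul ((ξ - 1) / p) M (v x t)

/-- The algebraic inequality multiplied by the kernel: energy and form keep `K` itself, and only the
cut-off error is estimated by the upper ellipticity bound. -/
theorem flux_lower_bound_inside (hp : 1 < p) {Λ ξ d M : ℝ} (hΛ : 1 ≤ Λ) (hξ : 1 ≤ ξ) (hd : 0 < d)
    (hM : 0 < M) {K : Rn n → Rn n → ℝ → ℝ} (hK : IsEllipticKernel s p Λ K) {u φ : Rn n → ℝ → ℝ}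
    {t : ℝ} {x y : Rn n} (hx : 0 ≤ u x t) (hy : 0 ≤ u y t) :
    (2 ^ p)⁻¹ * ξ ^ (1 - p) * energyDensity p K (wTrunc p ξ M fun x t => u x t + d) φ (t, x, y) ≤
      opA p K u x y t * (powProfile ξ d M (u x t) * |φ x t| ^ p -
        powProfile ξ d M (u y t) * |φ y t| ^ p) +
      formConst p * Λ * cutoffDensity s p ξ (fun x t => u x t + d) φ (t, x, y) := by
  have hp0 : 0 < p := by linarith
  by_cases hxy : x = y
  · subst hxy
    simp [energyDensity, cutoffDensity, hp0.ne']
  have hK0 := hK.nonneg hΛ hxy t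
  have hKΛ := hK.upper x y t hxy
  -- This exponent gives `p r = ξ - 1`, the power in the profile, and `1 + r = (p - 1 + ξ)/p`, the
  -- power defining `w`. From `1 + r ≤ ξ` comes the factor `ξ^(1-p)`.
  set r := (ξ - 1) / p with hr_def
  have hr : 0 ≤ r := div_nonneg (by linarith) hp0.le
  have hpr : p * r = ξ - 1 := by rw [hr_def]; field_simp
  have hrξ : 1 + r ≤ ξ := by
    have : r ≤ ξ - 1 := div_le_self (by linarith) hp.le
    linarith
  have ha : 0 < u x t + d := by linarith
  have hb : 0 < u y t + d := by linarith
  have hform := energy_le_form (α := φ x t) (β := φ y t) hp hr hM ha hb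
  rw [hpr] at hform
  have hexp : (p - 1 + ξ) / p = 1 + r := by rw [hr_def]; field_simp; ring
  set Wa := truncMul r M (u x t + d)
  set Wb := truncMul r M (u y t + d)
  have hWa : 0 ≤ Wa := truncMul_nonneg hM.le ha.le
  have hWm : 0 ≤ max Wa Wb := le_max_of_le_left hWa
  have hmax : max Wa Wb ^ p ≤ max ((u x t + d) ^ (1 + r)) ((u y t + d) ^ (1 + r)) ^ p :=
    Real.rpow_le_rpow hWm (max_le_max (truncMul_le_rpow hr hM ha) (truncMul_le_rpow hr hM hb))
      hp0.le
  have hξr : ξ ^ (1 - p) ≤ (1 + r) ^ (1 - p) :=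
    Real.rpow_le_rpow_of_nonpos (by linarith) hrξ (by linarith)
  simp only [energyDensity, cutoffDensity, wTrunc, wPow, hexp, opA, powProfile, max_eq_left hx,
    max_eq_left hy]
  rw [add_sub_add_right_eq_sub] at hform
  set E := |Wa * φ x t - Wb * φ y t| ^ p
  set J := |u x t - u y t| ^ (p - 2) * (u x t - u y t)
  set F := truncMul (ξ - 1) M (u x t + d) * |φ x t| ^ p -
    truncMul (ξ - 1) M (u y t + d) * |φ y t| ^ p
  set m := max ((u x t + d) ^ (1 + r)) ((u y t + d) ^ (1 + r)) ^ p
  set δ := |φ x t - φ y t| ^ p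
  have hE : 0 ≤ E := by positivity
  have hδ : 0 ≤ δ := by positivity
  have hm : 0 ≤ m := (Real.rpow_nonneg hWm _).trans hmax
  have h2p : (1 : ℝ) ≤ 2 ^ p := Real.one_le_rpow one_le_two hp0.le
  have hC := formConst_nonneg hp
  have h1 : ξ ^ (1 - p) * E ≤ 2 ^ p * (J * F) + formConst p * (m * δ) := by
    calc ξ ^ (1 - p) * E ≤ (1 + r) ^ (1 - p) * E := by gcongr
      _ ≤ _ := hform
      _ ≤ _ := by gcongr
  have h2 : (2 ^ p)⁻¹ * ξ ^ (1 - p) * E ≤ J * F + formConst p * (m * δ) := by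
    have h3 : (2 ^ p)⁻¹ * (formConst p * (m * δ)) ≤ formConst p * (m * δ) :=
      mul_le_of_le_one_left (by positivity) (inv_le_one_of_one_le₀ h2p)
    have h4 := mul_le_mul_of_nonneg_left h1 (by positivity : (0 : ℝ) ≤ (2 ^ p)⁻¹)
    rw [mul_add, ← mul_assoc (2 ^ p)⁻¹ (2 ^ p), inv_mul_cancel₀ (by positivity), one_mul] at h4
    rw [mul_assoc]
    linarith
  have h5 := mul_le_mul_of_nonneg_right h2 hK0
  have h6 : formConst p * (m * δ) * K x y t ≤ formConst p * (m * δ) * (Λ * singKernel s p x y) := by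
    gcongr
  calc _ = (2 ^ p)⁻¹ * ξ ^ (1 - p) * E * K x y t := by ring
    _ ≤ _ := h5
    _ = J * F * K x y t + formConst p * (m * δ) * K x y t := by ring
    _ ≤ J * F * K x y t + formConst p * (m * δ) * (Λ * singKernel s p x y) := by linarith
    _ = _ := by ring

/-- Two bounds, for the pair and for its reflection, because `K` is not assumed symmetric. Both lead
to the same tail density. -/
theorem flux_lower_bound_tail (hp : 1 < p) {Λ ξ d M : ℝ} (hΛ : 1 ≤ Λ) (hξ : 1 ≤ ξ) (hd : 0 < d)
    (hM : 0 < M) {K : Rn n → Rn n → ℝ → ℝ} (hK : IsEllipticKernel s p Λ K) {u φ : Rn n → ℝ → ℝ}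
    {t : ℝ} {x y : Rn n} (hx : 0 ≤ u x t) :
    -(Λ * tailDensity s p ξ u (fun x t => u x t + d) φ t x y) ≤
      opA p K u x y t * (powProfile ξ d M (u x t) * |φ x t| ^ p) ∧
    -(Λ * tailDensity s p ξ u (fun x t => u x t + d) φ t x y) ≤
      opA p K u y x t * -(powProfile ξ d M (u x t) * |φ x t| ^ p) := by
  have hk := singKernel_nonneg s p x y
  have hmax : 0 ≤ max (u y t) 0 ^ (p - 1) := by positivity
  have hv : 0 ≤ (u x t + d) ^ ξ := by positivity
  have hφ : 0 ≤ |φ x t| ^ p := by positivity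
  by_cases hxy : x = y
  · subst hxy
    have : 0 ≤ Λ * tailDensity s p ξ u (fun x t => u x t + d) φ t x x := by
      unfold tailDensity
      positivity
    simp only [opA_self, zero_mul]
    constructor <;> linarith
  have hJ := neg_le_signed_rpow hp (b := u y t) hx
  have hH0 := powProfile_nonneg (ξ := ξ) hd hM (u x t)
  have hH := powProfile_le_rpow hξ hd hM hx
  have key : ∀ k : ℝ, 0 ≤ k → k ≤ Λ * singKernel s p x y →
      -(Λ * tailDensity s p ξ u (fun x t => u x t + d) φ t x y) ≤
        k * (|u x t - u y t| ^ (p - 2) * (u x t - u y t)) *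
          (powProfile ξ d M (u x t) * |φ x t| ^ p) := by
    intro k hk0 hkΛ
    have h1 : k * max (u y t) 0 ^ (p - 1) * (powProfile ξ d M (u x t) * |φ x t| ^ p) ≤
        (Λ * singKernel s p x y) * max (u y t) 0 ^ (p - 1) * ((u x t + d) ^ ξ * |φ x t| ^ p) := by
      gcongr
    have h2 := mul_le_mul_of_nonneg_right (mul_le_mul_of_nonneg_left hJ hk0)
      (mul_nonneg hH0 hφ)
    unfold tailDensity
    linarith
  constructor
  · have := key _ (hK.nonneg hΛ hxy t) (hK.upper x y t hxy)
    unfold opA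
    rw [mul_assoc (K x y t)]
    exact this
  · have h3 := key _ (hK.nonneg hΛ (Ne.symm hxy) t) (by
      rw [singKernel_comm]; exact hK.upper y x t (Ne.symm hxy))
    unfold opA
    rw [abs_sub_comm (u y t)]
    linarith

/-! ### Iterated integrals -/

theorem lintegral_iterated_eq {F : ℝ × Rn n × Rn n → ℝ≥0∞} (hF : Measurable F) {T : Set ℝ}
    {A A' : Set (Rn n)} (hT : MeasurableSet T) (hA : MeasurableSet A) (hA' : MeasurableSet A') :
    ∫⁻ t in T, ∫⁻ x in A, ∫⁻ y in A', F (t, x, y) =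
      ∫⁻ q, (T ×ˢ A ×ˢ A').indicator F q := by
  rw [lintegral_indicator (hT.prod (hA.prod hA')), Measure.volume_eq_prod, ← Measure.prod_restrict,
    Measure.volume_eq_prod, ← Measure.prod_restrict, lintegral_prod _ hF.aemeasurable]
  congr 1; ext t
  rw [lintegral_prod _ (by fun_prop)]

theorem measurable_energyDensity {Λ : ℝ} {K : Rn n → Rn n → ℝ → ℝ}
    (hK : IsEllipticKernel s p Λ K) {W φ : Rn n → ℝ → ℝ}
    (hW : Measurable fun q : ℝ × Rn n => W q.2 q.1)
    (hφ : Measurable fun q : ℝ × Rn n => φ q.2 q.1) : Measurable (energyDensity p K W φ) := by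
  have h0 : Measurable fun q : ℝ × Rn n × Rn n => K q.2.1 q.2.2 q.1 :=
    hK.measurable.comp (g := fun q : Rn n × Rn n × ℝ => K q.1 q.2.1 q.2.2)
      (f := fun q : ℝ × Rn n × Rn n => (q.2.1, q.2.2, q.1)) (by fun_prop)
  have m1 : Measurable fun q : ℝ × Rn n × Rn n => (q.1, q.2.1) := by fun_prop
  have m2 : Measurable fun q : ℝ × Rn n × Rn n => (q.1, q.2.2) := by fun_prop
  exact ((((hW.comp m1).mul (hφ.comp m1)).sub ((hW.comp m2).mul (hφ.comp m2))).norm.pow_const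
    p).mul h0

theorem measurable_cutoffDensity {ξ : ℝ} {v φ : Rn n → ℝ → ℝ}
    (hv : Measurable fun q : ℝ × Rn n => v q.2 q.1)
    (hφ : Measurable fun q : ℝ × Rn n => φ q.2 q.1) :
    Measurable (cutoffDensity s p ξ v φ) := by
  have m1 : Measurable fun q : ℝ × Rn n × Rn n => (q.1, q.2.1) := by fun_prop
  have m2 : Measurable fun q : ℝ × Rn n × Rn n => (q.1, q.2.2) := by fun_prop
  have hw : Measurable fun q : ℝ × Rn n => wPow p ξ v q.2 q.1 := hv.pow_const _
  exact ((((hw.comp m1).max (hw.comp m2)).pow_const p).mul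
    (((hφ.comp m1).sub (hφ.comp m2)).norm.pow_const p)).mul
    (measurable_singKernel (by fun_prop) (by fun_prop))

theorem measurable_tailDensity {ξ : ℝ} {u v φ : Rn n → ℝ → ℝ}
    (hu : Measurable fun q : ℝ × Rn n => u q.2 q.1)
    (hv : Measurable fun q : ℝ × Rn n => v q.2 q.1)
    (hφ : Measurable fun q : ℝ × Rn n => φ q.2 q.1) :
    Measurable fun q : ℝ × Rn n × Rn n => tailDensity s p ξ u v φ q.1 q.2.1 q.2.2 := by
  have m1 : Measurable fun q : ℝ × Rn n × Rn n => (q.1, q.2.1) := by fun_prop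
  have m2 : Measurable fun q : ℝ × Rn n × Rn n => (q.1, q.2.2) := by fun_prop
  exact ((((hu.comp m2).max measurable_const).pow_const _).mul
    (measurable_singKernel (by fun_prop) (by fun_prop))).mul
    (((hv.comp m1).pow_const _).mul ((hφ.comp m1).norm.pow_const p))

theorem lintegral_tailDensity_le {ξ : ℝ} {u v φ : Rn n → ℝ → ℝ}
    (hv : Measurable fun q : ℝ × Rn n => v q.2 q.1)
    (hφ : Measurable fun q : ℝ × Rn n => φ q.2 q.1) {B S : Set (Rn n)} (a b : ℝ)
    (hp : 0 < p) (hS : ∀ x ∉ S, ∀ t, φ x t = 0) :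
    ∫⁻ t in Ioo a b, ∫⁻ x in B, ∫⁻ y in Bᶜ, ENNReal.ofReal (tailDensity s p ξ u v φ t x y) ≤
      tailTerm s p ξ S B a b u v φ := by
  refine lintegral_mono fun t => ?_
  have m1 : Measurable fun x : Rn n => (t, x) := by fun_prop
  have hm : Measurable fun x => ENNReal.ofReal (v x t ^ ξ * |φ x t| ^ p) :=
    (((hv.comp m1).pow_const _).mul ((hφ.comp m1).norm.pow_const p)).ennreal_ofReal
  rw [← lintegral_const_mul _ hm]
  refine lintegral_mono fun x => ?_
  by_cases hx : x ∈ S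
  · refine le_trans ?_ (mul_le_mul_left (le_iSup₂ (f := fun x (_ : x ∈ S) =>
      ∫⁻ y in Bᶜ, ENNReal.ofReal (max (u y t) 0 ^ (p - 1) * singKernel s p x y)) x hx) _)
    rw [← lintegral_mul_const' _ _ ENNReal.ofReal_ne_top]
    refine lintegral_mono fun y => ?_
    rw [← ENNReal.ofReal_mul (mul_nonneg (by positivity) (singKernel_nonneg _ _ _ _))]
    rfl
  · simp [tailDensity, hS x hx t, hp.ne']

/-! ### The Caccioppoli inequality for representatives -/

/-- Superadditivity of the lower limit keeps energy and final slice on the left of one inequality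
when both truncations are removed. -/
theorem liminf_add_liminf_le (f g : ℕ → ℝ≥0∞) :
    liminf f atTop + liminf g atTop ≤ liminf (fun k => f k + g k) atTop := by
  simp only [liminf_eq_iSup_iInf_of_nat]
  rw [ENNReal.iSup_add_iSup_of_monotone]
  · exact iSup_mono fun k => le_iInf₂ fun i hi => add_le_add (iInf₂_le i hi) (iInf₂_le i hi)
  · exact fun a b hab => le_iInf₂ fun i hi => iInf₂_le i (le_trans hab hi)
  · exact fun a b hab => le_iInf₂ fun i hi => iInf₂_le i (le_trans hab hi)

theorem lintegral_le_liminf {α : Type*} [MeasurableSpace α] {μ : Measure α} {F : ℕ → α → ℝ≥0∞}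
    {F₀ : α → ℝ≥0∞} (hF : ∀ k, AEMeasurable (F k) μ)
    (h : ∀ᵐ a ∂μ, ∀ᶠ k in atTop, F k a = F₀ a) :
    ∫⁻ a, F₀ a ∂μ ≤ liminf (fun k => ∫⁻ a, F k a ∂μ) atTop := by
  refine le_trans (le_of_eq ?_) (lintegral_liminf_le' hF)
  apply lintegral_congr_ae
  filter_upwards [h] with a ha
  exact (tendsto_const_nhds.congr' (ha.mono fun k hk => hk.symm)).liminf_eq.symm

/-- If `f` is not integrable its Bochner integral is zero by convention and the bound is trivial, so
no integrability needs to be known beforehand. -/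
theorem integral_le_toReal {α : Type*} [MeasurableSpace α] {μ : Measure α} {f : α → ℝ}
    {g : α → ℝ≥0∞} (h : ∀ᵐ a ∂μ, ENNReal.ofReal (f a) ≤ g a) (hg : ∫⁻ a, g a ∂μ ≠ ⊤) :
    ∫ a, f a ∂μ ≤ (∫⁻ a, g a ∂μ).toReal := by
  by_cases hf : Integrable f μ
  · rw [integral_eq_lintegral_pos_part_sub_lintegral_neg_part hf]
    have h1 := ENNReal.toReal_mono hg (lintegral_mono_ae h)
    have h2 : 0 ≤ (∫⁻ a, ENNReal.ofReal (-f a) ∂μ).toReal := ENNReal.toReal_nonneg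
    linarith
  · rw [integral_undef hf]
    exact ENNReal.toReal_nonneg

/-- For `p > 1` the map `a ↦ |a|^p` is continuously differentiable even at zero, so `|ψ|^p` is `C¹`
with compact support and hence Lipschitz, although `ψ` may change sign. -/
theorem isCutoff_abs_rpow (hp : 1 < p) {ψ : Rn n → ℝ} (hψ : ContDiff ℝ ∞ ψ)
    (hψc : HasCompactSupport ψ) {B : Set (Rn n)} (hB : tsupport ψ ⊆ B) :
    IsCutoff B fun x => |ψ x| ^ p := by
  have hp0 : p ≠ 0 := by linarith
  have h1 : ContDiff ℝ 1 fun x => |ψ x| ^ p :=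
    (hψ.of_le (m := 1) (by exact_mod_cast le_top)).norm_rpow hp
  have h2 : HasCompactSupport fun x => |ψ x| ^ p :=
    hψc.comp_left (g := fun a => |a| ^ p) (by simp [hp0])
  obtain ⟨C, hC⟩ := h2.exists_bound_of_continuous h1.continuous
  refine ⟨fun x => by positivity, ⟨C, fun x => (le_abs_self _).trans (hC x)⟩,
    h1.lipschitzWith_of_hasCompactSupport h2 one_ne_zero, fun x hx => ?_⟩
  simp [image_eq_zero_of_notMem_tsupport fun h => hx (hB h), hp0]

theorem gd_cutProfile_eq {u φ : Rn n → ℝ → ℝ} {ψ : Rn n → ℝ} {ζ : ℝ → ℝ}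
    (hφ : φ = fun x t => ψ x * ζ t) {K : Rn n → Rn n → ℝ → ℝ}
    {Γ : ℝ → ℝ} {t₁ t₂ t : ℝ} (ht : t ∈ Icc t₁ t₂) (x y : Rn n) :
    flux s p K (fun q => u q.2 q.1) (t, x, y) * gd s p (cutProfile Γ (fun x => |ψ x| ^ p)
      (fun t => |ζ t| ^ p) t₁ t₂ (fun q => u q.2 q.1)) (t, x, y) =
    opA p K u x y t * (Γ (u x t) * |φ x t| ^ p - Γ (u y t) * |φ y t| ^ p) := by
  rw [flux_mul_gd]
  subst hφ
  simp only [cutProfile, indicator_of_mem ht, abs_mul]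
  rw [Real.mul_rpow (abs_nonneg _) (abs_nonneg _), Real.mul_rpow (abs_nonneg _) (abs_nonneg _)]
  ring

theorem measurable_wTrunc {ξ M : ℝ} {v : Rn n → ℝ → ℝ}
    (hv : Measurable fun q : ℝ × Rn n => v q.2 q.1) :
    Measurable fun q : ℝ × Rn n => wTrunc p ξ M v q.2 q.1 := by
  unfold wTrunc truncMul
  exact hv.mul ((hv.min measurable_const).pow_const _)

/-- The truncated inequality, in extended reals. -/
theorem caccioppoli_truncated (hp : 1 < p)
    {Λ : ℝ} (hΛ : 1 ≤ Λ) {K : Rn n → Rn n → ℝ → ℝ} (hK : IsEllipticKernel s p Λ K)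
    {B : Set (Rn n)} (hB : MeasurableSet B) {t₁ t₂ : ℝ}
    {u : Rn n → ℝ → ℝ} (hum : Measurable fun q : ℝ × Rn n => u q.2 q.1)
    (hu0 : ∀ x ∈ B, ∀ t, 0 ≤ u x t)
    {ψ : Rn n → ℝ} {ζ : ℝ → ℝ} (hψ : Continuous ψ) (hζ : Continuous ζ)
    (hψB : tsupport ψ ⊆ B) {φ : Rn n → ℝ → ℝ} (hφ : φ = fun x t => ψ x * ζ t)
    {ξ d M : ℝ} (hξ : 1 ≤ ξ) (hd : 0 < d) (hM : 0 < M)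
    (hint : Integrable (fun q => flux s p K (fun q => u q.2 q.1) q *
      gd s p (cutProfile (powProfile ξ d M) (fun x => |ψ x| ^ p) (fun t => |ζ t| ^ p) t₁ t₂
        (fun q => u q.2 q.1)) q)) {a R : ℝ} (ha : 0 ≤ a)
    (hle : (∫ q, flux s p K (fun q => u q.2 q.1) q *
      gd s p (cutProfile (powProfile ξ d M) (fun x => |ψ x| ^ p) (fun t => |ζ t| ^ p) t₁ t₂
        (fun q => u q.2 q.1)) q) + a ≤ R) :
    ENNReal.ofReal ((2 ^ p)⁻¹ * ξ ^ (1 - p)) *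
      (∫⁻ q, (Ioo t₁ t₂ ×ˢ B ×ˢ B).indicator (fun q => ENNReal.ofReal
        (energyDensity p K (wTrunc p ξ M fun x t => u x t + d) φ q)) q) + ENNReal.ofReal a ≤
    ENNReal.ofReal R +
      (ENNReal.ofReal (formConst p * Λ) * cutoffTerm s p ξ B t₁ t₂ (fun x t => u x t + d) φ +
      ENNReal.ofReal (2 * Λ) * tailTerm s p ξ (tsupport ψ) B t₁ t₂ u (fun x t => u x t + d) φ) := by
  have hp0 : 0 < p := by linarith
  have hΛ0 : 0 ≤ Λ := by linarith
  have hC := formConst_nonneg hp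
  have hCΛ : 0 ≤ formConst p * Λ := by positivity
  set v : Rn n → ℝ → ℝ := fun x t => u x t + d
  set f : ℝ × Rn n × Rn n → ℝ := fun q => flux s p K (fun q => u q.2 q.1) q *
      gd s p (cutProfile (powProfile ξ d M) (fun x => |ψ x| ^ p) (fun t => |ζ t| ^ p) t₁ t₂
        (fun q => u q.2 q.1)) q
  set c₀ := (2 ^ p)⁻¹ * ξ ^ (1 - p)
  have hc₀ : 0 ≤ c₀ := by positivity
  have hvm : Measurable fun q : ℝ × Rn n => v q.2 q.1 := hum.add_const d
  have hφm : Measurable fun q : ℝ × Rn n => φ q.2 q.1 := by subst hφ; fun_prop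
  have hφ0 : ∀ x ∉ tsupport ψ, ∀ t, φ x t = 0 := fun x hx t => by
    simp [hφ, image_eq_zero_of_notMem_tsupport hx]
  have hφB : ∀ x ∉ B, ∀ t, |φ x t| ^ p = 0 := fun x hx t => by
    simp [hφ0 x (fun h => hx (hψB h)) t, hp0.ne']
  have hv0 : ∀ x ∈ B, ∀ t, 0 < v x t := fun x hx t => by
    have := hu0 x hx t
    simp only [v]; linarith
  -- the densities
  set e : ℝ × Rn n × Rn n → ℝ := (Ioo t₁ t₂ ×ˢ B ×ˢ B).indicator
    (energyDensity p K (wTrunc p ξ M v) φ)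
  set c : ℝ × Rn n × Rn n → ℝ := (Ioo t₁ t₂ ×ˢ B ×ˢ B).indicator (cutoffDensity s p ξ v φ)
  set b₁ : ℝ × Rn n × Rn n → ℝ := (Ioo t₁ t₂ ×ˢ B ×ˢ Bᶜ).indicator
    (fun q => tailDensity s p ξ u v φ q.1 q.2.1 q.2.2)
  set b₂ : ℝ × Rn n × Rn n → ℝ := (Ioo t₁ t₂ ×ˢ Bᶜ ×ˢ B).indicator
    (fun q => tailDensity s p ξ u v φ q.1 q.2.2 q.2.1)
  have hSBB : MeasurableSet (Ioo t₁ t₂ ×ˢ B ×ˢ B) := measurableSet_Ioo.prod (hB.prod hB)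
  have hSBC : MeasurableSet (Ioo t₁ t₂ ×ˢ B ×ˢ Bᶜ) := measurableSet_Ioo.prod (hB.prod hB.compl)
  have hSCB : MeasurableSet (Ioo t₁ t₂ ×ˢ Bᶜ ×ˢ B) := measurableSet_Ioo.prod (hB.compl.prod hB)
  have hcm0 : Measurable (cutoffDensity s p ξ v φ) := measurable_cutoffDensity hvm hφm
  have ht1 : Measurable fun q : ℝ × Rn n × Rn n => tailDensity s p ξ u v φ q.1 q.2.1 q.2.2 :=
    measurable_tailDensity hum hvm hφm
  have ht2 : Measurable fun q : ℝ × Rn n × Rn n => tailDensity s p ξ u v φ q.1 q.2.2 q.2.1 :=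
    ht1.comp (g := fun q : ℝ × Rn n × Rn n => tailDensity s p ξ u v φ q.1 q.2.1 q.2.2)
      (f := fun q : ℝ × Rn n × Rn n => (q.1, q.2.2, q.2.1)) (by fun_prop)
  have hcm : Measurable c := hcm0.indicator hSBB
  have hb₁m : Measurable b₁ := ht1.indicator hSBC
  have hb₂m : Measurable b₂ := ht2.indicator hSCB
  have hc0 : ∀ q, 0 ≤ c q := indicator_nonneg fun q hq => by
    have : 0 ≤ wPow p ξ v q.2.1 q.1 := Real.rpow_nonneg (hv0 _ hq.2.1 _).le _
    exact mul_nonneg (mul_nonneg (Real.rpow_nonneg (le_max_of_le_left this) _) (by positivity))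
      (singKernel_nonneg _ _ _ _)
  have htail0 : ∀ t, ∀ x ∈ B, ∀ y, 0 ≤ tailDensity s p ξ u v φ t x y := fun t x hx y => by
    have := singKernel_nonneg s p x y
    have := (hv0 x hx t).le
    unfold tailDensity
    positivity
  have hb₁0 : ∀ q, 0 ≤ b₁ q := indicator_nonneg fun q hq => htail0 _ _ hq.2.1 _
  have hb₂0 : ∀ q, 0 ≤ b₂ q := indicator_nonneg fun q hq => htail0 _ _ hq.2.2 _
  have hofReal : ∀ (S : Set (ℝ × Rn n × Rn n)) (F : ℝ × Rn n × Rn n → ℝ) (q : ℝ × Rn n × Rn n),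
      ENNReal.ofReal (S.indicator F q) = S.indicator (fun q => ENNReal.ofReal (F q)) q := by
    intro S F q
    by_cases hq : q ∈ S <;> simp [hq]
  have hIc : ∫⁻ q, ENNReal.ofReal (c q) = cutoffTerm s p ξ B t₁ t₂ v φ := by
    simp_rw [c, hofReal]
    rw [← lintegral_iterated_eq hcm0.ennreal_ofReal measurableSet_Ioo hB hB]
    rfl
  have hIb₁ : ∫⁻ q, ENNReal.ofReal (b₁ q) ≤ tailTerm s p ξ (tsupport ψ) B t₁ t₂ u v φ := by
    simp_rw [b₁, hofReal]
    rw [← lintegral_iterated_eq (F := fun q => ENNReal.ofReal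
      (tailDensity s p ξ u v φ q.1 q.2.1 q.2.2)) ht1.ennreal_ofReal measurableSet_Ioo hB hB.compl]
    exact lintegral_tailDensity_le hvm hφm _ _ hp0 hφ0
  have hIb₂ : ∫⁻ q, ENNReal.ofReal (b₂ q) ≤ tailTerm s p ξ (tsupport ψ) B t₁ t₂ u v φ := by
    simp_rw [b₂, hofReal]
    rw [← lintegral_iterated_eq (F := fun q => ENNReal.ofReal
      (tailDensity s p ξ u v φ q.1 q.2.2 q.2.1)) ht2.ennreal_ofReal measurableSet_Ioo hB.compl hB]
    refine le_trans (le_of_eq ?_) (lintegral_tailDensity_le hvm hφm _ _ hp0 hφ0)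
    congr 1; ext t
    have hmt : Measurable fun z : Rn n × Rn n => ENNReal.ofReal
        (tailDensity s p ξ u v φ t z.2 z.1) :=
      (ht2.comp (measurable_prodMk_left (x := t))).ennreal_ofReal
    exact lintegral_lintegral_swap hmt.aemeasurable
  -- the pointwise inequality
  have hpt : ∀ᵐ q, c₀ * e q ≤ f q + (formConst p * Λ * c q + Λ * b₁ q + Λ * b₂ q) := by
    -- The test function lives on the closed time interval, the energy and error terms on the open
    -- one.
    have hne : ∀ᵐ q : ℝ × Rn n × Rn n, q.1 ≠ t₁ ∧ q.1 ≠ t₂ := by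
      have : ∀ᵐ t : ℝ, t ≠ t₁ ∧ t ≠ t₂ := by
        filter_upwards [Measure.ae_ne volume t₁, Measure.ae_ne volume t₂] with t h1 h2
        exact ⟨h1, h2⟩
      exact Measure.quasiMeasurePreserving_fst.ae this
    filter_upwards [hne] with q hq
    obtain ⟨t, x, y⟩ := q
    by_cases ht : t ∈ Icc t₁ t₂
    · have ht' : t ∈ Ioo t₁ t₂ := ⟨lt_of_le_of_ne ht.1 (Ne.symm hq.1), lt_of_le_of_ne ht.2 hq.2⟩
      have hf : f (t, x, y) = _ := gd_cutProfile_eq hφ ht x y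
      -- Two interior points give the energy; exactly one gives a tail term, one for each order;
      -- with none the test function vanishes at both.
      by_cases hx : x ∈ B <;> by_cases hy : y ∈ B
      · have h := flux_lower_bound_inside (φ := φ) hp hΛ hξ hd hM hK (hu0 x hx t) (hu0 y hy t)
        simp only [e, c, b₁, b₂, indicator, mem_prod, ht', hx, hy, mem_compl_iff, not_true_eq_false,
          and_true, and_false, if_true, if_false]
        rw [hf]
        linarith
      · have h := (flux_lower_bound_tail (φ := φ) (y := y) hp hΛ hξ hd hM hK (hu0 x hx t)).1
        simp only [e, c, b₁, b₂, indicator, mem_prod, ht', hx, hy, mem_compl_iff, not_true_eq_false,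
          not_false_eq_true, and_true, and_false, if_true, if_false]
        rw [hf, hφB y hy t]
        linarith
      · have h := (flux_lower_bound_tail (φ := φ) (y := x) hp hΛ hξ hd hM hK (hu0 y hy t)).2
        simp only [e, c, b₁, b₂, indicator, mem_prod, ht', hx, hy, mem_compl_iff, not_true_eq_false,
          not_false_eq_true, and_true, and_false, if_true, if_false]
        rw [hf, hφB x hx t]
        linarith
      · simp only [e, c, b₁, b₂, indicator, mem_prod, hx, hy, and_false, false_and, if_false]
        rw [hf, hφB x hx t, hφB y hy t]
        simp
    · have ht' : t ∉ Ioo t₁ t₂ := fun h => ht ⟨h.1.le, h.2.le⟩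
      have hf : f (t, x, y) = 0 := by
        simp only [f, gd, cutProfile, indicator_of_notMem ht]
        simp
      simp only [e, c, b₁, b₂, indicator, mem_prod, ht', false_and, if_false, hf]
      simp
  set g : ℝ × Rn n × Rn n → ℝ := fun q => formConst p * Λ * c q + Λ * b₁ q + Λ * b₂ q
  have hg0 : ∀ q, 0 ≤ g q := fun q => by
    have := hc0 q
    have := hb₁0 q
    have := hb₂0 q
    positivity
  have hgm : Measurable g := by fun_prop
  have hIg : ∫⁻ q, ENNReal.ofReal (g q) ≤
      ENNReal.ofReal (formConst p * Λ) * cutoffTerm s p ξ B t₁ t₂ v φ +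
      ENNReal.ofReal (2 * Λ) * tailTerm s p ξ (tsupport ψ) B t₁ t₂ u v φ := by
    have e1 : ∀ q, ENNReal.ofReal (g q) = ENNReal.ofReal (formConst p * Λ) * ENNReal.ofReal (c q) +
        ENNReal.ofReal Λ * ENNReal.ofReal (b₁ q) + ENNReal.ofReal Λ * ENNReal.ofReal (b₂ q) := by
      intro q
      have h1 := hc0 q
      have h2 := hb₁0 q
      have h3 := hb₂0 q
      rw [← ENNReal.ofReal_mul hCΛ, ← ENNReal.ofReal_mul hΛ0, ← ENNReal.ofReal_mul hΛ0,
        ← ENNReal.ofReal_add (by positivity) (by positivity),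
        ← ENNReal.ofReal_add (by positivity) (by positivity)]
    simp_rw [e1]
    rw [lintegral_add_right _ (by fun_prop), lintegral_add_right _ (by fun_prop),
      lintegral_const_mul' _ _ ENNReal.ofReal_ne_top, lintegral_const_mul' _ _ ENNReal.ofReal_ne_top,
      lintegral_const_mul' _ _ ENNReal.ofReal_ne_top, hIc, two_mul, ENNReal.ofReal_add hΛ0 hΛ0,
      add_mul, add_assoc]
    gcongr
  refine le_trans ?_ (add_le_add_right hIg _)
  -- With infinite error terms the claim is trivial. Otherwise `g` is integrable and the pointwise
  -- inequality can be integrated as one between real integrals.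
  by_cases hgtop : ∫⁻ q, ENNReal.ofReal (g q) = ⊤
  · rw [hgtop]; simp
  have hgi : Integrable g := by
    refine ⟨hgm.aestronglyMeasurable, ?_⟩
    rw [hasFiniteIntegral_iff_ofReal (ae_of_all _ hg0)]
    exact lt_top_iff_ne_top.2 hgtop
  have he0 : ∀ᵐ q, 0 ≤ c₀ * e q := by
    refine ae_of_all _ fun q => mul_nonneg hc₀ ?_
    by_cases hq : q ∈ Ioo t₁ t₂ ×ˢ B ×ˢ B
    · simp only [e]
      rw [indicator_of_mem hq]
      unfold energyDensity
      by_cases hxy : q.2.1 = q.2.2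
      · simp [hxy, hp0.ne']
      · exact mul_nonneg (by positivity) (hK.nonneg hΛ hxy _)
    · simp only [e]
      rw [indicator_of_notMem hq]
  have hsum0 : 0 ≤ᵐ[volume] fun q => f q + g q := by
    filter_upwards [hpt, he0] with q h1 h2 using h2.trans h1
  have hE : ENNReal.ofReal c₀ * (∫⁻ q, (Ioo t₁ t₂ ×ˢ B ×ˢ B).indicator (fun q => ENNReal.ofReal
        (energyDensity p K (wTrunc p ξ M v) φ q)) q) ≤ ENNReal.ofReal ((∫ q, f q) + ∫ q, g q) := by
    have hfg : Integrable (fun q => f q + g q) := hint.add hgi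
    rw [← integral_add hint hgi, ofReal_integral_eq_lintegral_ofReal hfg hsum0,
      ← lintegral_const_mul' _ _ ENNReal.ofReal_ne_top]
    refine lintegral_mono_ae ?_
    filter_upwards [hpt] with q h1
    rw [← hofReal, ← ENNReal.ofReal_mul hc₀]
    exact ENNReal.ofReal_le_ofReal h1
  have hS0 : 0 ≤ (∫ q, f q) + ∫ q, g q := by
    rw [← integral_add hint hgi]
    exact integral_nonneg_of_ae hsum0
  have hg0' : 0 ≤ ∫ q, g q := integral_nonneg hg0
  calc _ ≤ ENNReal.ofReal ((∫ q, f q) + ∫ q, g q) + ENNReal.ofReal a := by gcongr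
    _ = ENNReal.ofReal ((∫ q, f q) + a + ∫ q, g q) := by
        rw [← ENNReal.ofReal_add hS0 ha]; congr 1; ring
    _ ≤ ENNReal.ofReal (R + ∫ q, g q) := ENNReal.ofReal_le_ofReal (by linarith)
    _ ≤ ENNReal.ofReal R + ENNReal.ofReal (∫ q, g q) := ENNReal.ofReal_add_le
    _ = _ := by rw [ofReal_integral_eq_lintegral_ofReal hgi (ae_of_all _ hg0)]

theorem deriv_abs_rpow_mul (p a : ℝ) (ζ : ℝ → ℝ) (t : ℝ) :
    deriv (fun τ => |a * ζ τ| ^ p) t = |a| ^ p * deriv (fun τ => |ζ τ| ^ p) t := by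
  simp_rw [abs_mul, Real.mul_rpow (abs_nonneg _) (abs_nonneg _)]
  exact deriv_const_mul_field _

theorem integral_cappedPrimitive_slice_le {B : Set (Rn n)} {ξ d M N : ℝ} (hξ : 1 ≤ ξ)
    (hd : 0 < d) (hM : 0 < M) {f : Rn n → ℝ} (hf : ∀ᵐ x ∂(volume.restrict B), 0 ≤ f x)
    {φ : Rn n → ℝ → ℝ} {t : ℝ} (hfin : sliceTerm p ξ B (fun x _ => f x + d) φ t ≠ ⊤) :
    ∫ x in B, cappedPrimitive ξ d M N (f x) * |φ x t| ^ p ≤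
      (sliceTerm p ξ B (fun x _ => f x + d) φ t).toReal := by
  unfold sliceTerm at hfin ⊢
  rw [← lintegral_const_mul' _ _ ENNReal.ofReal_ne_top] at hfin ⊢
  refine integral_le_toReal ?_ hfin
  filter_upwards [hf] with x hx
  rw [← ENNReal.ofReal_mul (by positivity), ← mul_assoc, one_div_mul_eq_div]
  exact ENNReal.ofReal_le_ofReal (mul_le_mul_of_nonneg_right (cappedPrimitive_le hξ hd hM hx)
    (by positivity))

/-- The signed derivative of the cut-off may be replaced by its positive part because the primitive
is nonnegative on the values of `U` in `B`. -/
theorem integral_cappedPrimitive_time_le {B : Set (Rn n)} (hB : MeasurableSet B) {ξ d M N : ℝ}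
    (hξ : 1 ≤ ξ) (hd : 0 < d) (hM : 0 < M) {U : ℝ × Rn n → ℝ} (hU : Measurable U)
    (hU0 : ∀ x ∈ B, ∀ t, 0 ≤ U (t, x)) {ψ : Rn n → ℝ} {ζ : ℝ → ℝ} (hψ : Measurable ψ)
    {φ : Rn n → ℝ → ℝ}
    (hφ : φ = fun x t => ψ x * ζ t) {t₁ t₂ : ℝ}
    (hfin : timeTerm p ξ B t₁ t₂ (fun x t => U (t, x) + d) φ ≠ ⊤) :
    ∫ q, cappedPrimitive ξ d M N (U q) * (|ψ q.2| ^ p * deriv (fun t => |ζ t| ^ p) q.1)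
        ∂((volume.restrict (Ioc t₁ t₂)).prod (volume.restrict B)) ≤
      (timeTerm p ξ B t₁ t₂ (fun x t => U (t, x) + d) φ).toReal := by
  have hm : Measurable fun q : ℝ × Rn n => ENNReal.ofReal ((U q + d) ^ (1 + ξ) *
      max (|ψ q.2| ^ p * deriv (fun t => |ζ t| ^ p) q.1) 0) := by fun_prop
  have e : timeTerm p ξ B t₁ t₂ (fun x t => U (t, x) + d) φ =
      ∫⁻ q, ENNReal.ofReal (1 / (1 + ξ)) * ENNReal.ofReal ((U q + d) ^ (1 + ξ) *
        max (|ψ q.2| ^ p * deriv (fun t => |ζ t| ^ p) q.1) 0)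
        ∂((volume.restrict (Ioc t₁ t₂)).prod (volume.restrict B)) := by
    rw [lintegral_const_mul' _ _ ENNReal.ofReal_ne_top,
      ← Measure.restrict_congr_set Ioo_ae_eq_Ioc, lintegral_prod _ hm.aemeasurable, hφ]
    simp only [timeTerm, deriv_abs_rpow_mul]
  rw [e] at hfin ⊢
  refine integral_le_toReal ?_ hfin
  rw [Measure.prod_restrict]
  filter_upwards [ae_restrict_mem (measurableSet_Ioc.prod hB)] with q hq
  have h0 := hU0 q.2 hq.2 q.1
  rw [← ENNReal.ofReal_mul (by positivity), ← mul_assoc (1 / (1 + ξ)), one_div_mul_eq_div]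
  apply ENNReal.ofReal_le_ofReal
  have h1 := cappedPrimitive_nonneg (N := N) hξ hd hM h0
  exact (mul_le_mul_of_nonneg_left (le_max_left _ _) h1).trans
    (mul_le_mul_of_nonneg_right (cappedPrimitive_le hξ hd hM h0) (le_max_right _ _))

/-- Fatou's lemma: at each pair of points the truncated density equals the true one once the level
exceeds both values of `v`. -/
theorem energy_le_liminf {Λ : ℝ} {K : Rn n → Rn n → ℝ → ℝ} (hp : 1 < p)
    (hK : IsEllipticKernel s p Λ K) {B : Set (Rn n)} (hB : MeasurableSet B) {t₁ t₂ ξ : ℝ}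
    {v φ : Rn n → ℝ → ℝ} (hv : Measurable fun q : ℝ × Rn n => v q.2 q.1)
    (hφ : Measurable fun q : ℝ × Rn n => φ q.2 q.1) (hv0 : ∀ x ∈ B, ∀ t, 0 < v x t)
    {c : ℝ≥0∞} (hc : c ≠ ⊤) :
    c * energy p ξ K B t₁ t₂ v φ ≤ liminf (fun N : ℕ => c * ∫⁻ q,
      (Ioo t₁ t₂ ×ˢ B ×ˢ B).indicator (fun q => ENNReal.ofReal
        (energyDensity p K (wTrunc p ξ (N + 1) v) φ q)) q) atTop := by
  have hw : Measurable fun q : ℝ × Rn n => wPow p ξ v q.2 q.1 := hv.pow_const _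
  have e : energy p ξ K B t₁ t₂ v φ = ∫⁻ q, (Ioo t₁ t₂ ×ˢ B ×ˢ B).indicator (fun q =>
      ENNReal.ofReal (energyDensity p K (wPow p ξ v) φ q)) q := by
    rw [← lintegral_iterated_eq (measurable_energyDensity hK hw hφ).ennreal_ofReal
      measurableSet_Ioo hB hB]
    rfl
  simp_rw [e, ← lintegral_const_mul' _ _ hc]
  have hS : MeasurableSet (Ioo t₁ t₂ ×ˢ B ×ˢ B) := measurableSet_Ioo.prod (hB.prod hB)
  refine lintegral_le_liminf (fun N => ?_) (ae_of_all _ fun q => ?_)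
  · exact (((measurable_energyDensity hK (measurable_wTrunc hv) hφ).ennreal_ofReal.indicator
      hS).const_mul c).aemeasurable
  · by_cases hq : q ∈ Ioo t₁ t₂ ×ˢ B ×ˢ B
    · have hexp : (p - 1 + ξ) / p = 1 + (ξ - 1) / p := by
        field_simp
        ring
      have key : ∀ x ∈ B, ∀ᶠ N : ℕ in atTop, wTrunc p ξ (N + 1) v x q.1 = wPow p ξ v x q.1 := by
        intro x hx
        filter_upwards [(tendsto_natCast_atTop_atTop (R := ℝ)).eventually_ge_atTop (v x q.1)]
          with N hN
        unfold wTrunc wPow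
        rw [truncMul_eq_rpow (hv0 x hx _) (by linarith), hexp]
      filter_upwards [key _ hq.2.1, key _ hq.2.2] with N h1 h2
      simp only [indicator_of_mem hq, energyDensity, h1, h2]
    · simp [hq]

theorem sliceTerm_le_liminf {B : Set (Rn n)} {ξ d : ℝ} (hξ : 1 ≤ ξ)
    (hd : 0 < d) {f : Rn n → ℝ} (hf0 : ∀ᵐ x ∂(volume.restrict B), 0 ≤ f x)
    {φ : Rn n → ℝ → ℝ} {t : ℝ}
    (hint : ∀ N : ℕ, Integrable (fun x => cappedPrimitive ξ d (N + 1) N (f x) * |φ x t| ^ p)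
      (volume.restrict B)) :
    sliceTerm p ξ B (fun x _ => f x + d) φ t ≤ liminf (fun N : ℕ => ENNReal.ofReal
      (∫ x in B, cappedPrimitive ξ d (N + 1) N (f x) * |φ x t| ^ p)) atTop := by
  have e : ∀ N : ℕ, ENNReal.ofReal
      (∫ x in B, cappedPrimitive ξ d (N + 1) N (f x) * |φ x t| ^ p) =
      ∫⁻ x in B, ENNReal.ofReal (cappedPrimitive ξ d (N + 1) N (f x) * |φ x t| ^ p) := by
    intro N
    refine ofReal_integral_eq_lintegral_ofReal (hint N) ?_
    filter_upwards [hf0] with x hx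
    exact mul_nonneg (cappedPrimitive_nonneg hξ hd (by positivity) hx) (by positivity)
  simp_rw [e]
  unfold sliceTerm
  rw [← lintegral_const_mul' _ _ ENNReal.ofReal_ne_top]
  refine lintegral_le_liminf (fun N => (hint N).1.aemeasurable.ennreal_ofReal) ?_
  filter_upwards [hf0] with x hx
  filter_upwards [(tendsto_natCast_atTop_atTop (R := ℝ)).eventually_ge_atTop (f x + d)] with N hN
  rw [← ENNReal.ofReal_mul (by positivity), ← mul_assoc, one_div_mul_eq_div,
    cappedPrimitive_eq hξ hd hx (by linarith) (by linarith)]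

/-- The Caccioppoli inequality between two instants at which the mollifications of the
representative `U` converge in `L¹(B)`. -/
theorem IsSubsolution.caccioppoli (hn : 1 ≤ n) (hs : 0 < s) (hs1 : s < 1) (hp : 1 < p)
    {Λ : ℝ} (hΛ : 1 ≤ Λ) {K : Rn n → Rn n → ℝ → ℝ} (hK : IsEllipticKernel s p Λ K)
    {κ : ℕ → ℝ → ℝ} {h : ℕ → ℝ} (hκ : ∀ k, IsTimeKernel (h k) (κ k))
    (hh : Tendsto h atTop (𝓝 0)) {B : Set (Rn n)} (hB : MeasurableSet B)
    (hBfin : volume B ≠ ⊤) {τ₁ τ₂ t₁ t₂ : ℝ} (h1 : τ₁ < t₁) (h2 : t₂ < τ₂) (ht : t₁ ≤ t₂)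
    {u : Rn n → ℝ → ℝ} {U : ℝ × Rn n → ℝ} (hU : IsRep s p τ₁ τ₂ u U)
    (hU0 : ∀ x ∈ B, ∀ t, 0 ≤ U (t, x))
    (hu : IsSubsolution s p K B τ₁ τ₂ u) {U₁ U₂ : Rn n → ℝ}
    (hU₁m : AEStronglyMeasurable U₁ (volume.restrict B))
    (hU₂m : AEStronglyMeasurable U₂ (volume.restrict B))
    (hU₁ : Tendsto (fun k => ∫⁻ x in B, ‖tmol (κ k) U (t₁, x) - U₁ x‖ₑ) atTop (𝓝 0))
    (hU₂ : Tendsto (fun k => ∫⁻ x in B, ‖tmol (κ k) U (t₂, x) - U₂ x‖ₑ) atTop (𝓝 0))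
    (hU₁0 : ∀ᵐ x ∂(volume.restrict B), 0 ≤ U₁ x) (hU₂0 : ∀ᵐ x ∂(volume.restrict B), 0 ≤ U₂ x)
    {ψ : Rn n → ℝ} {ζ : ℝ → ℝ} (hψ : ContDiff ℝ ∞ ψ) (hψc : HasCompactSupport ψ)
    (hψB : tsupport ψ ⊆ B) (hζ : ContDiff ℝ ∞ ζ) {φ : Rn n → ℝ → ℝ}
    (hφ : φ = fun x t => ψ x * ζ t) {ξ d : ℝ} (hξ : 1 ≤ ξ) (hd : 0 < d) :
    ENNReal.ofReal ((2 ^ p)⁻¹ * ξ ^ (1 - p)) *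
        energy p ξ K B t₁ t₂ (fun x t => U (t, x) + d) φ +
      sliceTerm p ξ B (fun x _ => U₂ x + d) φ t₂ ≤
    sliceTerm p ξ B (fun x _ => U₁ x + d) φ t₁ +
      timeTerm p ξ B t₁ t₂ (fun x t => U (t, x) + d) φ +
      (ENNReal.ofReal (formConst p * Λ) *
        cutoffTerm s p ξ B t₁ t₂ (fun x t => U (t, x) + d) φ +
      ENNReal.ofReal (2 * Λ) * tailTerm s p ξ (tsupport ψ) B t₁ t₂ (fun x t => U (t, x))
        (fun x t => U (t, x) + d) φ) := by
  set T := sliceTerm p ξ B (fun x _ => U₁ x + d) φ t₁ +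
      timeTerm p ξ B t₁ t₂ (fun x t => U (t, x) + d) φ
  -- If the data terms are infinite there is nothing to prove; if finite, they provide the real
  -- bound `R` that is uniform in the truncation.
  by_cases hT : T = ⊤
  · rw [hT]; simp
  obtain ⟨hT1, hT2⟩ := ENNReal.add_ne_top.1 hT
  have hZ : ContDiff ℝ 1 fun t => |ζ t| ^ p :=
    (hζ.of_le (m := 1) (by exact_mod_cast le_top)).norm_rpow hp
  have hφp : ∀ x t, |φ x t| ^ p = |ψ x| ^ p * |ζ t| ^ p := fun x t => by
    rw [hφ, abs_mul, Real.mul_rpow (abs_nonneg _) (abs_nonneg _)]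
  have hUm := hU.measurable
  have hφm : Measurable fun q : ℝ × Rn n => φ q.2 q.1 := by
    have := hψ.continuous
    have := hζ.continuous
    subst hφ
    fun_prop
  have hR : ∀ M : ℝ, 0 < M → ∀ N : ℕ,
      (∫ x in B, cappedPrimitive ξ d M N (U₁ x) * (|ψ x| ^ p * |ζ t₁| ^ p)) +
      (∫ q, cappedPrimitive ξ d M N (U q) * (|ψ q.2| ^ p * deriv (fun t => |ζ t| ^ p) q.1)
        ∂((volume.restrict (Ioc t₁ t₂)).prod (volume.restrict B))) ≤ T.toReal := by
    intro M hM N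
    have i1 := integral_cappedPrimitive_slice_le (N := N) hξ hd hM hU₁0 hT1
    have i2 := integral_cappedPrimitive_time_le (N := N) hB hξ hd hM hUm hU0
      hψ.continuous.measurable hφ hT2
    simp_rw [hφp] at i1
    rw [ENNReal.toReal_add hT1 hT2]
    exact add_le_add i1 i2
  -- Level and cap are coupled as `M = N + 1`, so a single sequence removes both; the `+ 1` keeps
  -- the level positive for `N = 0`.
  have hstep := fun N : ℕ => hu.powProfile_le hn hs hs1 hp hΛ hK hκ hh hB hBfin h1 h2 ht hU hU₁m
    hU₂m hU₁ hU₂ hU₂0 (isCutoff_abs_rpow hp hψ hψc hψB) hZ (fun t => by positivity) hξ hd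
    (by positivity : (0 : ℝ) < N + 1) (hR (N + 1) (by positivity)) N
  simp_rw [← hφp] at hstep
  have hfin : ∀ N : ℕ, _ := fun N : ℕ => caccioppoli_truncated (u := fun x t => U (t, x)) hp hΛ hK hB
    hUm hU0 hψ.continuous hζ.continuous hψB hφ hξ hd (by positivity : (0 : ℝ) < N + 1)
    (hstep N).1 (integral_nonneg_of_ae (by
      filter_upwards [hU₂0] with x hx
      exact mul_nonneg (cappedPrimitive_nonneg hξ hd (by positivity) hx) (by positivity)))
    (hstep N).2.2
  rw [ENNReal.ofReal_toReal hT] at hfin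
  refine le_trans (add_le_add (energy_le_liminf hp hK hB (by fun_prop) hφm (fun x hx t => by
    have := hU0 x hx t; positivity) ENNReal.ofReal_ne_top)
    (sliceTerm_le_liminf hξ hd hU₂0 fun N => (hstep N).2.1)) ?_
  refine (liminf_add_liminf_le _ _).trans ?_
  refine (liminf_le_liminf (Eventually.of_forall hfin)).trans ?_
  simp

/-! ### Existence of representatives -/

theorem lintegral_eq_setLIntegral {α : Type*} [MeasurableSpace α] {μ : Measure α} {S : Set α}
    (hS : MeasurableSet S) {F : α → ℝ≥0∞} (hF : ∀ a ∉ S, F a = 0) :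
    ∫⁻ a, F a ∂μ = ∫⁻ a in S, F a ∂μ := by
  rw [← lintegral_indicator hS]
  congr 1; ext a
  by_cases ha : a ∈ S <;> simp [ha, hF]

theorem lintegral_le_sobolevNorm_rpow (hp : 0 < p) (D : Set (Rn n)) (f : Rn n → ℝ) :
    ∫⁻ x in D, ENNReal.ofReal (|f x| ^ p) ≤ sobolevNorm s p D f ^ p := by
  calc _ = ((∫⁻ x in D, ENNReal.ofReal (|f x| ^ p)) ^ (1 / p)) ^ p := by
        rw [← ENNReal.rpow_mul, one_div, inv_mul_cancel₀ hp.ne', ENNReal.rpow_one]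
    _ ≤ _ := ENNReal.rpow_le_rpow le_self_add hp.le

theorem gagliardo_le_sobolevNorm_rpow (hp : 0 < p) (D : Set (Rn n)) (f : Rn n → ℝ) :
    gagliardo s p D f ≤ sobolevNorm s p D f ^ p := by
  calc _ = (gagliardo s p D f ^ (1 / p)) ^ p := by
        rw [← ENNReal.rpow_mul, one_div, inv_mul_cancel₀ hp.ne', ENNReal.rpow_one]
    _ ≤ _ := ENNReal.rpow_le_rpow le_add_self hp.le

theorem gagliardo_congr {D : Set (Rn n)} {f g : Rn n → ℝ} (h : ∀ᵐ x, f x = g x) :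
    gagliardo s p D f = gagliardo s p D g := by
  refine lintegral_congr_ae ?_
  filter_upwards [ae_restrict_of_ae h] with x hx
  refine lintegral_congr_ae ?_
  filter_upwards [ae_restrict_of_ae h] with y hy
  rw [hx, hy]

/-- The null set where `u` differs from `U` is sliced both ways: for almost every `t` the slices in
`x` agree, as the integral quantities require, and for almost every `x` the slices in `t` agree, as
mollification requires. -/
theorem exists_isRep (hp : 1 < p) {τ₁ τ₂ : ℝ} {u : Rn n → ℝ → ℝ}
    (hu : MemLpW s p univ τ₁ τ₂ u) {B : Set (Rn n)} (hB : MeasurableSet B)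
    (hu0 : ∀ᵐ q ∂((volume : Measure (Rn n × ℝ)).restrict (B ×ˢ Ioo τ₁ τ₂)), 0 ≤ u q.1 q.2) :
    ∃ U : ℝ × Rn n → ℝ, IsRep s p τ₁ τ₂ u U ∧ (∀ x ∈ B, ∀ t, 0 ≤ U (t, x)) ∧
      ∀ᵐ x, ∀ᵐ t, t ∈ Ioo τ₁ τ₂ → u x t = U (t, x) := by
  have hp0 : 0 < p := by linarith
  obtain ⟨hm, hfin⟩ := hu
  set g := hm.mk
  have hg : Measurable g := hm.stronglyMeasurable_mk.measurable
  have hT : MeasurableSet {q : ℝ × Rn n | q.1 ∈ Ioo τ₁ τ₂} := measurable_fst measurableSet_Ioo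
  have hBm : MeasurableSet {q : ℝ × Rn n | q.2 ∈ B} := measurable_snd hB
  -- Over `B` this is the positive part of the Borel version, so nonnegativity holds everywhere
  -- there; outside `B` the two arguments of the maximum coincide.
  set U : ℝ × Rn n → ℝ := {q : ℝ × Rn n | q.1 ∈ Ioo τ₁ τ₂}.indicator fun q =>
    max (g (q.2, q.1)) ({q : ℝ × Rn n | q.2 ∈ B}.indicator 0 q + {q : ℝ × Rn n | q.2 ∈ B}ᶜ.indicator
      (fun q => g (q.2, q.1)) q) with hU_def
  have hgs : Measurable fun q : ℝ × Rn n => g (q.2, q.1) := by fun_prop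
  have hUm : Measurable U := by
    refine Measurable.indicator ?_ hT
    exact hgs.max ((measurable_zero.indicator hBm).add (hgs.indicator hBm.compl))
  have hU1 : ∀ t ∈ Ioo τ₁ τ₂, ∀ x ∉ B, U (t, x) = g (x, t) := fun t ht x hx => by
    rw [hU_def, indicator_of_mem (by exact ht)]
    simp [hx]
  have hU2 : ∀ t ∈ Ioo τ₁ τ₂, ∀ x ∈ B, U (t, x) = max (g (x, t)) 0 := fun t ht x hx => by
    rw [hU_def, indicator_of_mem (by exact ht)]
    simp [hx]
  have hU3 : ∀ t ∉ Ioo τ₁ τ₂, ∀ x, U (t, x) = 0 := fun t ht x => by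
    rw [hU_def, indicator_of_notMem (by exact ht)]
  have hprod : ∀ᵐ q : Rn n × ℝ, q.2 ∈ Ioo τ₁ τ₂ → u q.1 q.2 = U (q.2, q.1) := by
    have h1 := (ae_restrict_iff' (MeasurableSet.univ.prod measurableSet_Ioo)).1 hm.ae_eq_mk
    have h2 := (ae_restrict_iff' (hB.prod measurableSet_Ioo)).1 hu0
    filter_upwards [h1, h2] with q h1 h2 ht
    have h3 := h1 ⟨mem_univ _, ht⟩
    by_cases hx : q.1 ∈ B
    · rw [hU2 _ ht _ hx, max_eq_left]
      · exact h3
      · exact (h2 ⟨hx, ht⟩).trans_eq h3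
    · rw [hU1 _ ht _ hx]
      exact h3
  rw [Measure.volume_eq_prod] at hprod
  have hx_t := Measure.ae_ae_of_ae_prod hprod
  have ht_x : ∀ᵐ t ∂(volume.restrict (Ioo τ₁ τ₂)), ∀ᵐ x, u x t = U (t, x) := by
    have h1 := (Measure.measurePreserving_swap (μ := (volume : Measure ℝ))
      (ν := (volume : Measure (Rn n)))).quasiMeasurePreserving.ae hprod
    rw [ae_restrict_iff' measurableSet_Ioo]
    filter_upwards [Measure.ae_ae_of_ae_prod h1] with t h2 ht
    filter_upwards [h2] with x hx using hx ht
  have hzero : (∫⁻ t in Ioo τ₁ τ₂, ∫⁻ x, ‖U (t, x)‖ₑ ^ p) < ⊤ := by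
    refine lt_of_le_of_lt (lintegral_mono_ae ?_) hfin
    filter_upwards [ht_x] with t ht
    refine le_trans (le_of_eq ?_) (lintegral_le_sobolevNorm_rpow hp0 _ _)
    rw [Measure.restrict_univ]
    refine lintegral_congr_ae ?_
    filter_upwards [ht] with x hx
    rw [← ofReal_abs_rpow hp0.le, hx]
  have hone : (∫⁻ t in Ioo τ₁ τ₂, gagliardo s p univ fun x => U (t, x)) < ⊤ := by
    refine lt_of_le_of_lt (lintegral_mono_ae ?_) hfin
    filter_upwards [ht_x] with t ht
    rw [← gagliardo_congr ht]
    exact gagliardo_le_sobolevNorm_rpow hp0 _ _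
  refine ⟨U, ⟨hUm, ht_x, hU3, ?_, ?_⟩, fun x hx t => ?_, hx_t⟩
  · rw [memLp_iff_lintegral hp0 hUm.aestronglyMeasurable, Measure.volume_eq_prod,
      lintegral_prod _ (by fun_prop), lintegral_eq_setLIntegral measurableSet_Ioo]
    · exact hzero
    · intro t ht
      simp [hU3 t ht, hp0]
  · rw [memLp_iff_lintegral hp0 (measurable_gd hUm).aestronglyMeasurable,
      lintegral_gd_rpow hp0 hUm, lintegral_eq_setLIntegral measurableSet_Ioo]
    · exact hone
    · intro t ht
      simp [hU3 t ht, gagliardo, hp0.ne']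
  · by_cases ht : t ∈ Ioo τ₁ τ₂
    · rw [hU2 t ht x hx]
      exact le_max_right _ _
    · rw [hU3 t ht]

/-! ### Invariance of the Caccioppoli quantities under change of representative -/

section Transfer

variable {τ₁ τ₂ t₁ t₂ : ℝ} {u : Rn n → ℝ → ℝ} {U : ℝ × Rn n → ℝ}

theorem IsRep.ae_eq_of_subset (hU : IsRep s p τ₁ τ₂ u U) (h1 : τ₁ ≤ t₁) (h2 : t₂ ≤ τ₂) :
    ∀ᵐ t ∂(volume.restrict (Ioo t₁ t₂)), ∀ᵐ x, u x t = U (t, x) :=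
  ae_restrict_of_ae_restrict_of_subset (Ioo_subset_Ioo h1 h2) hU.ae_eq

theorem IsRep.energy_eq (hU : IsRep s p τ₁ τ₂ u U) (h1 : τ₁ ≤ t₁) (h2 : t₂ ≤ τ₂) (ξ d : ℝ)
    (K : Rn n → Rn n → ℝ → ℝ) (B : Set (Rn n)) (φ : Rn n → ℝ → ℝ) :
    energy p ξ K B t₁ t₂ (fun x t => u x t + d) φ =
      energy p ξ K B t₁ t₂ (fun x t => U (t, x) + d) φ := by
  refine lintegral_congr_ae ?_
  filter_upwards [hU.ae_eq_of_subset h1 h2] with t ht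
  refine lintegral_congr_ae ?_
  filter_upwards [ae_restrict_of_ae ht] with x hx
  refine lintegral_congr_ae ?_
  filter_upwards [ae_restrict_of_ae ht] with y hy
  simp only [wPow, hx, hy]

theorem IsRep.cutoffTerm_eq (hU : IsRep s p τ₁ τ₂ u U) (h1 : τ₁ ≤ t₁) (h2 : t₂ ≤ τ₂) (ξ d : ℝ)
    (B : Set (Rn n)) (φ : Rn n → ℝ → ℝ) :
    cutoffTerm s p ξ B t₁ t₂ (fun x t => u x t + d) φ =
      cutoffTerm s p ξ B t₁ t₂ (fun x t => U (t, x) + d) φ := by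
  refine lintegral_congr_ae ?_
  filter_upwards [hU.ae_eq_of_subset h1 h2] with t ht
  refine lintegral_congr_ae ?_
  filter_upwards [ae_restrict_of_ae ht] with x hx
  refine lintegral_congr_ae ?_
  filter_upwards [ae_restrict_of_ae ht] with y hy
  simp only [wPow, hx, hy]

theorem IsRep.tailTerm_eq (hU : IsRep s p τ₁ τ₂ u U) (h1 : τ₁ ≤ t₁) (h2 : t₂ ≤ τ₂) (ξ d : ℝ)
    (S B : Set (Rn n)) (φ : Rn n → ℝ → ℝ) :
    tailTerm s p ξ S B t₁ t₂ u (fun x t => u x t + d) φ =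
      tailTerm s p ξ S B t₁ t₂ (fun x t => U (t, x)) (fun x t => U (t, x) + d) φ := by
  refine lintegral_congr_ae ?_
  filter_upwards [hU.ae_eq_of_subset h1 h2] with t ht
  congr 1
  · refine iSup_congr fun x => iSup_congr fun _ => lintegral_congr_ae ?_
    filter_upwards [ae_restrict_of_ae ht] with y hy
    rw [hy]
  · refine lintegral_congr_ae ?_
    filter_upwards [ae_restrict_of_ae ht] with x hx
    rw [hx]

theorem IsRep.timeTerm_eq (hU : IsRep s p τ₁ τ₂ u U) (h1 : τ₁ ≤ t₁) (h2 : t₂ ≤ τ₂) (ξ d : ℝ)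
    (B : Set (Rn n)) (φ : Rn n → ℝ → ℝ) :
    timeTerm p ξ B t₁ t₂ (fun x t => u x t + d) φ =
      timeTerm p ξ B t₁ t₂ (fun x t => U (t, x) + d) φ := by
  unfold timeTerm
  congr 1
  refine lintegral_congr_ae ?_
  filter_upwards [hU.ae_eq_of_subset h1 h2] with t ht
  refine lintegral_congr_ae ?_
  filter_upwards [ae_restrict_of_ae ht] with x hx
  rw [hx]

end Transfer

/-! ### Convergence of the mollifications at fixed times -/

/-- For small `h` the kernel centred at `t` vanishes outside `(τ₁, τ₂)`, so neither the zero
extension of `U` nor the values of `u` there are seen. -/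
theorem IsMollifier.timeMollify_eq_tmol {ρ : ℝ → ℝ} (hρ : IsMollifier ρ) {h t τ₁ τ₂ : ℝ}
    (hh : 0 < h) (h1 : τ₁ < t - h) (h2 : t + h < τ₂) {u : Rn n → ℝ → ℝ} {U : ℝ × Rn n → ℝ} {x : Rn n}
    (hx : ∀ᵐ t, t ∈ Ioo τ₁ τ₂ → u x t = U (t, x)) :
    timeMollify ρ h u x t = tmol (fun σ => h⁻¹ * ρ (σ / h)) U (t, x) := by
  refine integral_congr_ae ?_
  filter_upwards [hx] with σ hσ
  by_cases hmem : σ ∈ Ioo τ₁ τ₂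
  · simp only [hσ hmem]
  · have hlt : h < |t - σ| := by
      by_contra! hcon
      rw [abs_le] at hcon
      exact hmem ⟨by linarith, by linarith⟩
    have h0 : h⁻¹ * ρ ((t - σ) / h) = 0 := (hρ.isTimeKernel hh).eq_zero _ hlt
    simp only [h0, mul_zero]

theorem lintegral_enorm_le_sq {α : Type*} [MeasurableSpace α] {μ : Measure α} {f : α → ℝ}
    (hf : AEStronglyMeasurable f μ) :
    ∫⁻ a, ‖f a‖ₑ ∂μ ≤
      (∫⁻ a, ENNReal.ofReal (|f a| ^ 2) ∂μ) ^ (2⁻¹ : ℝ) * μ univ ^ (2⁻¹ : ℝ) := by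
  have h1 := eLpNorm_le_eLpNorm_mul_rpow_measure_univ (p := 1) (q := ENNReal.ofReal 2)
    (μ := μ) (by norm_num) hf
  rw [eLpNorm_one_eq_lintegral_enorm, ENNReal.toReal_ofReal (by norm_num)] at h1
  have h2 := eLpNorm_ofReal_rpow (μ := μ) (p := 2) (by norm_num) f
  have h3 : eLpNorm f (ENNReal.ofReal 2) μ =
      (∫⁻ a, ENNReal.ofReal (|f a| ^ 2) ∂μ) ^ (2⁻¹ : ℝ) := by
    have : ∀ a, ENNReal.ofReal (|f a| ^ 2) = ‖f a‖ₑ ^ (2 : ℝ) := fun a => by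
      rw [← ofReal_abs_rpow (by norm_num)]
      norm_cast
    simp_rw [this]
    rw [← h2, ← ENNReal.rpow_mul]
    norm_num
  rw [h3] at h1
  convert h1 using 3
  norm_num

/-- Convergence in `L²(B)` gives convergence in `L¹(B)` by Cauchy–Schwarz, and `L¹` is all that the
slices require. -/
theorem IsLebesgueInstant.tendsto_tmol {ρ : ℝ → ℝ} (hρ : IsMollifier ρ) {B : Set (Rn n)}
    (hBfin : volume B ≠ ⊤) {τ₁ τ₂ t : ℝ} (ht : t ∈ Ioo τ₁ τ₂) {u : Rn n → ℝ → ℝ}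
    {U : ℝ × Rn n → ℝ} (hU : Measurable U)
    (hx : ∀ᵐ x, ∀ᵐ t, t ∈ Ioo τ₁ τ₂ → u x t = U (t, x)) (hL : IsLebesgueInstant ρ B u t)
    {h : ℕ → ℝ} (hh : Tendsto h atTop (𝓝 0)) (hh0 : ∀ k, 0 < h k) :
    Tendsto (fun k => ∫⁻ x in B, ‖tmol (fun σ => (h k)⁻¹ * ρ (σ / h k)) U (t, x) - u x t‖ₑ)
      atTop (𝓝 0) := by
  have h1 : Tendsto h atTop (𝓝[>] 0) :=
    tendsto_nhdsWithin_iff.2 ⟨hh, Eventually.of_forall hh0⟩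
  have h2 := ENNReal.Tendsto.mul_const (b := volume B ^ (2⁻¹ : ℝ))
    ((hL.2.comp h1).ennrpow_const (2⁻¹ : ℝ)) (Or.inr (ENNReal.rpow_ne_top_of_nonneg (by norm_num) hBfin))
  rw [ENNReal.zero_rpow_of_pos (by norm_num), zero_mul] at h2
  refine tendsto_of_tendsto_of_tendsto_of_le_of_le' tendsto_const_nhds h2
    (Eventually.of_forall fun _ => bot_le) ?_
  have hδ : 0 < min (t - τ₁) (τ₂ - t) := lt_min (by linarith [ht.1]) (by linarith [ht.2])
  filter_upwards [hh.eventually (gt_mem_nhds hδ)] with k hk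
  have hk1 := hk.trans_le (min_le_left _ _)
  have hk2 := hk.trans_le (min_le_right _ _)
  have hm : AEStronglyMeasurable (fun x =>
      tmol (fun σ => (h k)⁻¹ * ρ (σ / h k)) U (t, x) - u x t) (volume.restrict B) := by
    refine AEStronglyMeasurable.sub ?_ hL.1
    exact ((measurable_tmol (hρ.isTimeKernel (hh0 k)).continuous.measurable hU).comp
      measurable_prodMk_left).aestronglyMeasurable
  refine (lintegral_enorm_le_sq hm).trans_eq ?_
  rw [Measure.restrict_apply_univ]
  congr 2
  refine lintegral_congr_ae ?_
  filter_upwards [ae_restrict_of_ae hx] with x hx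
  rw [hρ.timeMollify_eq_tmol (hh0 k) (by linarith) (by linarith) hx]

/-- Nonnegativity almost everywhere in space-time says nothing about a single time. It is inherited
from the mollifications: where these are nonnegative, the negative part of the limit is at most the
error. -/
theorem ae_nonneg_of_tendsto_tmol {B : Set (Rn n)} (hB : MeasurableSet B) {U : ℝ × Rn n → ℝ}
    (hU0 : ∀ x ∈ B, ∀ t, 0 ≤ U (t, x)) {h : ℕ → ℝ} {κ : ℕ → ℝ → ℝ}
    (hκ : ∀ k, IsTimeKernel (h k) (κ k)) {t : ℝ} {f : Rn n → ℝ}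
    (hf : AEStronglyMeasurable f (volume.restrict B))
    (hlim : Tendsto (fun k => ∫⁻ x in B, ‖tmol (κ k) U (t, x) - f x‖ₑ) atTop (𝓝 0)) :
    ∀ᵐ x ∂(volume.restrict B), 0 ≤ f x := by
  have hle : ∫⁻ x in B, ENNReal.ofReal (-f x) ≤ 0 := by
    refine ge_of_tendsto' hlim fun k => ?_
    refine setLIntegral_mono' hB fun x hx => ?_
    have h0 : 0 ≤ tmol (κ k) U (t, x) :=
      integral_nonneg fun σ => mul_nonneg (hU0 x hx σ) ((hκ k).nonneg _)
    rw [Real.enorm_eq_ofReal_abs]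
    exact ENNReal.ofReal_le_ofReal ((le_abs_self _).trans' (by linarith))
  have h0 := (lintegral_eq_zero_iff' hf.aemeasurable.neg.ennreal_ofReal).1 (le_antisymm hle bot_le)
  filter_upwards [h0] with x hx
  simpa using hx

theorem exists_isMollifier : ∃ ρ : ℝ → ℝ, IsMollifier ρ := by
  let b : ContDiffBump (0 : ℝ) := ⟨1 / 2, 1, by norm_num, by norm_num⟩
  refine ⟨b.normed volume, b.contDiff_normed, fun σ => b.nonneg_normed σ, fun σ => b.normed_neg σ,
    ?_, b.integral_normed⟩
  rw [b.tsupport_normed_eq, Real.closedBall_eq_Icc]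
  simp [b]

theorem exists_timeKernel_tendsto_ae (hp : 1 < p) {B : Set (Rn n)} (hBfin : volume B ≠ ⊤)
    (τ₁ τ₂ : ℝ) {U : ℝ × Rn n → ℝ} (hUm : Measurable U) (hU : MemLp U (ENNReal.ofReal p)) :
    ∃ (h : ℕ → ℝ) (κ : ℕ → ℝ → ℝ), (∀ k, IsTimeKernel (h k) (κ k)) ∧ Tendsto h atTop (𝓝 0) ∧
      ∀ᵐ t ∂(volume.restrict (Ioo τ₁ τ₂)),
        Tendsto (fun k => ∫⁻ x in B, ‖tmol (κ k) U (t, x) - U (t, x)‖ₑ) atTop (𝓝 0) := by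
  obtain ⟨ρ, hρ⟩ := exists_isMollifier
  set h : ℕ → ℝ := fun k => 1 / ((k : ℝ) + 1)
  set κ : ℕ → ℝ → ℝ := fun k σ => (h k)⁻¹ * ρ (σ / h k)
  have hκ : ∀ k, IsTimeKernel (h k) (κ k) := fun k => hρ.isTimeKernel (by positivity)
  have hh : Tendsto h atTop (𝓝 0) := tendsto_one_div_add_atTop_nhds_zero_nat
  have hm : ∀ k, Measurable fun q => tmol (κ k) U q - U q := fun k =>
    (measurable_tmol (hκ k).continuous.measurable hUm).sub hUm
  set G : ℕ → ℝ → ℝ≥0∞ := fun k t => ∫⁻ x in B, ‖tmol (κ k) U (t, x) - U (t, x)‖ₑ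
  have hGm : ∀ k, Measurable (G k) := fun k => (hm k).enorm.lintegral_prod_right'
  have hBf : IsFiniteMeasure (volume.restrict B) := ⟨by simpa using hBfin.lt_top⟩
  set μ := (volume.restrict (Ioo τ₁ τ₂)).prod (volume.restrict B)
  have hlim : Tendsto (fun k => ∫⁻ t in Ioo τ₁ τ₂, G k t) atTop (𝓝 0) := by
    have h1 := tendsto_eLpNorm_tmol_sub hp.le hUm hU hκ hh
    have hc : μ univ ^ (1 / (1 : ℝ≥0∞).toReal - 1 / (ENNReal.ofReal p).toReal) ≠ ⊤ := by
      refine ENNReal.rpow_ne_top_of_nonneg ?_ (measure_ne_top _ _)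
      rw [ENNReal.toReal_ofReal (by linarith)]
      have : 1 / p ≤ 1 := by rw [div_le_one (by linarith)]; exact hp.le
      simpa using this
    have h2 := ENNReal.Tendsto.mul_const h1 (Or.inr hc)
    rw [zero_mul] at h2
    refine tendsto_of_tendsto_of_tendsto_of_le_of_le tendsto_const_nhds h2
      (fun _ => bot_le) fun k => ?_
    have e : ∫⁻ t in Ioo τ₁ τ₂, G k t = eLpNorm (fun q => tmol (κ k) U q - U q) 1 μ := by
      rw [eLpNorm_one_eq_lintegral_enorm, lintegral_prod _ (hm k).enorm.aemeasurable]
    simp only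
    rw [e]
    refine (eLpNorm_le_eLpNorm_mul_rpow_measure_univ (q := ENNReal.ofReal p)
      (by simpa using ENNReal.ofReal_le_ofReal hp.le) (hm k).aestronglyMeasurable).trans ?_
    gcongr
    rw [Measure.volume_eq_prod]
    exact Measure.prod_mono Measure.restrict_le_self Measure.restrict_le_self
  -- A subsequence with `L¹` errors at most `2^(-j)` has summable errors, hence by Tonelli the slice
  -- errors are summable, and so tend to zero, for almost every `t`.
  have hsel : ∀ j : ℕ, ∃ k, ∫⁻ t in Ioo τ₁ τ₂, G k t ≤ 2⁻¹ ^ j ∧ j ≤ k := fun j =>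
    ((ENNReal.tendsto_nhds_zero.1 hlim _ (ENNReal.pow_pos (by simp) j)).and (eventually_ge_atTop j)).exists
  choose m hm1 hm2 using hsel
  refine ⟨fun j => h (m j), fun j => κ (m j), fun j => hκ _,
    hh.comp (tendsto_atTop_mono hm2 tendsto_id), ?_⟩
  have hsum : ∫⁻ t in Ioo τ₁ τ₂, ∑' j, G (m j) t ≠ ⊤ := by
    rw [lintegral_tsum fun j => (hGm _).aemeasurable]
    refine ne_top_of_le_ne_top ?_ (ENNReal.tsum_le_tsum hm1)
    rw [ENNReal.tsum_geometric, ENNReal.one_sub_inv_two, inv_inv]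
    norm_num
  filter_upwards [ae_lt_top (Measurable.tsum fun j => hGm _) hsum] with t ht
  exact ENNReal.tendsto_atTop_zero_of_tsum_ne_top ht.ne

/-! ### The Caccioppoli inequality -/

/-- The Caccioppoli inequality between two Lebesgue instants. -/
theorem IsSubsolution.caccioppoli_of_isLebesgueInstant (hn : 1 ≤ n) (hs : 0 < s) (hs1 : s < 1)
    (hp : 1 < p) {Λ : ℝ} (hΛ : 1 ≤ Λ) {K : Rn n → Rn n → ℝ → ℝ} (hK : IsEllipticKernel s p Λ K)
    {B : Set (Rn n)} (hB : MeasurableSet B) (hBfin : volume B ≠ ⊤) {τ₁ τ₂ : ℝ}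
    {u : Rn n → ℝ → ℝ} (hu : IsSubsolution s p K B τ₁ τ₂ u)
    (hu0 : ∀ᵐ q ∂((volume : Measure (Rn n × ℝ)).restrict (B ×ˢ Ioo τ₁ τ₂)), 0 ≤ u q.1 q.2)
    {ψ : Rn n → ℝ} {ζ : ℝ → ℝ} (hψ : ContDiff ℝ ∞ ψ) (hψc : HasCompactSupport ψ)
    (hψB : tsupport ψ ⊆ B) (hζ : ContDiff ℝ ∞ ζ) {φ : Rn n → ℝ → ℝ}
    (hφ : φ = fun x t => ψ x * ζ t) {ξ d : ℝ} (hξ : 1 ≤ ξ) (hd : 0 < d) {ρ : ℝ → ℝ}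
    (hρ : IsMollifier ρ) {t₁ t₂ : ℝ} (h1 : τ₁ < t₁) (ht : t₁ < t₂) (h2 : t₂ < τ₂)
    (hL₁ : IsLebesgueInstant ρ B u t₁) (hL₂ : IsLebesgueInstant ρ B u t₂) :
    ENNReal.ofReal ((2 ^ p)⁻¹ * ξ ^ (1 - p)) * energy p ξ K B t₁ t₂ (fun x t => u x t + d) φ +
      sliceTerm p ξ B (fun x t => u x t + d) φ t₂ ≤
    sliceTerm p ξ B (fun x t => u x t + d) φ t₁ +
      timeTerm p ξ B t₁ t₂ (fun x t => u x t + d) φ +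
      (ENNReal.ofReal (formConst p * Λ) * cutoffTerm s p ξ B t₁ t₂ (fun x t => u x t + d) φ +
      ENNReal.ofReal (2 * Λ) *
        tailTerm s p ξ (tsupport ψ) B t₁ t₂ u (fun x t => u x t + d) φ) := by
  obtain ⟨U, hU, hU0, hx⟩ := exists_isRep hp hu.mem hB hu0
  set h : ℕ → ℝ := fun k => 1 / ((k : ℝ) + 1)
  have hh : Tendsto h atTop (𝓝 0) := tendsto_one_div_add_atTop_nhds_zero_nat
  have hh0 : ∀ k, 0 < h k := fun k => by positivity
  have hκ := fun k => hρ.isTimeKernel (hh0 k)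
  have hlim₁ := hL₁.tendsto_tmol hρ hBfin ⟨h1, ht.trans h2⟩ hU.measurable hx hh hh0
  have hlim₂ := hL₂.tendsto_tmol hρ hBfin ⟨h1.trans ht, h2⟩ hU.measurable hx hh hh0
  rw [hU.energy_eq h1.le h2.le, hU.timeTerm_eq h1.le h2.le, hU.cutoffTerm_eq h1.le h2.le,
    hU.tailTerm_eq h1.le h2.le]
  exact hu.caccioppoli hn hs hs1 hp hΛ hK hκ hh hB hBfin h1 h2 ht.le hU hU0 hL₁.1 hL₂.1 hlim₁ hlim₂
    (ae_nonneg_of_tendsto_tmol hB hU0 hκ hL₁.1 hlim₁)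
    (ae_nonneg_of_tendsto_tmol hB hU0 hκ hL₂.1 hlim₂) hψ hψc hψB hζ hφ hξ hd

theorem exists_Ioo_superset_of_isCompact {a b : ℝ} (hab : a < b) {S : Set ℝ} (hS : IsCompact S)
    (h : S ⊆ Ioo a b) : ∃ α β, a < α ∧ α < β ∧ β < b ∧ S ⊆ Ioo α β := by
  rcases S.eq_empty_or_nonempty with rfl | hne
  · exact ⟨a + (b - a) / 3, b - (b - a) / 3, by linarith, by linarith, by linarith,
      empty_subset _⟩
  · obtain ⟨m, hm, hm'⟩ := hS.exists_isLeast hne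
    obtain ⟨M, hM, hM'⟩ := hS.exists_isGreatest hne
    have h1 := h hm
    have h2 := h hM
    have h3 := hm' hM
    refine ⟨(a + m) / 2, (M + b) / 2, by linarith [h1.1], by linarith [h1.1, h2.2],
      by linarith [h2.2], fun x hx => ⟨?_, ?_⟩⟩
    · linarith [h1.1, hm' hx]
    · linarith [h2.2, hM' hx]

theorem exists_mem_Ioo_of_ae {a b : ℝ} (hab : a < b) {P : ℝ → Prop}
    (h : ∀ᵐ t ∂(volume.restrict (Ioo a b)), P t) : ∃ t ∈ Ioo a b, P t := by
  have : NeBot (ae ((volume : Measure ℝ).restrict (Ioo a b))) := by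
    rw [ae_neBot, Ne, Measure.restrict_eq_zero, Real.volume_Ioo]
    simpa using hab
  exact ((ae_restrict_mem measurableSet_Ioo).and h).exists

/-- The supremum form of the Caccioppoli inequality. -/
theorem IsSubsolution.caccioppoli_essSup (hn : 1 ≤ n) (hs : 0 < s) (hs1 : s < 1)
    (hp : 1 < p) {Λ : ℝ} (hΛ : 1 ≤ Λ) {K : Rn n → Rn n → ℝ → ℝ} (hK : IsEllipticKernel s p Λ K)
    {B : Set (Rn n)} (hB : MeasurableSet B) (hBfin : volume B ≠ ⊤) {τ₁ τ₂ : ℝ} (hτ : τ₁ < τ₂)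
    {u : Rn n → ℝ → ℝ} (hu : IsSubsolution s p K B τ₁ τ₂ u)
    (hu0 : ∀ᵐ q ∂((volume : Measure (Rn n × ℝ)).restrict (B ×ˢ Ioo τ₁ τ₂)), 0 ≤ u q.1 q.2)
    {ψ : Rn n → ℝ} {ζ : ℝ → ℝ} (hψ : ContDiff ℝ ∞ ψ) (hψc : HasCompactSupport ψ)
    (hψB : tsupport ψ ⊆ B) (hζ : ContDiff ℝ ∞ ζ) (hζc : HasCompactSupport ζ)
    (hζτ : tsupport ζ ⊆ Ioo τ₁ τ₂) {φ : Rn n → ℝ → ℝ}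
    (hφ : φ = fun x t => ψ x * ζ t) {ξ d : ℝ} (hξ : 1 ≤ ξ) (hd : 0 < d) :
    ENNReal.ofReal ((2 ^ p)⁻¹ * ξ ^ (1 - p)) * energy p ξ K B τ₁ τ₂ (fun x t => u x t + d) φ ≤
      timeTerm p ξ B τ₁ τ₂ (fun x t => u x t + d) φ +
      (ENNReal.ofReal (formConst p * Λ) * cutoffTerm s p ξ B τ₁ τ₂ (fun x t => u x t + d) φ +
      ENNReal.ofReal (2 * Λ) *
        tailTerm s p ξ (tsupport ψ) B τ₁ τ₂ u (fun x t => u x t + d) φ) ∧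
    essSup (sliceTerm p ξ B (fun x t => u x t + d) φ) (volume.restrict (Ioo τ₁ τ₂)) ≤
      timeTerm p ξ B τ₁ τ₂ (fun x t => u x t + d) φ +
      (ENNReal.ofReal (formConst p * Λ) * cutoffTerm s p ξ B τ₁ τ₂ (fun x t => u x t + d) φ +
      ENNReal.ofReal (2 * Λ) *
        tailTerm s p ξ (tsupport ψ) B τ₁ τ₂ u (fun x t => u x t + d) φ) := by
  have hp0 : 0 < p := by linarith
  obtain ⟨U, hU, hU0, -⟩ := exists_isRep hp hu.mem hB hu0
  obtain ⟨h, κ, hκ, hh, hlim⟩ := exists_timeKernel_tendsto_ae hp hBfin τ₁ τ₂ hU.measurable hU.memLp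
  obtain ⟨α, β, hα, hαβ, hβ, hsupp⟩ := exists_Ioo_superset_of_isCompact hτ hζc hζτ
  have hφ0 : ∀ t ∉ Ioo α β, ∀ x, φ x t = 0 := fun t ht x => by
    rw [hφ]
    simp [image_eq_zero_of_notMem_tsupport fun hmem => ht (hsupp hmem)]
  have hslice0 : ∀ v : Rn n → ℝ → ℝ, ∀ t ∉ Ioo α β, sliceTerm p ξ B v φ t = 0 :=
    fun v t ht => by
      simp [sliceTerm, hφ0 t ht, hp0.ne']
  have hUs : ∀ t, AEStronglyMeasurable (fun x => U (t, x)) (volume.restrict B) := fun t =>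
    (hU.measurable.comp measurable_prodMk_left).aestronglyMeasurable
  have hU0' : ∀ t, ∀ᵐ x ∂(volume.restrict B), 0 ≤ U (t, x) := fun t => by
    filter_upwards [ae_restrict_mem hB] with x hx using hU0 x hx t
  -- A good starting time before the support of `ζ`: the initial slice vanishes there.
  obtain ⟨a, ha, halim⟩ := exists_mem_Ioo_of_ae hα (ae_restrict_of_ae_restrict_of_subset
    (Ioo_subset_Ioo le_rfl (hαβ.trans hβ).le) hlim)
  have haα : a ∉ Ioo α β := fun hmem => lt_irrefl _ (hmem.1.trans ha.2)
  -- the inequality started at an instant at which the cut-off vanishes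
  have key : ∀ b, a < b → b < τ₂ →
      Tendsto (fun k => ∫⁻ x in B, ‖tmol (κ k) U (b, x) - U (b, x)‖ₑ) atTop (𝓝 0) →
      ENNReal.ofReal ((2 ^ p)⁻¹ * ξ ^ (1 - p)) * energy p ξ K B a b (fun x t => u x t + d) φ +
        sliceTerm p ξ B (fun x t => U (t, x) + d) φ b ≤
      timeTerm p ξ B τ₁ τ₂ (fun x t => u x t + d) φ +
      (ENNReal.ofReal (formConst p * Λ) * cutoffTerm s p ξ B τ₁ τ₂ (fun x t => u x t + d) φ +
      ENNReal.ofReal (2 * Λ) *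
        tailTerm s p ξ (tsupport ψ) B τ₁ τ₂ u (fun x t => u x t + d) φ) := by
    intro b hab hb hblim
    have hmain := hu.caccioppoli hn hs hs1 hp hΛ hK hκ hh hB hBfin ha.1 hb hab.le hU hU0
      (hUs a) (hUs b) halim hblim (hU0' a) (hU0' b) hψ hψc hψB hζ hφ hξ hd
    rw [hslice0 _ a haα, zero_add, ← hU.energy_eq ha.1.le hb.le, ← hU.timeTerm_eq ha.1.le hb.le,
      ← hU.cutoffTerm_eq ha.1.le hb.le, ← hU.tailTerm_eq ha.1.le hb.le] at hmain
    refine hmain.trans ?_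
    have hsub : Ioo a b ⊆ Ioo τ₁ τ₂ := Ioo_subset_Ioo ha.1.le hb.le
    unfold timeTerm cutoffTerm tailTerm
    gcongr
  constructor
  -- A good final time beyond the support of `ζ`; the energy over `(a, b)` is then already the whole
  -- energy.
  · obtain ⟨b, hb, hblim⟩ := exists_mem_Ioo_of_ae hβ (ae_restrict_of_ae_restrict_of_subset
      (Ioo_subset_Ioo (hα.trans hαβ).le le_rfl) hlim)
    have hab : a < b := ha.2.trans (hαβ.trans hb.1)
    refine le_trans (le_trans ?_ le_self_add) (key b hab hb.2 hblim)
    gcongr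
    unfold energy
    rw [← lintegral_indicator measurableSet_Ioo, ← lintegral_indicator measurableSet_Ioo]
    refine lintegral_mono fun t => ?_
    by_cases ht : t ∈ Ioo α β
    · rw [indicator_of_mem (show t ∈ Ioo a b from ⟨ha.2.trans ht.1, ht.2.trans hb.1⟩)]
      exact indicator_le_self _ _ _
    · refine le_trans (le_of_eq ?_) bot_le
      refine indicator_apply_eq_zero.2 fun _ => ?_
      simp [hφ0 t ht, hp0.ne']
  · refine essSup_le_of_ae_le _ ?_
    filter_upwards [hlim, hU.ae_eq, ae_restrict_mem measurableSet_Ioo] with t htlim hteq ht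
    -- Almost every time inside the support may serve as a final time; outside it the slice term is
    -- zero.
    by_cases hmem : t ∈ Ioo α β
    · refine le_trans (le_of_eq ?_) (le_add_self.trans
        (key t (ha.2.trans hmem.1) ht.2 htlim))
      unfold sliceTerm
      congr 1
      refine lintegral_congr_ae ?_
      filter_upwards [ae_restrict_of_ae hteq] with x hx
      rw [hx]
    · rw [hslice0 _ t hmem]
      exact bot_le

end FracParabolic

/-! ### The theorem and its constant -/

open FracParabolic in
theorem lemma2p3 (n : ℕ) (hn : 1 ≤ n) (p Λ : ℝ) (hp : 1 < p) (hΛ : 1 ≤ Λ) :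
    ∃ C : ℝ, 1 ≤ C ∧
      ∀ (s : ℝ), 0 < s → s < 1 →
      ∀ (ξ : ℝ), 1 ≤ ξ →
      ∀ (K : Rn n → Rn n → ℝ → ℝ), IsEllipticKernel s p Λ K →
      ∀ (x₀ : Rn n) (r τ₁ τ₂ : ℝ), 0 < r → τ₁ < τ₂ →
      ∀ (u : Rn n → ℝ → ℝ), IsSubsolution s p K (Metric.ball x₀ r) τ₁ τ₂ u →
        (∀ᵐ q ∂((volume : Measure (Rn n × ℝ)).restrict (Metric.ball x₀ r ×ˢ Ioo τ₁ τ₂)),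
          0 ≤ u q.1 q.2) →
      ∀ (d : ℝ), 0 < d →
      ∀ (v : Rn n → ℝ → ℝ), (v = fun x t => u x t + d) →
      ∀ (ψ : Rn n → ℝ) (ζ : ℝ → ℝ),
        ContDiff ℝ ∞ ψ → HasCompactSupport ψ → tsupport ψ ⊆ Metric.ball x₀ r →
        ContDiff ℝ ∞ ζ → HasCompactSupport ζ → tsupport ζ ⊆ Ioo τ₁ τ₂ →
      ∀ (φ : Rn n → ℝ → ℝ), (φ = fun x t => ψ x * ζ t) →
        (∀ (ρ : ℝ → ℝ), IsMollifier ρ →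
          ∀ (t₁ t₂ : ℝ), τ₁ < t₁ → t₁ < t₂ → t₂ < τ₂ →
            IsLebesgueInstant ρ (Metric.ball x₀ r) u t₁ →
            IsLebesgueInstant ρ (Metric.ball x₀ r) u t₂ →
            ENNReal.ofReal (C⁻¹ * ξ ^ (1 - p)) * energy p ξ K (Metric.ball x₀ r) t₁ t₂ v φ +
                sliceTerm p ξ (Metric.ball x₀ r) v φ t₂
              ≤ sliceTerm p ξ (Metric.ball x₀ r) v φ t₁ +
                ENNReal.ofReal C * cutoffTerm s p ξ (Metric.ball x₀ r) t₁ t₂ v φ +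
                ENNReal.ofReal C * farTerm s p ξ (tsupport ψ) (Metric.ball x₀ r) t₁ t₂ v φ +
                ENNReal.ofReal C * tailTerm s p ξ (tsupport ψ) (Metric.ball x₀ r) t₁ t₂ u v φ +
                timeTerm p ξ (Metric.ball x₀ r) t₁ t₂ v φ) ∧
        (ENNReal.ofReal (ξ ^ (1 - p)) * energy p ξ K (Metric.ball x₀ r) τ₁ τ₂ v φ +
            essSup (sliceTerm p ξ (Metric.ball x₀ r) v φ) (volume.restrict (Ioo τ₁ τ₂))
          ≤ ENNReal.ofReal C * cutoffTerm s p ξ (Metric.ball x₀ r) τ₁ τ₂ v φ +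
            ENNReal.ofReal C * farTerm s p ξ (tsupport ψ) (Metric.ball x₀ r) τ₁ τ₂ v φ +
            ENNReal.ofReal C * tailTerm s p ξ (tsupport ψ) (Metric.ball x₀ r) τ₁ τ₂ u v φ +
            ENNReal.ofReal C * timeTerm p ξ (Metric.ball x₀ r) τ₁ τ₂ v φ) := by
  have hF := formConst_nonneg hp
  have h2p : (1 : ℝ) ≤ 2 ^ p := Real.one_le_rpow one_le_two (by linarith)
  set c₁ := formConst p * Λ
  set c₂ := 2 * Λ
  have hc₁ : 0 ≤ c₁ := by positivity
  have hc₂ : 0 ≤ c₂ := by positivity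
  set D : ℝ := 1 + c₁ + c₂
  have hD1 : 1 ≤ D := by simp only [D]; linarith
  have hD₁ : c₁ ≤ D := by simp only [D]; linarith
  have hD₂ : c₂ ≤ D := by simp only [D]; linarith
  have hC : ∀ c ≤ D, c ≤ (2 ^ p + 1) * D := fun c hc => hc.trans
    (le_mul_of_one_le_left (by linarith) (by linarith))
  -- `D` dominates `1` and the two error constants. In (ii) energy and supremum are bounded
  -- separately by the same right side: clearing `2^(-p)` from the energy costs `2^p`, and the
  -- supremum adds `1`.
  refine ⟨(2 ^ p + 1) * D, hC 1 hD1, ?_⟩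
  intro s hs hs1 ξ hξ K hK x₀ r τ₁ τ₂ _ hτ u hu hu0 d hd v hv ψ ζ hψ hψc hψB hζ hζc hζτ φ hφ
  subst hv
  have hBfin : volume (Metric.ball x₀ r) ≠ ⊤ := measure_ball_lt_top.ne
  refine ⟨fun ρ hρ t₁ t₂ h1 ht h2 hL₁ hL₂ => ?_, ?_⟩
  · have hmain := hu.caccioppoli_of_isLebesgueInstant hn hs hs1 hp hΛ hK Metric.isOpen_ball.measurableSet
      hBfin hu0 hψ hψc hψB hζ hφ hξ hd hρ h1 ht h2 hL₁ hL₂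
    have hinv : ((2 ^ p + 1) * D)⁻¹ ≤ (2 ^ p)⁻¹ := by
      apply inv_anti₀ (by positivity)
      nlinarith
    refine le_trans ?_ (hmain.trans ?_)
    · gcongr
    · calc _ ≤ sliceTerm p ξ (Metric.ball x₀ r) (fun x t => u x t + d) φ t₁ +
              timeTerm p ξ (Metric.ball x₀ r) t₁ t₂ (fun x t => u x t + d) φ +
              (ENNReal.ofReal ((2 ^ p + 1) * D) *
                cutoffTerm s p ξ (Metric.ball x₀ r) t₁ t₂ (fun x t => u x t + d) φ +
              ENNReal.ofReal ((2 ^ p + 1) * D) * tailTerm s p ξ (tsupport ψ) (Metric.ball x₀ r)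
                t₁ t₂ u (fun x t => u x t + d) φ) := by
            gcongr _ + (ENNReal.ofReal ?_ * _ + ENNReal.ofReal ?_ * _)
            · exact hC _ hD₁
            · exact hC _ hD₂
        -- The exterior interactions are already covered by the tail term; the far term enters by
        -- nonnegativity alone.
        _ ≤ _ + ENNReal.ofReal ((2 ^ p + 1) * D) *
              farTerm s p ξ (tsupport ψ) (Metric.ball x₀ r) t₁ t₂ (fun x t => u x t + d) φ :=
            le_self_add
        _ = _ := by ring
  · obtain ⟨hE, hA⟩ := hu.caccioppoli_essSup hn hs hs1 hp hΛ hK Metric.isOpen_ball.measurableSet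
      hBfin hτ hu0 hψ hψc hψB hζ hζc hζτ hφ hξ hd
    set E := energy p ξ K (Metric.ball x₀ r) τ₁ τ₂ (fun x t => u x t + d) φ
    set I₁ := cutoffTerm s p ξ (Metric.ball x₀ r) τ₁ τ₂ (fun x t => u x t + d) φ
    set I₃ := tailTerm s p ξ (tsupport ψ) (Metric.ball x₀ r) τ₁ τ₂ u (fun x t => u x t + d) φ
    set I₄ := timeTerm p ξ (Metric.ball x₀ r) τ₁ τ₂ (fun x t => u x t + d) φ
    have hR : I₄ + (ENNReal.ofReal c₁ * I₁ + ENNReal.ofReal c₂ * I₃) ≤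
        ENNReal.ofReal D * (I₄ + (I₁ + I₃)) := by
      rw [mul_add, mul_add]
      gcongr
      exact le_mul_of_one_le_left bot_le (by simpa using ENNReal.ofReal_le_ofReal hD1)
    have hE' : ENNReal.ofReal (ξ ^ (1 - p)) * E ≤
        ENNReal.ofReal (2 ^ p) * (ENNReal.ofReal D * (I₄ + (I₁ + I₃))) := by
      calc _ = ENNReal.ofReal (2 ^ p) * (ENNReal.ofReal ((2 ^ p)⁻¹ * ξ ^ (1 - p)) * E) := by
            rw [← mul_assoc, ← ENNReal.ofReal_mul (by positivity), ← mul_assoc,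
              mul_inv_cancel₀ (by positivity), one_mul]
        _ ≤ _ := mul_le_mul_right (hE.trans hR) _
    calc _ ≤ ENNReal.ofReal (2 ^ p) * (ENNReal.ofReal D * (I₄ + (I₁ + I₃))) +
            ENNReal.ofReal D * (I₄ + (I₁ + I₃)) := add_le_add hE' (hA.trans hR)
      _ = ENNReal.ofReal ((2 ^ p + 1) * D) * (I₄ + (I₁ + I₃)) := by
          rw [ENNReal.ofReal_mul (by positivity), ENNReal.ofReal_add (by positivity) zero_le_one,
            ENNReal.ofReal_one]
          ring
      _ ≤ _ + ENNReal.ofReal ((2 ^ p + 1) * D) *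
            farTerm s p ξ (tsupport ψ) (Metric.ball x₀ r) τ₁ τ₂ (fun x t => u x t + d) φ :=
          le_self_add
      _ = _ := by ring
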